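/- Let $M$ be a closed (compact, without boundary) smooth $n$-manifold with a smooth Riemannian metric $g$ and Riemannian volume measure $\mu_g$, let $E\to M$ be a smooth complex vector bundle of rank $r$, and let $\alpha:M\to\mathbb R$ be a smooth function with $\alpha>-1/r$. For $x\in M$ let $Herm(E_x)$ be the real vector space of Hermitian sesquilinear forms on $E_x$ and $Herm^+(E_x)$ the open cone of positive definite ones. For $h\in Herm^+(E_x)$ and $v\in Herm(E_x)$ let $h^{-1}v\in End(E_x)$ be the endomorphism with $v(a,b)=h(a,(h^{-1}v)b)$. Give $Herm^+(E_x)$ the Riemannian metric $$\langle v,w\rangle_h=tr(h^{-1}v\,h^{-1}w)+\alpha(x)\,tr(h^{-1}v)\,tr(h^{-1}w)$$ and let $d_x$ be its Riemannian distance. On the space $\Gamma(Herm^+(E))$ of smooth Hermitian metrics on $E$, an open subset of the Fréchet space $\Gamma(Herm(E))$ of smooth sections with the smooth topology, consider the $L^2$ metric $(v,w)_h=\int_M\langle v(x),w(x)\rangle_{h(x)}\,\mu_g(x)$, and let $d$ be the induced distance, i.e. the infimum of the lengths $L(c)=\int_0^1 (\dot c(t),\dot c(t))_{c(t)}^{1/2}\,dt$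 of the piecewise $C^1$ paths $c:[0,1]\to\Gamma(Herm^+(E))$ joining two given points. **Theorem 4.1.** For all $h_1,h_2\in\Gamma(Herm^+(E))$, the function $x\mapsto d_x(h_1(x),h_2(x))^2$ is $\mu_g$-integrable and $$d(h_1,h_2)=\Big(\int_M d_x(h_1(x),h_2(x))^2\,\mu_g(x)\Big)^{1/2}.$$ Moreover, for each $x$ there is a unique $v(x)\in Herm(E_x)$ with $e^{h_1(x)^{-1}v(x)}=h_1(x)^{-1}h_2(x)$; these form a smooth section $v\in\Gamma(Herm(E))$; and the path $\gamma(t)=h_1e^{t h_1^{-1}v}$, $0\le t\le 1$ (that is, $h_1^{-1}\gamma(t)=e^{t h_1^{-1}v}$), has the following properties. 1. $\gamma$ is a $C^1$ path in $\Gamma(Herm^+(E))$ from $h_1$ to $h_2$, with $\gamma(t)^{-1}\dot\gamma(t)=h_1^{-1}v$ for all $t$ (so it is a geodesic), and $d_x(\gamma(s)(x),\gamma(t)(x))=|s-t|\,d_x(h_1(x),h_2(x))$ for all $x\in M$ and $s,t\in[0,1]$. 2. $\gamma$ is a shortest path: $L(\gamma)=d(h_1,h_2)$, and $d(\gamma(s),\gamma(t))=|s-t|\,d(h_1,h_2)$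 for all $s,t\in[0,1]$. 3. $\gamma$ is the unique shortest path: every piecewise $C^1$ path $c$ in $\Gamma(Herm^+(E))$ from $h_1$ to $h_2$ with $L(c)=d(h_1,h_2)$ is of the form $c=\gamma\circ\varphi$ with $\varphi:[0,1]\to[0,1]$ continuous and nondecreasing, $\varphi(0)=0$, $\varphi(1)=1$; and $\gamma$ is the only map $c:[0,1]\to\Gamma(Herm^+(E))$ with $c(0)=h_1$, $c(1)=h_2$ and $d(c(s),c(t))=|s-t|\,d(h_1,h_2)$ for all $s,t\in[0,1]$. -/

import Mathlib

open scoped Manifold ContDiff Topology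
open Set Filter MeasureTheory Bundle

noncomputable section

/-! ### Paths, length and distance for a (possibly weak) Riemannian metric on an open subset of a
real topological vector space -/

section Paths

variable {X : Type*} [AddCommGroup X] [Module ℝ X] [TopologicalSpace X]

/-- `w` is the derivative of the curve `c` on `[a, b]` (one-sided at the endpoints) in the given
vector topology, and it is continuous there: `c` is a `C¹` curve on `[a, b]` with velocity `w`. -/
def IsC1CurveOn (c w : ℝ → X) (a b : ℝ) : Prop :=
  ContinuousOn w (Icc a b) ∧
    ∀ t ∈ Icc a b, Tendsto (slope c t) (𝓝[Icc a b \ {t}] t) (𝓝 (w t))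

/-- Piecewise `C¹` paths `[0, 1] → S` from `p` to `q`, together with their velocity (which is
determined except at the finitely many break points). Only the values on `[0, 1]` matter. -/
structure PiecewiseC1Path (S : Set X) (p q : X) where
  toFun : ℝ → X
  velocity : ℝ → X
  source : toFun 0 = p
  target : toFun 1 = q
  mem : ∀ t ∈ Icc (0 : ℝ) 1, toFun t ∈ S
  piecewise : ∃ (N : ℕ) (τ : Fin (N + 1) → ℝ), StrictMono τ ∧ τ 0 = 0 ∧ τ (Fin.last N) = 1 ∧
    ∀ i : Fin N, ∃ w : ℝ → X, IsC1CurveOn toFun w (τ i.castSucc) (τ i.succ) ∧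
      ∀ t ∈ Ioo (τ i.castSucc) (τ i.succ), velocity t = w t

/-- The length of a path, where `nrm p v` is the norm of the tangent vector `v` at the point `p`. -/
def PiecewiseC1Path.length {S : Set X} {p q : X} (nrm : X → X → ℝ) (c : PiecewiseC1Path S p q) :
    ℝ :=
  ∫ t in (0 : ℝ)..1, nrm (c.toFun t) (c.velocity t)

/-- The path-length distance on `S`: the infimum of the lengths of piecewise `C¹` paths in `S`. -/
def pathDist (S : Set X) (nrm : X → X → ℝ) (p q : X) : ℝ :=
  ⨅ c : PiecewiseC1Path S p q, c.length nrm

end Paths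

/-! ### Hermitian forms on a complex vector space -/

section Fiber

variable {V : Type*} [AddCommGroup V] [Module ℂ V]

variable (V) in
/-- The real vector space of Hermitian sesquilinear forms on `V`
(linear in the first variable, conjugate-linear in the second one). -/
def Herm : Submodule ℝ (V →ₗ[ℂ] V →ₗ⋆[ℂ] ℂ) where
  carrier := {v | ∀ a b, v b a = starRingEnd ℂ (v a b)}
  add_mem' := by
    intro v w hv hw a b
    simp [hv a b, hw a b]
  zero_mem' := by
    intro a b
    simp
  smul_mem' := by
    intro c v hv a b
    simp [hv a b]

/-- The topology of pointwise convergence on `Herm V`; when `V` is finite-dimensional this is the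
usual topology of the finite-dimensional real vector space `Herm V`. -/
instance Herm.instTopologicalSpace : TopologicalSpace (Herm V) :=
  TopologicalSpace.induced (fun (v : Herm V) (p : V × V) ↦ v.1 p.1 p.2) inferInstance

variable (V) in
/-- The positive definite Hermitian forms. -/
def HermPos : Set (Herm V) := {h | ∀ a : V, a ≠ 0 → 0 < (h.1 a a).re}

/-- If `h` is positive definite and `V` is finite-dimensional, every sesquilinear form `v` can be
written as `v(a, b) = h(a, A b)` for a unique endomorphism `A`. -/
theorem HermPos.existsUnique_endo [FiniteDimensional ℂ V] {h : Herm V} (hh : h ∈ HermPos V)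
    (v : V →ₗ[ℂ] V →ₗ⋆[ℂ] ℂ) : ∃! A : Module.End ℂ V, ∀ a b, v a b = h.1 a (A b) := by
  have key : ∀ c c' : V, (∀ a, h.1 a c = h.1 a c') → c = c' := by
    intro c c' hc
    by_contra hne
    have := hh (c - c') (sub_ne_zero.mpr hne)
    rw [map_sub (h.1 (c - c')), hc, sub_self] at this
    simp at this
  let T : V →ₗ[ℝ] (V →ₗ[ℂ] ℂ) :=
    { toFun := fun c ↦
        { toFun := fun a ↦ h.1 a c
          map_add' := by intros; simp
          map_smul' := by intros; simp }
      map_add' := by intro c c'; ext a; simp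
      map_smul' := by
        intro t c
        ext a
        simp [← Complex.coe_smul] }
  have hT : Function.Injective T := fun c c' hc ↦ key c c' fun a ↦ DFunLike.congr_fun hc a
  have : FiniteDimensional ℝ V := FiniteDimensional.complexToReal V
  have : FiniteDimensional ℝ (V →ₗ[ℂ] ℂ) := FiniteDimensional.complexToReal _
  have hfr : Module.finrank ℝ V = Module.finrank ℝ (V →ₗ[ℂ] ℂ) := by
    rw [finrank_real_of_complex, finrank_real_of_complex]
    congr 1
    exact (Subspace.dual_finrank_eq (K := ℂ) (V := V)).symm
  have hsurj : Function.Surjective T :=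
    (LinearMap.injective_iff_surjective_of_finrank_eq_finrank hfr).1 hT
  have hex : ∀ b : V, ∃ c : V, ∀ a, v a b = h.1 a c := by
    intro b
    obtain ⟨c, hc⟩ := hsurj
      { toFun := fun a ↦ v a b
        map_add' := by intros; simp
        map_smul' := by intros; simp }
    exact ⟨c, fun a ↦ (DFunLike.congr_fun hc a).symm⟩
  choose A hA using hex
  refine ⟨{ toFun := A, map_add' := ?_, map_smul' := ?_ }, fun a b ↦ hA b a, ?_⟩
  · intro b b'
    refine key _ _ fun a ↦ ?_
    rw [map_add (h.1 a), ← hA, ← hA, ← hA, map_add]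
  · intro t b
    refine key _ _ fun a ↦ ?_
    rw [RingHom.id_apply, LinearMap.map_smulₛₗ (h.1 a), ← hA, ← hA, LinearMap.map_smulₛₗ]
  · intro B hB
    ext b
    refine key _ _ fun a ↦ ?_
    rw [← hB]
    exact hA b a

open Classical in
/-- The endomorphism `h⁻¹v`, characterized by `v(a, b) = h(a, (h⁻¹v) b)`. -/
def hInv (h v : Herm V) : Module.End ℂ V :=
  if H : ∃ A : Module.End ℂ V, ∀ a b, v.1 a b = h.1 a (A b) then H.choose else 0

theorem hInv_spec [FiniteDimensional ℂ V] {h : Herm V} (hh : h ∈ HermPos V) (v : Herm V) (a b : V) :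
    v.1 a b = h.1 a (hInv h v b) := by
  have H : ∃ A : Module.End ℂ V, ∀ a b, v.1 a b = h.1 a (A b) :=
    (HermPos.existsUnique_endo hh v.1).exists
  rw [hInv, dif_pos H]
  exact H.choose_spec a b

/-- The inner product `⟨v, w⟩_h = tr(h⁻¹v · h⁻¹w) + α tr(h⁻¹v) tr(h⁻¹w)` of tangent vectors
`v, w` at `h` (this complex number is real when `h` is positive definite). -/
def fiberInner (α : ℝ) (h v w : Herm V) : ℝ :=
  (LinearMap.trace ℂ V (hInv h v * hInv h w) +
    (α : ℂ) * LinearMap.trace ℂ V (hInv h v) * LinearMap.trace ℂ V (hInv h w)).re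

/-- The norm of the tangent vector `v` at the point `h` of the space of positive definite forms. -/
def fiberNorm (α : ℝ) (h v : Herm V) : ℝ := √(fiberInner α h v v)

/-- The Riemannian distance on the space of positive definite Hermitian forms on `V`. -/
def fiberDist (α : ℝ) (h₁ h₂ : Herm V) : ℝ := pathDist (HermPos V) (fiberNorm α) h₁ h₂

/-- The exponential of an endomorphism of a finite-dimensional complex vector space, computed
through its matrix in some basis (the result does not depend on the basis). -/
def endExp [FiniteDimensional ℂ V] (A : Module.End ℂ V) : Module.End ℂ V :=
  Matrix.toLin (Module.finBasis ℂ V) (Module.finBasis ℂ V)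
    (NormedSpace.exp (LinearMap.toMatrix (Module.finBasis ℂ V) (Module.finBasis ℂ V) A))

end Fiber

/-! ### The Riemannian volume measure -/

section Volume

variable {n : ℕ} {M : Type*} [TopologicalSpace M] [ChartedSpace (EuclideanSpace ℝ (Fin n)) M]
  [IsManifold (𝓡 n) ∞ M]

/-- The Gram matrix `g(∂ᵢ, ∂ⱼ)` of a Riemannian metric in the preferred chart at `x₀`, as a
function on the target of this chart. -/
def chartGram
    (g : ContMDiffRiemannianMetric (𝓡 n) ∞ (EuclideanSpace ℝ (Fin n))
      (fun x : M ↦ TangentSpace (𝓡 n) x))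
    (x₀ : M) (y : EuclideanSpace ℝ (Fin n)) : Matrix (Fin n) (Fin n) ℝ :=
  Matrix.of fun i j ↦
    g.inner ((extChartAt (𝓡 n) x₀).symm y)
      (mfderiv 𝓘(ℝ, EuclideanSpace ℝ (Fin n)) (𝓡 n) (extChartAt (𝓡 n) x₀).symm y
        (EuclideanSpace.single i 1 : EuclideanSpace ℝ (Fin n)))
      (mfderiv 𝓘(ℝ, EuclideanSpace ℝ (Fin n)) (𝓡 n) (extChartAt (𝓡 n) x₀).symm y
        (EuclideanSpace.single j 1 : EuclideanSpace ℝ (Fin n)))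

variable [MeasurableSpace M]

/-- The Riemannian volume on the domain of the preferred chart at `x₀`: the image under the inverse
chart of the measure `√(det g(∂ᵢ, ∂ⱼ)) dy` on the target of the chart. -/
def chartVolume
    (g : ContMDiffRiemannianMetric (𝓡 n) ∞ (EuclideanSpace ℝ (Fin n))
      (fun x : M ↦ TangentSpace (𝓡 n) x))
    (x₀ : M) : Measure M :=
  Measure.map (extChartAt (𝓡 n) x₀).symm
    ((volume.restrict (extChartAt (𝓡 n) x₀).target).withDensity
      fun y ↦ ENNReal.ofReal √(chartGram g x₀ y).det)

variable [T2Space M] [SigmaCompactSpace M]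

/-- The Riemannian volume measure `μ_g`, glued from the volumes in charts with a smooth partition
of unity subordinate to the chart domains (it does not depend on the partition). -/
def riemannianVolume
    (g : ContMDiffRiemannianMetric (𝓡 n) ∞ (EuclideanSpace ℝ (Fin n))
      (fun x : M ↦ TangentSpace (𝓡 n) x)) : Measure M :=
  Measure.sum fun x₀ : M ↦ (chartVolume g x₀).withDensity fun x ↦
    ENNReal.ofReal
      ((SmoothPartitionOfUnity.exists_isSubordinate_chartAt_source (𝓡 n) M).choose x₀ x)

end Volume

/-! ### Smooth sections of the bundle of Hermitian forms, with the smooth topology -/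

section Sections

variable (n : ℕ) {M : Type*} [TopologicalSpace M] [ChartedSpace (EuclideanSpace ℝ (Fin n)) M]
  (F : Type*) [NormedAddCommGroup F] [NormedSpace ℂ F]
  (E : M → Type*) [∀ x, AddCommGroup (E x)] [∀ x, Module ℂ (E x)]
  [TopologicalSpace (TotalSpace F E)] [∀ x, TopologicalSpace (E x)] [FiberBundle F E]

variable {E} in
/-- The coefficient `x ↦ v_x(e_u(x), e_w(x))` of a family `v` of sesquilinear forms, where `e_u`,
`e_w` are the local sections of `E` that are constant equal to `u`, `w` in the preferred
trivialization around `x₀`. With `u`, `w` running through a basis of the model fiber these are the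
entries of the matrix of `v` in a local frame. -/
def localCoeff (v : ∀ x, E x →ₗ[ℂ] E x →ₗ⋆[ℂ] ℂ) (x₀ : M) (u w : F) (x : M) : ℂ :=
  v x ((trivializationAt F E x₀).symm x u) ((trivializationAt F E x₀).symm x w)

/-- The smooth sections of the bundle of Hermitian forms, among all families of sesquilinear forms on
the fibers: each form is Hermitian, and the coefficients with respect to local frames are smooth. -/
def smoothHermSubmodule : Submodule ℝ (∀ x, E x →ₗ[ℂ] E x →ₗ⋆[ℂ] ℂ) where
  carrier := {v | (∀ x, v x ∈ Herm (E x)) ∧ ∀ (x₀ : M) (u w : F),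
    ContMDiffOn (𝓡 n) 𝓘(ℝ, ℂ) ∞ (localCoeff F v x₀ u w) (trivializationAt F E x₀).baseSet}
  add_mem' := by
    intro v w hv hw
    exact ⟨fun x ↦ (Herm (E x)).add_mem (hv.1 x) (hw.1 x),
      fun x₀ a b ↦ (hv.2 x₀ a b).add (hw.2 x₀ a b)⟩
  zero_mem' := ⟨fun x ↦ (Herm (E x)).zero_mem, fun x₀ a b ↦ contMDiffOn_const (c := (0 : ℂ))⟩
  smul_mem' := by
    intro c v hv
    refine ⟨fun x ↦ (Herm (E x)).smul_mem c (hv.1 x), fun x₀ a b ↦ ?_⟩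
    have hc : ContMDiffOn (𝓡 n) 𝓘(ℝ, ℝ) ∞ (fun _ : M ↦ c) (trivializationAt F E x₀).baseSet :=
      contMDiffOn_const
    have := hc.smul (hv.2 x₀ a b)
    exact this

/-- The space of smooth sections of the bundle of Hermitian forms on `E`. -/
def HermSection : Type _ := smoothHermSubmodule n F E

instance HermSection.instAddCommGroup : AddCommGroup (HermSection n F E) :=
  inferInstanceAs (AddCommGroup (smoothHermSubmodule n F E))

instance HermSection.instModule : Module ℝ (HermSection n F E) :=
  inferInstanceAs (Module ℝ (smoothHermSubmodule n F E))

variable {n F E}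

/-- The value of a section at a point. -/
def HermSection.val (v : HermSection n F E) (x : M) : Herm (E x) := ⟨v.1 x, v.2.1 x⟩

variable (n F E) in
/-- The part of the target of the preferred chart at `x₀` over which the preferred trivialization
of `E` around `x₀` is defined. -/
def chartDomain (x₀ : M) : Set (EuclideanSpace ℝ (Fin n)) :=
  (extChartAt (𝓡 n) x₀).target ∩
    (extChartAt (𝓡 n) x₀).symm ⁻¹' (trivializationAt F E x₀).baseSet

/-- The smooth (Fréchet) topology on the space of sections: uniform convergence, on compact subsets
of chart domains, of the partial derivatives of all orders of the coefficients in local frames. -/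
instance HermSection.instTopologicalSpace : TopologicalSpace (HermSection n F E) :=
  TopologicalSpace.induced
    (fun (v : HermSection n F E) (p : M × F × F × ℕ) ↦
      UniformOnFun.ofFun {K | IsCompact K ∧ K ⊆ chartDomain n F E p.1}
        (iteratedFDeriv ℝ p.2.2.2
          (localCoeff F v.1 p.1 p.2.1 p.2.2.1 ∘ (extChartAt (𝓡 n) p.1).symm)))
    inferInstance

variable (n F E) in
/-- The space of smooth Hermitian metrics on `E`: the positive definite smooth sections. -/
def HermMetric : Set (HermSection n F E) := {h | ∀ x, h.val x ∈ HermPos (E x)}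

variable [MeasurableSpace M]

/-- The `L²` inner product `(v, w)_h = ∫ ⟨v(x), w(x)⟩_{h(x)} dμ(x)`, where the fiber over `x`
carries the inner product with parameter `α x`. -/
def sectionInner (μ : Measure M) (α : M → ℝ) (h v w : HermSection n F E) : ℝ :=
  ∫ x, fiberInner (α x) (h.val x) (v.val x) (w.val x) ∂μ

/-- The `L²` norm of a tangent vector `v` at `h`. -/
def sectionNorm (μ : Measure M) (α : M → ℝ) (h v : HermSection n F E) : ℝ :=
  √(sectionInner μ α h v v)

/-- The distance on the space of Hermitian metrics induced by the `L²` metric. -/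
def sectionDist (μ : Measure M) (α : M → ℝ) (h₁ h₂ : HermSection n F E) : ℝ :=
  pathDist (HermMetric n F E) (sectionNorm μ α) h₁ h₂

end Sections

end

/-!
The squared `L²` distance on Hermitian metrics is computed from an explicit function, and everything
else about distances, geodesics and shortest paths follows from one convexity inequality for it.

On positive definite matrices put `q(P, Q) = ∑ (log λᵢ)² + α (∑ log λᵢ)²`, where the `λᵢ` are the
eigenvalues of `P⁻¹ Q`. The curve `Γ(t) = P exp (t P⁻¹ X)` with `exp (P⁻¹ X) = P⁻¹ Q` joins `P` to
`Q` with constant speed `√q(P, Q)`, and `q` satisfies the CAT(0) inequality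
`q(R, Γ(t)) ≤ (1 - t) q(R, P) + t q(R, Q) - t (1 - t) q(P, Q)`.
By congruence invariance this reduces to the exponential metric increasing property
`tr (X - Y)² ≤ q₀(exp X, exp Y)`, where `q₀` is `q` with `α = 0`; the term with `α` is
the square of a function which is affine along `Γ`. Moreover `q(P, P + ε M) / ε²` is bounded by a
continuous function of `P`, `P + ε M` and `M` which at `ε = 0` is the squared norm of `M` at `P`.

An abstract argument (`IsCATZeroSqDist`) draws the conclusions: the CAT(0) inequality gives the
triangle inequality for `√q`, the infinitesimal bound then gives `√q ≤` length for every piecewise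
`C¹` path, and `Γ` attains equality. A point with distances `t √q` and `(1 - t) √q` to the endpoints
has to be `Γ(t)`, again by the CAT(0) inequality, and this gives both uniqueness statements.

The abstract argument is used twice: in a fiber (`fiber_isCATZeroSqDist`), where it identifies
`fiberDist` with `√q`, and for the integral of `q` over `M` (`section_isCATZeroSqDist`). Integration
preserves the CAT(0) inequality, and the geodesics of the space of metrics are the fibrewise ones.
What has to be checked for sections is that the fibrewise logarithm is smooth (`contDiffOn_matLog`,
by the inverse function theorem for `exp`), that fibrewise geodesics are `C¹` curves for the smooth
topology (their difference quotients are smooth functions of the times and of the endpoints,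
`matGeodSlope`), that convergence of sections gives uniform convergence of the integrands, and that
the Riemannian volume of a closed manifold is finite and charges every nonempty open set.
-/

noncomputable section

/-! ### Length spaces with an explicit CAT(0) squared distance -/

section CATZero

variable {X : Type*} [AddCommGroup X] [Module ℝ X] [TopologicalSpace X]

theorem IsC1CurveOn.mono {c w : ℝ → X} {a b a' b' : ℝ} (h : IsC1CurveOn c w a b) (ha : a ≤ a')
    (hb : b' ≤ b) : IsC1CurveOn c w a' b' :=
  ⟨h.1.mono (Icc_subset_Icc ha hb), fun t ht ↦ (h.2 t (Icc_subset_Icc ha hb ht)).mono_left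
    (nhdsWithin_mono _ (sdiff_subset_sdiff_left (Icc_subset_Icc ha hb)))⟩

/-- A candidate `q` for the square of the path-length distance of `(S, nrm)`: it vanishes only on
the diagonal, any two points are joined by a `C¹` curve `Γ p p'` of constant speed `√(q p p')` along
which the CAT(0) comparison inequality holds, and infinitesimally `q` is bounded by the norm. -/
structure IsCATZeroSqDist (S : Set X) (nrm q : X → X → ℝ) (Γ Γ' : X → X → ℝ → X) : Prop where
  nonneg : ∀ p ∈ S, ∀ p' ∈ S, 0 ≤ q p p'
  symm : ∀ p ∈ S, ∀ p' ∈ S, q p p' = q p' p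
  self : ∀ p ∈ S, q p p = 0
  eq_of_eq_zero : ∀ p ∈ S, ∀ p' ∈ S, q p p' = 0 → p = p'
  source : ∀ p ∈ S, ∀ p' ∈ S, Γ p p' 0 = p
  target : ∀ p ∈ S, ∀ p' ∈ S, Γ p p' 1 = p'
  mem : ∀ p ∈ S, ∀ p' ∈ S, ∀ t ∈ Icc (0 : ℝ) 1, Γ p p' t ∈ S
  isC1 : ∀ p ∈ S, ∀ p' ∈ S, IsC1CurveOn (Γ p p') (Γ' p p') 0 1
  speed : ∀ p ∈ S, ∀ p' ∈ S, ∀ t ∈ Icc (0 : ℝ) 1, nrm (Γ p p' t) (Γ' p p' t) = √(q p p')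
  cat : ∀ p ∈ S, ∀ p' ∈ S, ∀ r ∈ S, ∀ t ∈ Icc (0 : ℝ) 1,
    q r (Γ p p' t) ≤ (1 - t) * q r p + t * q r p' - t * (1 - t) * q p p'
  nrm_nonneg : ∀ p v, 0 ≤ nrm p v
  nrm_continuousOn : ∀ (c w : ℝ → X) (a b : ℝ), IsC1CurveOn c w a b → (∀ t ∈ Icc a b, c t ∈ S) →
    ContinuousOn (fun t ↦ nrm (c t) (w t)) (Icc a b)
  sqrt_le : ∀ (c w : ℝ → X) (a b : ℝ), IsC1CurveOn c w a b → (∀ t ∈ Icc a b, c t ∈ S) →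
    ∀ t ∈ Icc a b, ∀ r, nrm (c t) (w t) < r →
      ∀ᶠ s in 𝓝[Icc a b \ {t}] t, √(q (c t) (c s)) ≤ r * |s - t|

/-- The numerical form of "the comparison inequality implies the triangle inequality": a triangle
with `c > a + b` would have a point on the side `c` at negative squared distance from the
opposite vertex. -/
theorem le_add_of_forall_comparison {a b c : ℝ} (ha : 0 ≤ a) (hb : 0 ≤ b)
    (h : ∀ t ∈ Icc (0 : ℝ) 1, 0 ≤ (1 - t) * a ^ 2 + t * b ^ 2 - t * (1 - t) * c ^ 2) :
    c ≤ a + b := by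
  by_contra! hc
  have hc0 : 0 < c := by linarith
  -- For `a > 0` the point at distance `a` on the side `c` works; for `a = 0` this would be the
  -- opposite vertex itself, and the point at distance `(c - b) / 2` from it is taken.
  rcases ha.eq_or_lt with rfl | ha
  · have hm : (c - b) / (2 * c) ∈ Icc (0 : ℝ) 1 :=
      ⟨div_nonneg (by linarith) (by linarith), (div_le_one (by linarith)).2 (by linarith)⟩
    have := h _ hm
    have e : (1 - (c - b) / (2 * c)) * (0 : ℝ) ^ 2 + (c - b) / (2 * c) * b ^ 2
        - (c - b) / (2 * c) * (1 - (c - b) / (2 * c)) * c ^ 2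
        = - ((c - b) ^ 2 * (c + 2 * b) / (4 * c)) := by
      field_simp
      ring
    rw [e] at this
    have h2 : 0 < (c - b) ^ 2 * (c + 2 * b) / (4 * c) := by
      have : 0 < c - b := by linarith
      positivity
    linarith
  · have hm : a / c ∈ Icc (0 : ℝ) 1 := ⟨by positivity, (div_le_one hc0).2 (by linarith)⟩
    have := h _ hm
    have e : (1 - a / c) * a ^ 2 + a / c * b ^ 2 - a / c * (1 - a / c) * c ^ 2
        = - (a / c * ((c - a - b) * (c - a + b))) := by
      field_simp
      ring
    rw [e] at this
    have h2 : 0 < a / c * ((c - a - b) * (c - a + b)) := by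
      have h3 : 0 < c - a - b := by linarith
      have h4 : 0 < c - a + b := by linarith
      positivity
    linarith

namespace IsCATZeroSqDist

variable {S : Set X} {nrm q : X → X → ℝ} {Γ Γ' : X → X → ℝ → X}

theorem triangle (H : IsCATZeroSqDist S nrm q Γ Γ') {p r p' : X} (hp : p ∈ S) (hr : r ∈ S)
    (hp' : p' ∈ S) : √(q p p') ≤ √(q p r) + √(q r p') := by
  rw [H.symm p hp r hr]
  refine le_add_of_forall_comparison (Real.sqrt_nonneg _) (Real.sqrt_nonneg _) fun t ht ↦ ?_
  rw [Real.sq_sqrt (H.nonneg _ hr _ hp), Real.sq_sqrt (H.nonneg _ hr _ hp'),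
    Real.sq_sqrt (H.nonneg _ hp _ hp')]
  exact (H.nonneg _ hr _ (H.mem _ hp _ hp' t ht)).trans (H.cat _ hp _ hp' _ hr t ht)

theorem sqrt_symm (H : IsCATZeroSqDist S nrm q Γ Γ') {p p' : X} (hp : p ∈ S) (hp' : p' ∈ S) :
    √(q p p') = √(q p' p) := by
  rw [H.symm p hp p' hp']

theorem abs_sqrt_sub_le (H : IsCATZeroSqDist S nrm q Γ Γ') {p r r' : X} (hp : p ∈ S) (hr : r ∈ S)
    (hr' : r' ∈ S) : |√(q p r') - √(q p r)| ≤ √(q r r') := by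
  rw [abs_le]
  constructor
  · have := H.triangle hp hr' hr
    rw [H.sqrt_symm hr' hr] at this
    linarith
  · have := H.triangle hp hr hr'
    linarith

/-- A `C¹` curve is at least as long as the candidate distance between its endpoints. -/
theorem sqrt_le_integral (H : IsCATZeroSqDist S nrm q Γ Γ') {c w : ℝ → X} {a b : ℝ} (hab : a ≤ b)
    (hc : IsC1CurveOn c w a b) (hS : ∀ t ∈ Icc a b, c t ∈ S) :
    √(q (c a) (c b)) ≤ ∫ t in a..b, nrm (c t) (w t) := by
  have hn := H.nrm_continuousOn c w a b hc hS
  have haS := hS a (left_mem_Icc.2 hab)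
  have hfc : ContinuousOn (fun t ↦ √(q (c a) (c t))) (Icc a b) := by
    intro t ht
    rw [← continuousWithinAt_sdiff_self, ContinuousWithinAt, tendsto_iff_dist_tendsto_zero]
    have hz : Tendsto (fun s ↦ (nrm (c t) (w t) + 1) * |s - t|) (𝓝[Icc a b \ {t}] t) (𝓝 0) := by
      have : Tendsto (fun s : ℝ ↦ (nrm (c t) (w t) + 1) * |s - t|) (𝓝 t)
          (𝓝 ((nrm (c t) (w t) + 1) * |t - t|)) := Continuous.tendsto (by fun_prop) t
      simp only [sub_self, abs_zero, mul_zero] at this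
      exact this.mono_left nhdsWithin_le_nhds
    refine squeeze_zero' (.of_forall fun _ ↦ dist_nonneg) ?_ hz
    filter_upwards [H.sqrt_le c w a b hc hS t ht _ (lt_add_one _), self_mem_nhdsWithin] with s hs
      hs'
    exact (H.abs_sqrt_sub_le haS (hS t ht) (hS s hs'.1)).trans hs
  -- Both sides vanish at `a`, and the right slopes of `t ↦ √(q (c a) (c t))` are at most the speed.
  have key := image_le_of_liminf_slope_right_le_deriv_boundary
    (f := fun t ↦ √(q (c a) (c t))) (a := a) (b := b) hfc
    (B := fun t ↦ ∫ u in a..t, nrm (c u) (w u)) (B' := fun t ↦ nrm (c t) (w t))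
    (by simp [H.self _ haS]) ?_ ?_ ?_
  · exact key (right_mem_Icc.2 hab)
  · have h1 := intervalIntegral.continuousOn_primitive_interval' (μ := volume) (a := a)
      (hn.intervalIntegrable_of_Icc hab) (by simp)
    rwa [uIcc_of_le hab] at h1
  · intro x hx
    have hi : IntervalIntegrable (fun u ↦ nrm (c u) (w u)) volume a x :=
      (hn.mono (Icc_subset_Icc_right hx.2.le)).intervalIntegrable_of_Icc hx.1
    have hcx : ContinuousWithinAt (fun u ↦ nrm (c u) (w u)) (Ici x) x :=
      (hn.mono (Icc_subset_Icc_left hx.1)).continuousWithinAt (left_mem_Icc.2 hx.2.le)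
        |>.mono_of_mem_nhdsWithin (Icc_mem_nhdsGE hx.2)
    refine intervalIntegral.integral_hasDerivWithinAt_right hi (t := Ioi x) ?_ ?_
    · refine ⟨Ioc x b, Ioc_mem_nhdsGT hx.2, ?_⟩
      exact ((hn.mono (Ioc_subset_Icc_self.trans (Icc_subset_Icc_left hx.1))).aestronglyMeasurable
        measurableSet_Ioc)
    · exact hcx.mono Ioi_subset_Ici_self
  · intro x hx r hr
    refine Eventually.frequently ?_
    have hxI : x ∈ Icc a b := ⟨hx.1, hx.2.le⟩
    have hle : 𝓝[>] x ≤ 𝓝[Icc a b \ {x}] x := by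
      rw [← nhdsWithin_Ioc_eq_nhdsGT hx.2]
      exact nhdsWithin_mono _ fun s hs ↦ ⟨⟨hx.1.trans hs.1.le, hs.2⟩, hs.1.ne'⟩
    obtain ⟨r', hr1, hr2⟩ := exists_between hr
    filter_upwards [hle (H.sqrt_le c w a b hc hS x hxI r' hr1), hle self_mem_nhdsWithin,
      self_mem_nhdsWithin] with s hs hs' hxs
    have hxs' : 0 < s - x := sub_pos.2 hxs
    rw [slope_def_field]
    refine lt_of_le_of_lt ?_ hr2
    rw [div_le_iff₀ hxs']
    rw [abs_of_pos hxs'] at hs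
    exact ((le_abs_self _).trans (H.abs_sqrt_sub_le haS (hS x hxI) (hS s hs'.1))).trans hs

/-- Every subarc of a piecewise `C¹` path is at least as long as the candidate distance between its
endpoints; this includes the integrability of the speed. -/
theorem sqrt_le_integral_of_path (H : IsCATZeroSqDist S nrm q Γ Γ') {p p' : X}
    (c : PiecewiseC1Path S p p') :
    IntervalIntegrable (fun t ↦ nrm (c.toFun t) (c.velocity t)) volume 0 1 ∧
      ∀ s t, 0 ≤ s → s ≤ t → t ≤ 1 →
        √(q (c.toFun s) (c.toFun t)) ≤ ∫ u in s..t, nrm (c.toFun u) (c.velocity u) := by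
  obtain ⟨N, τ, hτ, h0, h1, hw⟩ := c.piecewise
  have hτ0 : ∀ i, 0 ≤ τ i := fun i ↦ h0 ▸ hτ.monotone (Fin.zero_le i)
  have hτ1 : ∀ i, τ i ≤ 1 := fun i ↦ h1 ▸ hτ.monotone (Fin.le_last i)
  set F : ℝ → ℝ := fun t ↦ nrm (c.toFun t) (c.velocity t) with hF
  have piece : ∀ i : Fin N, ∀ s t, τ i.castSucc ≤ s → s ≤ t → t ≤ τ i.succ →
      IntervalIntegrable F volume s t ∧
        √(q (c.toFun s) (c.toFun t)) ≤ ∫ u in s..t, F u := by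
    intro i s t hs hst ht
    obtain ⟨w, hcw, hvw⟩ := hw i
    have hS : ∀ u ∈ Icc s t, c.toFun u ∈ S := fun u hu ↦
      c.mem u ⟨(hτ0 _).trans (hs.trans hu.1), (hu.2.trans ht).trans (hτ1 _)⟩
    have hcw' := hcw.mono hs ht
    have hn := H.nrm_continuousOn c.toFun w s t hcw' hS
    have heq : ∀ᵐ u, u ∈ uIoc s t → nrm (c.toFun u) (w u) = F u := by
      have : ∀ᵐ u : ℝ, u ≠ t := Measure.ae_ne volume t
      filter_upwards [this] with u hu hut
      rw [uIoc_of_le hst] at hut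
      exact congrArg (nrm _) (hvw u ⟨hs.trans_lt hut.1, (lt_of_le_of_ne hut.2 hu).trans_le ht⟩).symm
    have hii := hn.intervalIntegrable_of_Icc (μ := volume) hst
    refine ⟨hii.congr_ae ?_, ?_⟩
    · rw [Filter.EventuallyEq, ae_restrict_iff' measurableSet_uIoc]
      exact heq
    · rw [← intervalIntegral.integral_congr_ae heq]
      exact H.sqrt_le_integral hst hcw' hS
  have key : ∀ k : ℕ, ∀ hk : k < N + 1, IntervalIntegrable F volume 0 (τ ⟨k, hk⟩) ∧
      ∀ s t, 0 ≤ s → s ≤ t → t ≤ τ ⟨k, hk⟩ →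
        √(q (c.toFun s) (c.toFun t)) ≤ ∫ u in s..t, F u := by
    intro k
    induction k with
    | zero =>
      intro hk
      have h0' : τ ⟨0, hk⟩ = 0 := h0
      rw [h0']
      refine ⟨IntervalIntegrable.refl, fun s t hs hst ht ↦ ?_⟩
      obtain rfl : s = t := le_antisymm hst (ht.trans hs)
      simp [H.self _ (c.mem s ⟨hs, ht.trans zero_le_one⟩)]
    | succ k ih =>
      intro hk
      obtain ⟨ih1, ih2⟩ := ih (by omega)
      have pc := piece ⟨k, by omega⟩
      simp only [Fin.castSucc_mk, Fin.succ_mk] at pc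
      have hlt : τ ⟨k, by omega⟩ ≤ τ ⟨k + 1, hk⟩ := hτ.monotone (by simp)
      refine ⟨ih1.trans (pc _ _ le_rfl hlt le_rfl).1, fun s t hs hst ht ↦ ?_⟩
      rcases le_total t (τ ⟨k, by omega⟩) with htk | htk
      · exact ih2 s t hs hst htk
      rcases le_total (τ ⟨k, by omega⟩) s with hsk | hsk
      · exact (pc s t hsk hst ht).2
      · have hm : ∀ u, 0 ≤ u → u ≤ t → c.toFun u ∈ S := fun u h1 h2 ↦
          c.mem u ⟨h1, h2.trans (ht.trans (hτ1 _))⟩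
        have hi1 : IntervalIntegrable F volume s (τ ⟨k, by omega⟩) :=
          ih1.mono_set (by
            rw [uIcc_of_le hsk, uIcc_of_le (hτ0 _)]
            exact Icc_subset_Icc_left hs)
        have p2 := pc _ _ le_rfl htk ht
        rw [← intervalIntegral.integral_add_adjacent_intervals hi1 p2.1]
        refine (H.triangle (hm s hs hst) (hm _ (hs.trans hsk) htk)
          (hm t (hs.trans hst) le_rfl)).trans (add_le_add (ih2 s _ hs hsk le_rfl) p2.2)
  have hlast : τ ⟨N, by omega⟩ = 1 := h1
  have := key N (by omega)
  rwa [hlast] at this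

theorem sqrt_le_length (H : IsCATZeroSqDist S nrm q Γ Γ') {p p' : X} (c : PiecewiseC1Path S p p') :
    √(q p p') ≤ c.length nrm := by
  have := (H.sqrt_le_integral_of_path c).2 0 1 le_rfl zero_le_one le_rfl
  rwa [c.source, c.target] at this

/-- The curve `Γ p p'` as a path. -/
def path (H : IsCATZeroSqDist S nrm q Γ Γ') {p p' : X} (hp : p ∈ S) (hp' : p' ∈ S) :
    PiecewiseC1Path S p p' where
  toFun := Γ p p'
  velocity := Γ' p p'
  source := H.source p hp p' hp'
  target := H.target p hp p' hp'
  mem := H.mem p hp p' hp'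
  piecewise := by
    refine ⟨1, ![0, 1], ?_, rfl, rfl, fun i ↦ ⟨Γ' p p', ?_, fun _ _ ↦ rfl⟩⟩
    · rw [Fin.strictMono_iff_lt_succ]
      intro i
      fin_cases i
      simp
    · fin_cases i
      simpa using H.isC1 p hp p' hp'

theorem length_path (H : IsCATZeroSqDist S nrm q Γ Γ') {p p' : X} (hp : p ∈ S) (hp' : p' ∈ S) :
    (H.path hp hp').length nrm = √(q p p') := by
  have : ∀ t ∈ uIcc (0 : ℝ) 1, nrm ((H.path hp hp').toFun t) ((H.path hp hp').velocity t)
      = √(q p p') := by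
    rw [uIcc_of_le zero_le_one]
    exact H.speed p hp p' hp'
  rw [PiecewiseC1Path.length, intervalIntegral.integral_congr this]
  simp

theorem pathDist_eq (H : IsCATZeroSqDist S nrm q Γ Γ') {p p' : X} (hp : p ∈ S) (hp' : p' ∈ S) :
    pathDist S nrm p p' = √(q p p') := by
  have : Nonempty (PiecewiseC1Path S p p') := ⟨H.path hp hp'⟩
  refine le_antisymm ?_ (le_ciInf fun c ↦ H.sqrt_le_length c)
  rw [← H.length_path hp hp']
  exact ciInf_le ⟨√(q p p'), by rintro _ ⟨c, rfl⟩; exact H.sqrt_le_length c⟩ _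

/-- The curve `Γ p p'` is minimizing between any two of its points. The comparison inequality with
`r` on the curve itself gives `≤`, and the triangle inequality turns the sum of the three upper
bounds on `[0, s]`, `[s, t]`, `[t, 1]` into `≥`. -/
theorem sqrt_geodesic (H : IsCATZeroSqDist S nrm q Γ Γ') {p p' : X} (hp : p ∈ S) (hp' : p' ∈ S)
    {s t : ℝ} (hs : s ∈ Icc (0 : ℝ) 1) (ht : t ∈ Icc (0 : ℝ) 1) :
    √(q (Γ p p' s) (Γ p p' t)) = |s - t| * √(q p p') := by
  have hq := H.nonneg p hp p' hp'
  have hΓ := H.mem p hp p' hp'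
  have h1 : ∀ t ∈ Icc (0 : ℝ) 1, q p (Γ p p' t) ≤ t ^ 2 * q p p' := fun t ht ↦ by
    have := H.cat p hp p' hp' p hp t ht
    rw [H.self p hp] at this
    linarith
  have h2 : ∀ t ∈ Icc (0 : ℝ) 1, q p' (Γ p p' t) ≤ (1 - t) ^ 2 * q p p' := fun t ht ↦ by
    have := H.cat p hp p' hp' p' hp' t ht
    rw [H.self p' hp', H.symm p' hp' p hp] at this
    linarith
  have h3 : ∀ s ∈ Icc (0 : ℝ) 1, ∀ t ∈ Icc (0 : ℝ) 1,
      q (Γ p p' s) (Γ p p' t) ≤ (s - t) ^ 2 * q p p' := fun s hs t ht ↦ by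
    have := H.cat p hp p' hp' _ (hΓ s hs) t ht
    rw [H.symm _ (hΓ s hs) p hp, H.symm _ (hΓ s hs) p' hp'] at this
    have a1 := mul_le_mul_of_nonneg_left (h1 s hs) (sub_nonneg.2 ht.2)
    have a2 := mul_le_mul_of_nonneg_left (h2 s hs) ht.1
    nlinarith
  have up : ∀ s ∈ Icc (0 : ℝ) 1, ∀ t ∈ Icc (0 : ℝ) 1,
      √(q (Γ p p' s) (Γ p p' t)) ≤ |s - t| * √(q p p') := fun s hs t ht ↦ by
    rw [← Real.sqrt_sq_eq_abs, ← Real.sqrt_mul (sq_nonneg _)]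
    exact Real.sqrt_le_sqrt (h3 s hs t ht)
  have main : ∀ s ∈ Icc (0 : ℝ) 1, ∀ t ∈ Icc (0 : ℝ) 1, s ≤ t →
      √(q (Γ p p' s) (Γ p p' t)) = |s - t| * √(q p p') := fun s hs t ht hst ↦ by
    refine le_antisymm (up s hs t ht) ?_
    have z : (0 : ℝ) ∈ Icc (0 : ℝ) 1 := by simp
    have o : (1 : ℝ) ∈ Icc (0 : ℝ) 1 := by simp
    have t1 := H.triangle hp (hΓ s hs) hp'
    have t2 := H.triangle (hΓ s hs) (hΓ t ht) hp'
    have u1 := up 0 z s hs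
    have u2 := up t ht 1 o
    rw [H.source p hp p' hp', zero_sub, abs_neg, abs_of_nonneg hs.1] at u1
    rw [H.target p hp p' hp', abs_sub_comm, abs_of_nonneg (sub_nonneg.2 ht.2)] at u2
    rw [abs_sub_comm, abs_of_nonneg (sub_nonneg.2 hst)]
    linarith
  rcases le_total s t with hst | hst
  · exact main s hs t ht hst
  · rw [H.sqrt_symm (hΓ s hs) (hΓ t ht), main t ht s hs hst, abs_sub_comm]

/-- A point at distances `t d` and `(1 - t) d` from two points at distance `d` is the point
of the geodesic at time `t`. -/
theorem eq_geodesic (H : IsCATZeroSqDist S nrm q Γ Γ') {p p' r : X} (hp : p ∈ S) (hp' : p' ∈ S)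
    (hr : r ∈ S) {t : ℝ} (ht : t ∈ Icc (0 : ℝ) 1) (h1 : √(q p r) = t * √(q p p'))
    (h2 : √(q r p') = (1 - t) * √(q p p')) : r = Γ p p' t := by
  have hΓ := H.mem p hp p' hp' t ht
  refine H.eq_of_eq_zero r hr _ hΓ (le_antisymm ?_ (H.nonneg r hr _ hΓ))
  have e : q p p' = √(q p p') ^ 2 := (Real.sq_sqrt (H.nonneg p hp p' hp')).symm
  have e1 : q r p = t ^ 2 * q p p' := by
    rw [e, ← mul_pow, ← h1, Real.sq_sqrt (H.nonneg p hp r hr), H.symm p hp r hr]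
  have e2 : q r p' = (1 - t) ^ 2 * q p p' := by
    rw [e, ← mul_pow, ← h2, Real.sq_sqrt (H.nonneg r hr p' hp')]
  have := H.cat p hp p' hp' r hr t ht
  rw [e1, e2] at this
  linarith

theorem eq_geodesic_of_isometric (H : IsCATZeroSqDist S nrm q Γ Γ') {p p' : X} (hp : p ∈ S)
    (hp' : p' ∈ S) {c : ℝ → X} (hc : ∀ t ∈ Icc (0 : ℝ) 1, c t ∈ S) (h0 : c 0 = p) (h1 : c 1 = p')
    (h : ∀ s ∈ Icc (0 : ℝ) 1, ∀ t ∈ Icc (0 : ℝ) 1,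
      pathDist S nrm (c s) (c t) = |s - t| * pathDist S nrm p p') :
    ∀ t ∈ Icc (0 : ℝ) 1, c t = Γ p p' t := by
  intro t ht
  have z : (0 : ℝ) ∈ Icc (0 : ℝ) 1 := by simp
  have o : (1 : ℝ) ∈ Icc (0 : ℝ) 1 := by simp
  have a := h 0 z t ht
  have b := h t ht 1 o
  rw [h0, H.pathDist_eq hp hp', H.pathDist_eq hp (hc t ht), zero_sub, abs_neg,
    abs_of_nonneg ht.1] at a
  rw [h1, H.pathDist_eq hp hp', H.pathDist_eq (hc t ht) hp', abs_sub_comm,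
    abs_of_nonneg (sub_nonneg.2 ht.2)] at b
  exact H.eq_geodesic hp hp' (hc t ht) ht a b

/-- A path of minimal length is a reparametrization of the geodesic. The parameter is the arc length
divided by the total length, unless the path is constant, where any parameter does. -/
theorem exists_reparam_of_length_eq (H : IsCATZeroSqDist S nrm q Γ Γ') {p p' : X} (hp : p ∈ S)
    (hp' : p' ∈ S) (c : PiecewiseC1Path S p p') (hc : c.length nrm = pathDist S nrm p p') :
    ∃ φ : ℝ → ℝ, ContinuousOn φ (Icc 0 1) ∧ MonotoneOn φ (Icc 0 1) ∧ φ 0 = 0 ∧ φ 1 = 1 ∧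
      ∀ t ∈ Icc (0 : ℝ) 1, c.toFun t = Γ p p' (φ t) := by
  obtain ⟨hi, hle⟩ := H.sqrt_le_integral_of_path c
  rw [H.pathDist_eq hp hp', PiecewiseC1Path.length] at hc
  set F : ℝ → ℝ := fun t ↦ nrm (c.toFun t) (c.velocity t) with hF
  have sub : ∀ s t, 0 ≤ s → s ≤ t → t ≤ 1 → IntervalIntegrable F volume s t :=
    fun s t hs hst ht ↦ hi.mono_set (by
      rw [uIcc_of_le hst, uIcc_of_le zero_le_one]
      exact Icc_subset_Icc hs ht)
  -- minimality of the whole forces minimality of both parts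
  have both : ∀ t ∈ Icc (0 : ℝ) 1, √(q p (c.toFun t)) = ∫ u in (0 : ℝ)..t, F u ∧
      √(q (c.toFun t) p') = √(q p p') - √(q p (c.toFun t)) := by
    intro t ht
    have e1 := hle 0 t le_rfl ht.1 ht.2
    have e2 := hle t 1 ht.1 ht.2 le_rfl
    rw [c.source] at e1
    rw [c.target] at e2
    have e3 := intervalIntegral.integral_add_adjacent_intervals (sub 0 t le_rfl ht.1 ht.2)
      (sub t 1 ht.1 ht.2 le_rfl)
    have e4 := H.triangle hp (c.mem t ht) hp'
    constructor <;> linarith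
  rcases (Real.sqrt_nonneg (q p p')).eq_or_lt with hd | hd
  · refine ⟨id, continuousOn_id, monotoneOn_id, rfl, rfl, fun t ht ↦ ?_⟩
    obtain ⟨-, e⟩ := both t ht
    have n1 := Real.sqrt_nonneg (q p (c.toFun t))
    have n2 := Real.sqrt_nonneg (q (c.toFun t) p')
    refine H.eq_geodesic hp hp' (c.mem t ht) ht ?_ ?_ <;> rw [← hd] at e ⊢ <;> linarith
  · refine ⟨fun t ↦ (∫ u in (0 : ℝ)..t, F u) / √(q p p'), ?_, ?_, by simp, ?_, ?_⟩
    · have h1 := intervalIntegral.continuousOn_primitive_interval' (μ := volume) (a := 0) hi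
        (by simp)
      rw [uIcc_of_le zero_le_one] at h1
      exact h1.div_const _
    · intro s hs t ht hst
      have e3 := intervalIntegral.integral_add_adjacent_intervals (sub 0 s le_rfl hs.1 hs.2)
        (sub s t hs.1 hst ht.2)
      have : 0 ≤ ∫ u in s..t, F u :=
        intervalIntegral.integral_nonneg hst fun u _ ↦ H.nrm_nonneg _ _
      refine div_le_div_of_nonneg_right ?_ hd.le
      linarith
    · change (∫ u in (0 : ℝ)..1, F u) / √(q p p') = 1
      rw [hc, div_self hd.ne']
    · intro t ht
      obtain ⟨e1, e2⟩ := both t ht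
      have n1 := Real.sqrt_nonneg (q p (c.toFun t))
      have n2 := Real.sqrt_nonneg (q (c.toFun t) p')
      change c.toFun t = Γ p p' ((∫ u in (0 : ℝ)..t, F u) / √(q p p'))
      rw [← e1]
      refine H.eq_geodesic hp hp' (c.mem t ht) ⟨by positivity, ?_⟩ ?_ ?_
      · rw [div_le_one hd]
        linarith
      · field_simp
      · rw [e2]
        field_simp

end IsCATZeroSqDist

end CATZero

/-! ### Positive definite matrices: simultaneous diagonalization -/

section Matrices

open scoped ComplexOrder Matrix

variable {ι : Type*} [DecidableEq ι]

/-- The complex diagonal matrix with the given real entries. -/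
def realDiag (f : ι → ℝ) : Matrix ι ι ℂ := Matrix.diagonal fun i ↦ (f i : ℂ)

theorem realDiag_conjTranspose (f : ι → ℝ) : (realDiag f)ᴴ = realDiag f := by
  rw [realDiag, Matrix.diagonal_conjTranspose]
  congr 1
  ext i
  simp

theorem realDiag_one : realDiag (fun _ : ι ↦ 1) = 1 := by
  simp [realDiag]

theorem posDef_realDiag {f : ι → ℝ} : (realDiag f).PosDef ↔ ∀ i, 0 < f i := by
  simp [realDiag, Matrix.posDef_diagonal_iff]

variable [Fintype ι]

theorem realDiag_mul (f g : ι → ℝ) : realDiag f * realDiag g = realDiag fun i ↦ f i * g i := by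
  simp [realDiag]

theorem trace_realDiag (f : ι → ℝ) : (realDiag f).trace = ((∑ i, f i : ℝ) : ℂ) := by
  simp [realDiag, Matrix.trace_diagonal]

theorem exp_realDiag (f : ι → ℝ) :
    NormedSpace.exp (realDiag f) = realDiag fun i ↦ Real.exp (f i) := by
  rw [realDiag, Matrix.exp_diagonal, realDiag]
  congr 1
  ext i
  rw [Pi.coe_exp, Complex.ofReal_exp, Complex.exp_eq_exp_ℂ]

theorem Matrix.IsHermitian.exists_diag {A : Matrix ι ι ℂ} (hA : A.IsHermitian) :
    ∃ (U : Matrix ι ι ℂ) (f : ι → ℝ), U * Uᴴ = 1 ∧ Uᴴ * U = 1 ∧ A = U * realDiag f * Uᴴ := by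
  refine ⟨hA.eigenvectorUnitary, hA.eigenvalues, ?_, ?_, ?_⟩
  · exact Unitary.coe_mul_star_self _
  · exact Unitary.coe_star_mul_self _
  · exact hA.spectral_theorem.trans (Unitary.conjStarAlgAut_apply _ _)

theorem posDef_congr {A S T : Matrix ι ι ℂ} (hST : S * T = 1) :
    (S * A * Sᴴ).PosDef ↔ A.PosDef :=
  Matrix.IsUnit.posDef_star_right_conjugate_iff (IsUnit.of_mul_eq_one T hST)

theorem Matrix.PosDef.exists_diag {A : Matrix ι ι ℂ} (hA : A.PosDef) :
    ∃ (U : Matrix ι ι ℂ) (f : ι → ℝ), U * Uᴴ = 1 ∧ Uᴴ * U = 1 ∧ (∀ i, 0 < f i) ∧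
      A = U * realDiag f * Uᴴ := by
  obtain ⟨U, f, h1, h2, rfl⟩ := hA.1.exists_diag
  exact ⟨U, f, h1, h2, posDef_realDiag.1 ((posDef_congr h1).1 hA), rfl⟩

/-- `S` brings `P` and `Q` simultaneously to the diagonal forms `1` and `exp ρ`; `T = S⁻¹`. -/
structure IsSimDiag (P Q S T : Matrix ι ι ℂ) (ρ : ι → ℝ) : Prop where
  mul_eq_one : S * T = 1
  left : P = S * Sᴴ
  right : Q = S * realDiag (fun i ↦ Real.exp (ρ i)) * Sᴴ

theorem exists_isSimDiag {P Q : Matrix ι ι ℂ} (hP : P.PosDef) (hQ : Q.PosDef) :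
    ∃ S T ρ, IsSimDiag P Q S T ρ := by
  obtain ⟨U, f, h1, h2, hf, rfl⟩ := hP.exists_diag
  set S₀ := U * realDiag fun i ↦ √(f i)
  set T₀ := (realDiag fun i ↦ (√(f i))⁻¹) * Uᴴ
  have d1 : (realDiag fun i ↦ √(f i)) * (realDiag fun i ↦ (√(f i))⁻¹) = 1 := by
    rw [realDiag_mul, ← realDiag_one]
    congr 1
    ext i
    exact mul_inv_cancel₀ (Real.sqrt_pos.2 (hf i)).ne'
  have hST : S₀ * T₀ = 1 := by
    calc S₀ * T₀ = U * ((realDiag fun i ↦ √(f i)) * (realDiag fun i ↦ (√(f i))⁻¹)) * Uᴴ := by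
          simp only [S₀, T₀, Matrix.mul_assoc]
      _ = 1 := by rw [d1, Matrix.mul_one, h1]
  have hTS : T₀ * S₀ = 1 := mul_eq_one_comm.1 hST
  obtain ⟨V, g, h3, h4, hg, hV⟩ := ((posDef_congr hTS).2 hQ).exists_diag
  refine ⟨S₀ * V, Vᴴ * T₀, fun i ↦ Real.log (g i), ?_, ?_, ?_⟩
  · calc S₀ * V * (Vᴴ * T₀) = S₀ * (V * Vᴴ) * T₀ := by simp only [Matrix.mul_assoc]
      _ = 1 := by rw [h3, Matrix.mul_one, hST]
  · calc U * realDiag f * Uᴴ = S₀ * S₀ᴴ := by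
          simp only [S₀, Matrix.conjTranspose_mul, realDiag_conjTranspose]
          rw [Matrix.mul_assoc U (realDiag _) (realDiag _ * _),
            ← Matrix.mul_assoc (realDiag _) (realDiag _) Uᴴ, realDiag_mul, ← Matrix.mul_assoc]
          simp only [Real.mul_self_sqrt (hf _).le]
      _ = S₀ * (V * Vᴴ) * S₀ᴴ := by rw [h3, Matrix.mul_one]
      _ = S₀ * V * (S₀ * V)ᴴ := by rw [Matrix.conjTranspose_mul S₀]; simp only [Matrix.mul_assoc]
  · simp only [Real.exp_log (hg _)]
    calc Q = (S₀ * T₀) * Q * (S₀ * T₀)ᴴ := by rw [hST]; simp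
      _ = S₀ * (T₀ * Q * T₀ᴴ) * S₀ᴴ := by
          rw [Matrix.conjTranspose_mul]; simp only [Matrix.mul_assoc]
      _ = S₀ * V * realDiag g * (S₀ * V)ᴴ := by
          rw [hV, Matrix.conjTranspose_mul S₀]; simp only [Matrix.mul_assoc]

/-- The curve `S exp(tρ) Sᴴ`. -/
def diagCurve (S : Matrix ι ι ℂ) (ρ : ι → ℝ) (t : ℝ) : Matrix ι ι ℂ :=
  S * realDiag (fun i ↦ Real.exp (t * ρ i)) * Sᴴ

theorem isSimDiag_diagCurve {S T : Matrix ι ι ℂ} (hST : S * T = 1) (ρ : ι → ℝ) (s t : ℝ) :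
    IsSimDiag (diagCurve S ρ s) (diagCurve S ρ t) (S * realDiag fun i ↦ Real.exp (s * ρ i / 2))
      ((realDiag fun i ↦ Real.exp (-(s * ρ i / 2))) * T) (fun i ↦ (t - s) * ρ i) := by
  have e : ∀ f : ι → ℝ, ∀ A : Matrix ι ι ℂ, realDiag f * (realDiag f * A)
      = realDiag (fun i ↦ f i * f i) * A := fun f A ↦ by
    rw [← Matrix.mul_assoc, realDiag_mul]
  refine ⟨?_, ?_, ?_⟩
  · rw [Matrix.mul_assoc, ← Matrix.mul_assoc (realDiag _), realDiag_mul]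
    simp only [← Real.exp_add, add_neg_cancel, Real.exp_zero]
    rw [realDiag_one, Matrix.one_mul, hST]
  · rw [Matrix.conjTranspose_mul, realDiag_conjTranspose, Matrix.mul_assoc, e, ← Matrix.mul_assoc,
      diagCurve]
    simp only [← Real.exp_add, add_halves]
  · rw [Matrix.conjTranspose_mul, realDiag_conjTranspose, Matrix.mul_assoc S, realDiag_mul,
      Matrix.mul_assoc S, ← Matrix.mul_assoc (realDiag _) (realDiag _), realDiag_mul,
      ← Matrix.mul_assoc, diagCurve]
    simp only [← Real.exp_add]
    congr 4
    ext i
    ring_nf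

theorem posDef_diagCurve {S T : Matrix ι ι ℂ} (hST : S * T = 1) (ρ : ι → ℝ) (t : ℝ) :
    (diagCurve S ρ t).PosDef :=
  (posDef_congr hST).2 (posDef_realDiag.2 fun _ ↦ Real.exp_pos _)

namespace IsSimDiag

variable {P Q S T : Matrix ι ι ℂ} {ρ : ι → ℝ}

theorem diagCurve_zero (h : IsSimDiag P Q S T ρ) : diagCurve S ρ 0 = P := by
  simp [diagCurve, realDiag_one, h.left]

theorem diagCurve_one (h : IsSimDiag P Q S T ρ) : diagCurve S ρ 1 = Q := by
  simp [diagCurve, h.right]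

theorem swap (h : IsSimDiag P Q S T ρ) : ∃ S' T', IsSimDiag Q P S' T' (fun i ↦ -ρ i) := by
  have := isSimDiag_diagCurve h.mul_eq_one ρ 1 0
  simp only [h.diagCurve_zero, h.diagCurve_one, zero_sub, neg_one_mul] at this
  exact ⟨_, _, this⟩

theorem inv_left (h : IsSimDiag P Q S T ρ) : P⁻¹ = Tᴴ * T := by
  have hTS : T * S = 1 := mul_eq_one_comm.1 h.mul_eq_one
  refine Matrix.inv_eq_left_inv ?_
  rw [h.left, Matrix.mul_assoc, ← Matrix.mul_assoc T, hTS, Matrix.one_mul,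
    ← Matrix.conjTranspose_mul, h.mul_eq_one, Matrix.conjTranspose_one]

theorem inv_mul (h : IsSimDiag P Q S T ρ) :
    P⁻¹ * Q = Tᴴ * (realDiag (fun i ↦ Real.exp (ρ i)) * Sᴴ) := by
  have hTS : T * S = 1 := mul_eq_one_comm.1 h.mul_eq_one
  rw [h.inv_left, h.right, Matrix.mul_assoc, Matrix.mul_assoc S, ← Matrix.mul_assoc T, hTS,
    Matrix.one_mul]

theorem conj_mul_conj (h : IsSimDiag P Q S T ρ) : Sᴴ * Tᴴ = 1 := by
  rw [← Matrix.conjTranspose_mul, mul_eq_one_comm.1 h.mul_eq_one, Matrix.conjTranspose_one]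

theorem trace_inv_mul (h : IsSimDiag P Q S T ρ) :
    (P⁻¹ * Q).trace = ((∑ i, Real.exp (ρ i) : ℝ) : ℂ) := by
  rw [h.inv_mul, Matrix.trace_mul_comm, Matrix.mul_assoc, h.conj_mul_conj, Matrix.mul_one,
    trace_realDiag]

theorem trace_inv_mul' (h : IsSimDiag P Q S T ρ) :
    (Q⁻¹ * P).trace = ((∑ i, Real.exp (-ρ i) : ℝ) : ℂ) := by
  obtain ⟨S', T', h'⟩ := h.swap
  exact h'.trace_inv_mul

theorem charpoly (h : IsSimDiag P Q S T ρ) :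
    (P⁻¹ * Q).charpoly = (realDiag fun i ↦ Real.exp (ρ i)).charpoly := by
  rw [h.inv_mul, Matrix.charpoly_mul_comm, Matrix.mul_assoc, h.conj_mul_conj, Matrix.mul_one]

theorem det (h : IsSimDiag P Q S T ρ) :
    (P⁻¹ * Q).det = (Real.exp (∑ i, ρ i) : ℝ) := by
  rw [h.inv_mul, Matrix.det_mul_comm, Matrix.mul_assoc, h.conj_mul_conj, Matrix.mul_one, realDiag,
    Matrix.det_diagonal, Real.exp_sum]
  push_cast
  rfl

end IsSimDiag

/-! ### The squared distance and the logarithm of the determinant -/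

/-- The sum of `(log |z|)²` over the roots `z` of a polynomial. For the characteristic polynomial of
`P⁻¹ Q` this is the squared affine-invariant distance of the positive definite matrices `P`, `Q`. -/
def sqLogRoots (p : Polynomial ℂ) : ℝ := (p.roots.map fun z ↦ Real.log ‖z‖ ^ 2).sum

/-- The squared affine-invariant distance on positive definite matrices. -/
def matSq (P Q : Matrix ι ι ℂ) : ℝ := sqLogRoots (P⁻¹ * Q).charpoly

/-- The difference `log det Q - log det P`. -/
def matLogDet (P Q : Matrix ι ι ℂ) : ℝ := Real.log ‖(P⁻¹ * Q).det‖

/-- The squared distance belonging to `tr(P⁻¹ V P⁻¹ W) + α tr(P⁻¹ V) tr(P⁻¹ W)`. -/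
def matSqDist (α : ℝ) (P Q : Matrix ι ι ℂ) : ℝ := matSq P Q + α * matLogDet P Q ^ 2

theorem sqLogRoots_realDiag (ρ : ι → ℝ) :
    sqLogRoots (realDiag fun i ↦ Real.exp (ρ i)).charpoly = ∑ i, ρ i ^ 2 := by
  have : (realDiag fun i ↦ Real.exp (ρ i)).charpoly.roots
      = (Finset.univ.val.map fun i ↦ (Real.exp (ρ i) : ℂ)) := by
    rw [realDiag, Matrix.charpoly_diagonal,
      ← Polynomial.roots_multiset_prod_X_sub_C (Finset.univ.val.map _), Multiset.map_map]
    rfl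
  rw [sqLogRoots, this, Multiset.map_map]
  refine Finset.sum_congr rfl fun i _ ↦ ?_
  rw [Function.comp_apply, Complex.norm_real,
    Real.norm_of_nonneg (Real.exp_pos _).le, Real.log_exp]

namespace IsSimDiag

variable {P Q S T : Matrix ι ι ℂ} {ρ : ι → ℝ}

theorem matSq_eq (h : IsSimDiag P Q S T ρ) : matSq P Q = ∑ i, ρ i ^ 2 := by
  rw [matSq, h.charpoly, sqLogRoots_realDiag]

theorem matLogDet_eq (h : IsSimDiag P Q S T ρ) : matLogDet P Q = ∑ i, ρ i := by
  rw [matLogDet, h.det, Complex.norm_real, Real.norm_of_nonneg (Real.exp_pos _).le, Real.log_exp]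

end IsSimDiag

variable {P Q R : Matrix ι ι ℂ}

theorem matSq_comm (hP : P.PosDef) (hQ : Q.PosDef) : matSq P Q = matSq Q P := by
  obtain ⟨S, T, ρ, h⟩ := exists_isSimDiag hP hQ
  obtain ⟨S', T', h'⟩ := h.swap
  rw [h.matSq_eq, h'.matSq_eq]
  simp

theorem matLogDet_comm (hP : P.PosDef) (hQ : Q.PosDef) : matLogDet P Q = -matLogDet Q P := by
  obtain ⟨S, T, ρ, h⟩ := exists_isSimDiag hP hQ
  obtain ⟨S', T', h'⟩ := h.swap
  rw [h.matLogDet_eq, h'.matLogDet_eq]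
  simp

theorem matLogDet_add (hP : P.PosDef) (hQ : Q.PosDef) (hR : R.PosDef) :
    matLogDet P R = matLogDet P Q + matLogDet Q R := by
  have d : ∀ {A : Matrix ι ι ℂ}, A.PosDef → A.det ≠ 0 := fun hA ↦ hA.det_pos.ne'
  simp only [matLogDet, Matrix.det_mul, Matrix.det_nonsing_inv, Ring.inverse_eq_inv']
  rw [← Real.log_mul]
  · congr 1
    rw [← norm_mul]
    congr 1
    have := d hQ
    field_simp
  · exact norm_ne_zero_iff.2 (mul_ne_zero (inv_ne_zero (d hP)) (d hQ))
  · exact norm_ne_zero_iff.2 (mul_ne_zero (inv_ne_zero (d hQ)) (d hR))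

theorem charpoly_congr {C C' : Matrix ι ι ℂ} (hC : C * C' = 1) (hP : P.PosDef) :
    ((C * P * Cᴴ)⁻¹ * (C * Q * Cᴴ)).charpoly = (P⁻¹ * Q).charpoly := by
  have hC' : C' * C = 1 := mul_eq_one_comm.1 hC
  have hH : Cᴴ * C'ᴴ = 1 := by rw [← Matrix.conjTranspose_mul, hC', Matrix.conjTranspose_one]
  have hP' : P⁻¹ * P = 1 := Matrix.nonsing_inv_mul _ ((Matrix.isUnit_iff_isUnit_det _).1 hP.isUnit)
  have e : (C * P * Cᴴ)⁻¹ = C'ᴴ * P⁻¹ * C' := by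
    refine Matrix.inv_eq_left_inv ?_
    calc C'ᴴ * P⁻¹ * C' * (C * P * Cᴴ) = C'ᴴ * (P⁻¹ * ((C' * C) * P)) * Cᴴ := by
          simp only [Matrix.mul_assoc]
      _ = 1 := by rw [hC', Matrix.one_mul, hP', Matrix.mul_one, mul_eq_one_comm.1 hH]
  rw [e]
  calc (C'ᴴ * P⁻¹ * C' * (C * Q * Cᴴ)).charpoly
      = (C'ᴴ * (P⁻¹ * ((C' * C) * Q) * Cᴴ)).charpoly := by simp only [Matrix.mul_assoc]
    _ = (P⁻¹ * Q).charpoly := by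
      rw [hC', Matrix.one_mul, Matrix.charpoly_mul_comm, Matrix.mul_assoc, hH, Matrix.mul_one]

theorem matSq_congr {C C' : Matrix ι ι ℂ} (hC : C * C' = 1) (hP : P.PosDef) :
    matSq (C * P * Cᴴ) (C * Q * Cᴴ) = matSq P Q := by
  rw [matSq, charpoly_congr hC hP, matSq]

/-! ### The exponential metric increasing property -/

theorem trace_diag_mul_diag {U V : Matrix ι ι ℂ} (f g : ι → ℝ) :
    (U * realDiag f * Uᴴ * (V * realDiag g * Vᴴ)).trace =
      ((∑ i, ∑ j, f i * g j * Complex.normSq ((Uᴴ * V) i j) : ℝ) : ℂ) := by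
  set W := Uᴴ * V
  have hW : Vᴴ * U = Wᴴ := by simp [W, Matrix.conjTranspose_mul]
  have : (U * realDiag f * Uᴴ * (V * realDiag g * Vᴴ)).trace
      = (realDiag f * (W * (realDiag g * Wᴴ))).trace := by
    rw [← hW, Matrix.mul_assoc, Matrix.mul_assoc, Matrix.trace_mul_comm]
    simp only [W, Matrix.mul_assoc]
  rw [this, Matrix.trace]
  push_cast
  refine Finset.sum_congr rfl fun i _ ↦ ?_
  rw [Matrix.diag_apply, realDiag, Matrix.diagonal_mul, Matrix.mul_apply, Finset.mul_sum]
  refine Finset.sum_congr rfl fun j _ ↦ ?_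
  rw [realDiag, Matrix.diagonal_mul, Matrix.conjTranspose_apply, Complex.normSq_eq_conj_mul_self]
  simp only [Complex.star_def]
  ring

theorem exp_conj_realDiag {U : Matrix ι ι ℂ} (h1 : U * Uᴴ = 1) (f : ι → ℝ) :
    NormedSpace.exp (U * realDiag f * Uᴴ) = U * realDiag (fun i ↦ Real.exp (f i)) * Uᴴ := by
  have : Uᴴ = U⁻¹ := (Matrix.inv_eq_right_inv h1).symm
  rw [this, Matrix.exp_conj _ _ (IsUnit.of_mul_eq_one _ h1), exp_realDiag]

theorem Matrix.IsHermitian.posDef_exp {X : Matrix ι ι ℂ} (hX : X.IsHermitian) :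
    (NormedSpace.exp X).PosDef := by
  obtain ⟨U, f, h1, -, rfl⟩ := hX.exists_diag
  rw [exp_conj_realDiag h1]
  exact (posDef_congr h1).2 (posDef_realDiag.2 fun i ↦ Real.exp_pos _)

theorem Matrix.PosDef.exists_log (hP : P.PosDef) :
    ∃ X : Matrix ι ι ℂ, X.IsHermitian ∧ NormedSpace.exp X = P := by
  obtain ⟨U, f, h1, -, hf, rfl⟩ := hP.exists_diag
  refine ⟨U * realDiag (fun i ↦ Real.log (f i)) * Uᴴ, ?_, ?_⟩
  · rw [Matrix.IsHermitian, Matrix.conjTranspose_mul, Matrix.conjTranspose_mul,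
      realDiag_conjTranspose, Matrix.conjTranspose_conjTranspose, Matrix.mul_assoc]
  · rw [exp_conj_realDiag h1]
    simp only [Real.exp_log (hf _)]

theorem sq_le_exp_add_exp_neg (x : ℝ) : x ^ 2 ≤ Real.exp x + Real.exp (-x) - 2 := by
  have h : (x / 2) ^ 2 ≤ Real.sinh (x / 2) ^ 2 := by
    refine sq_le_sq' ?_ ?_ |>.trans_eq (sq_abs _)
    · have := Real.self_le_sinh_iff (x := -(x / 2))
      rcases le_total 0 (x / 2) with h | h
      · linarith [abs_nonneg (Real.sinh (x / 2))]
      · have h2 := this.2 (by linarith)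
        rw [Real.sinh_neg] at h2
        linarith [neg_abs_le (Real.sinh (x / 2))]
    · rcases le_total 0 (x / 2) with h | h
      · exact (Real.self_le_sinh_iff.2 h).trans (le_abs_self _)
      · exact h.trans (abs_nonneg _)
  have h2 := Real.cosh_sq (x / 2)
  have h3 := Real.cosh_two_mul (x / 2)
  have h4 := Real.cosh_eq x
  rw [mul_div_cancel₀ x two_ne_zero] at h3
  nlinarith

/-- The rows of the matrix `(|w i j|²)` of a unitary `w` sum to `1`. -/
theorem sum_normSq_unitary {W : Matrix ι ι ℂ} (hW : W * Wᴴ = 1) (i : ι) :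
    ∑ j, Complex.normSq (W i j) = 1 := by
  have := congr_fun (congr_fun hW i) i
  rw [Matrix.mul_apply, Matrix.one_apply_eq] at this
  have h2 : ((∑ j, Complex.normSq (W i j) : ℝ) : ℂ) = 1 := by
    rw [← this]
    push_cast
    refine Finset.sum_congr rfl fun j _ ↦ ?_
    rw [Matrix.conjTranspose_apply, ← Complex.mul_conj]
    rfl
  exact_mod_cast h2

/-- A comparison of logarithms that is exact to first order. In eigenbases of `X` and `Y` it is
the inequality `(x - y)² ≤ exp(x - y) + exp(y - x) - 2`, weighted by a doubly stochastic matrix. -/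
theorem trace_sub_sq_le {X Y : Matrix ι ι ℂ} (hX : X.IsHermitian) (hY : Y.IsHermitian) :
    ((X - Y) * (X - Y)).trace.re ≤
      ((NormedSpace.exp X)⁻¹ * NormedSpace.exp Y).trace.re +
        ((NormedSpace.exp Y)⁻¹ * NormedSpace.exp X).trace.re - 2 * Fintype.card ι := by
  obtain ⟨U, f, hU, hU', rfl⟩ := hX.exists_diag
  obtain ⟨V, g, hV, hV', rfl⟩ := hY.exists_diag
  set W := Uᴴ * V with hW
  have hWH : Vᴴ * U = Wᴴ := by simp [W, Matrix.conjTranspose_mul]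
  have w1 : W * Wᴴ = 1 := by
    rw [← hWH, hW, Matrix.mul_assoc, ← Matrix.mul_assoc V, hV, Matrix.one_mul, hU']
  have w2 : Wᴴ * W = 1 := mul_eq_one_comm.1 w1
  have row := sum_normSq_unitary w1
  have col : ∀ j, ∑ i, Complex.normSq (W i j) = 1 := fun j ↦ by
    have := sum_normSq_unitary (W := Wᴴ) (by rwa [Matrix.conjTranspose_conjTranspose]) j
    simpa [Matrix.conjTranspose_apply, Complex.normSq_conj] using this
  have e1 : ∀ {U : Matrix ι ι ℂ} (f : ι → ℝ), U * Uᴴ = 1 →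
      (U * realDiag (fun i ↦ Real.exp (f i)) * Uᴴ)⁻¹ =
        U * realDiag (fun i ↦ Real.exp (-f i)) * Uᴴ := fun {U} f h ↦ by
    refine Matrix.inv_eq_left_inv ?_
    calc U * realDiag (fun i ↦ Real.exp (-f i)) * Uᴴ * (U * realDiag (fun i ↦ Real.exp (f i)) * Uᴴ)
        = U * (realDiag (fun i ↦ Real.exp (-f i)) * ((Uᴴ * U) *
            realDiag (fun i ↦ Real.exp (f i)))) * Uᴴ := by simp only [Matrix.mul_assoc]
      _ = 1 := by
        rw [mul_eq_one_comm.1 h, Matrix.one_mul, realDiag_mul]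
        simp only [← Real.exp_add, neg_add_cancel, Real.exp_zero]
        rw [realDiag_one, Matrix.mul_one, h]
  have sq : ∀ {U : Matrix ι ι ℂ} (f : ι → ℝ), U * Uᴴ = 1 →
      (U * realDiag f * Uᴴ * (U * realDiag f * Uᴴ)).trace = ((∑ i, f i ^ 2 : ℝ) : ℂ) :=
    fun {U} f h ↦ by
    calc (U * realDiag f * Uᴴ * (U * realDiag f * Uᴴ)).trace
        = (U * (realDiag f * ((Uᴴ * U) * realDiag f) * Uᴴ)).trace := by
          simp only [Matrix.mul_assoc]
      _ = _ := by
        rw [mul_eq_one_comm.1 h, Matrix.one_mul, realDiag_mul, Matrix.trace_mul_comm,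
          Matrix.mul_assoc, mul_eq_one_comm.1 h, Matrix.mul_one, trace_realDiag]
        simp only [sq]
  rw [exp_conj_realDiag hU, exp_conj_realDiag hV, e1 f hU, e1 g hV, trace_diag_mul_diag,
    Matrix.trace_mul_comm (V * _ * Vᴴ), trace_diag_mul_diag]
  have e2 : ((U * realDiag f * Uᴴ - V * realDiag g * Vᴴ) *
      (U * realDiag f * Uᴴ - V * realDiag g * Vᴴ)).trace =
      ((∑ i, f i ^ 2 : ℝ) : ℂ) + ((∑ i, g i ^ 2 : ℝ) : ℂ) -
        2 * ((∑ i, ∑ j, f i * g j * Complex.normSq (W i j) : ℝ) : ℂ) := by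
    rw [Matrix.sub_mul, Matrix.mul_sub, Matrix.mul_sub, Matrix.trace_sub, Matrix.trace_sub,
      Matrix.trace_sub, sq f hU, sq g hV, Matrix.trace_mul_comm (V * _ * Vᴴ), trace_diag_mul_diag]
    ring
  rw [e2, ← Complex.ofReal_add, ← Complex.ofReal_ofNat, ← Complex.ofReal_mul,
    ← Complex.ofReal_sub, Complex.ofReal_re, Complex.ofReal_re, Complex.ofReal_re]
  have r1 : ∑ i, f i ^ 2 = ∑ i, ∑ j, f i ^ 2 * Complex.normSq (W i j) := by
    simp only [← Finset.mul_sum, row, mul_one]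
  have r2 : ∑ i, g i ^ 2 = ∑ i, ∑ j, g j ^ 2 * Complex.normSq (W i j) := by
    rw [Finset.sum_comm]
    simp only [← Finset.mul_sum, col, mul_one]
  have r3 : (2 : ℝ) * Fintype.card ι = ∑ i, ∑ j, 2 * Complex.normSq (W i j) := by
    simp only [← Finset.mul_sum, row, Finset.sum_const, Finset.card_univ, nsmul_eq_mul, mul_one]
    ring
  rw [r1, r2, r3, Finset.mul_sum]
  simp only [Finset.mul_sum, ← Finset.sum_add_distrib, ← Finset.sum_sub_distrib]
  refine Finset.sum_le_sum fun i _ ↦ Finset.sum_le_sum fun j _ ↦ ?_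
  have h := mul_le_mul_of_nonneg_right (sq_le_exp_add_exp_neg (f i - g j))
    (Complex.normSq_nonneg (W i j))
  have x1 : Real.exp (f i - g j) = Real.exp (f i) * Real.exp (-g j) := by
    rw [← Real.exp_add]; ring_nf
  have x2 : Real.exp (-(f i - g j)) = Real.exp (-f i) * Real.exp (g j) := by
    rw [← Real.exp_add]; ring_nf
  rw [x1, x2] at h
  nlinarith [h]

theorem eq_zero_of_trace_sq_le {κ : Type*} [Fintype κ] {X : Matrix κ κ ℂ} (hX : X.IsHermitian)
    (h : (X * X).trace.re ≤ 0) : X = 0 := by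
  have e : (Xᴴ * X).PosSemidef := Matrix.posSemidef_conjTranspose_mul_self X
  have h0 := e.trace_nonneg
  rw [hX] at h0
  refine Matrix.trace_conjTranspose_mul_self_eq_zero_iff.1 ?_
  rw [hX]
  rw [Complex.le_def] at h0
  exact Complex.ext (le_antisymm h h0.1) h0.2.symm

/-- The exponential is injective on Hermitian matrices. -/
theorem Matrix.IsHermitian.exp_injective {X Y : Matrix ι ι ℂ} (hX : X.IsHermitian)
    (hY : Y.IsHermitian) (h : NormedSpace.exp X = NormedSpace.exp Y) : X = Y := by
  have := trace_sub_sq_le hX hY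
  rw [h, Matrix.nonsing_inv_mul _ ((Matrix.isUnit_iff_isUnit_det _).1 (Matrix.isUnit_exp Y)),
    Matrix.trace_one, Complex.natCast_re] at this
  exact sub_eq_zero.1 (eq_zero_of_trace_sq_le (hX.sub hY) (by linarith))

open scoped Matrix.Norms.Frobenius in
theorem frobenius_norm_sq {X : Matrix ι ι ℂ} (hX : X.IsHermitian) :
    ‖X‖ ^ 2 = (X * X).trace.re := by
  rw [Matrix.frobenius_norm_def, ← Real.sqrt_eq_rpow, Real.sq_sqrt (by positivity), Matrix.trace,
    Complex.re_sum]
  refine Finset.sum_congr rfl fun i _ ↦ ?_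
  rw [Matrix.diag_apply, Matrix.mul_apply, Complex.re_sum]
  refine Finset.sum_congr rfl fun j _ ↦ ?_
  have : X j i = star (X i j) := (hX.apply j i).symm
  rw [this, Complex.star_def, Complex.mul_conj, Complex.ofReal_re, Complex.normSq_eq_norm_sq]
  norm_cast

/-- The defect of `trace_sub_sq_le` summed over `n` equal pieces of a geodesic: as `n → ∞`, the
bound tends to `x²`. -/
theorem mul_sq_exp_add_exp_neg_le (x : ℝ) {n : ℕ} (hn : n ≠ 0) :
    (n : ℝ) ^ 2 * (Real.exp (x / n) + Real.exp (-(x / n)) - 2) ≤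
      x ^ 2 * Real.exp ((x / n) ^ 2 / 2) := by
  have hn' : (n : ℝ) ≠ 0 := Nat.cast_ne_zero.2 hn
  set y := x / n with hy
  have hx : x = n * y := by rw [hy]; field_simp
  have h1 := Real.cosh_le_exp_half_sq y
  have h2 : Real.exp (y ^ 2 / 2) - 1 ≤ y ^ 2 / 2 * Real.exp (y ^ 2 / 2) := by
    have a := Real.add_one_le_exp (-(y ^ 2 / 2))
    have b : Real.exp (-(y ^ 2 / 2)) * Real.exp (y ^ 2 / 2) = 1 := by
      rw [← Real.exp_add]; simp
    nlinarith [Real.exp_pos (y ^ 2 / 2)]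
  have h3 : Real.exp y + Real.exp (-y) - 2 ≤ y ^ 2 * Real.exp (y ^ 2 / 2) := by
    have := Real.cosh_eq y
    linarith
  rw [hx, mul_pow, mul_assoc]
  exact mul_le_mul_of_nonneg_left h3 (sq_nonneg _)

open scoped Matrix.Norms.Frobenius in
/-- The **exponential metric increasing property**: cut the geodesic from `exp X` to `exp Y` into
`n` equal pieces, apply `trace_sub_sq_le` to each of them, and let `n` tend to infinity. -/
theorem trace_sub_sq_le_matSq {X Y : Matrix ι ι ℂ} (hX : X.IsHermitian) (hY : Y.IsHermitian) :
    ((X - Y) * (X - Y)).trace.re ≤ matSq (NormedSpace.exp X) (NormedSpace.exp Y) := by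
  obtain ⟨S, T, ρ, h⟩ := exists_isSimDiag hX.posDef_exp hY.posDef_exp
  choose L hL hLe using fun t ↦ (posDef_diagCurve h.mul_eq_one ρ t).exists_log
  have h0 : L 0 = X := (hL 0).exp_injective hX (by rw [hLe, h.diagCurve_zero])
  have h1 : L 1 = Y := (hL 1).exp_injective hY (by rw [hLe, h.diagCurve_one])
  have step : ∀ s t, ‖L s - L t‖ ^ 2 ≤
      ∑ i, (Real.exp ((t - s) * ρ i) + Real.exp (-((t - s) * ρ i)) - 2) := fun s t ↦ by
    have d := isSimDiag_diagCurve h.mul_eq_one ρ s t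
    rw [frobenius_norm_sq ((hL s).sub (hL t))]
    refine (trace_sub_sq_le (hL s) (hL t)).trans_eq ?_
    rw [hLe, hLe, d.trace_inv_mul, d.trace_inv_mul', Complex.ofReal_re, Complex.ofReal_re]
    simp [Finset.sum_add_distrib, Finset.sum_sub_distrib, mul_comm]
  have bound : ∀ n : ℕ, n ≠ 0 → ‖X - Y‖ ^ 2 ≤ ∑ i, ρ i ^ 2 * Real.exp ((ρ i / n) ^ 2 / 2) := by
    intro n hn
    have hn' : (n : ℝ) ≠ 0 := Nat.cast_ne_zero.2 hn
    set c := ∑ i, (Real.exp (ρ i / n) + Real.exp (-(ρ i / n)) - 2) with hc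
    have d : dist (L ((0 : ℕ) / n)) (L ((n : ℕ) / n)) ≤ ∑ _k ∈ Finset.range n, √c := by
      refine (dist_le_range_sum_dist (fun k : ℕ ↦ L (k / n)) n).trans
        (Finset.sum_le_sum fun k _ ↦ ?_)
      rw [dist_eq_norm]
      refine Real.le_sqrt_of_sq_le ((step _ _).trans_eq ?_)
      have : ((k + 1 : ℕ) : ℝ) / n - k / n = 1 / n := by
        push_cast
        ring
      rw [hc, this]
      refine Finset.sum_congr rfl fun i _ ↦ ?_
      rw [div_mul_eq_mul_div, one_mul]
    rw [Nat.cast_zero, zero_div, div_self hn', h0, h1, Finset.sum_const, Finset.card_range,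
      nsmul_eq_mul, dist_eq_norm] at d
    have hc0 : 0 ≤ c := Finset.sum_nonneg fun i _ ↦
      (sq_nonneg _).trans (sq_le_exp_add_exp_neg (ρ i / n))
    calc ‖X - Y‖ ^ 2 ≤ (n * √c) ^ 2 := by gcongr
      _ = ∑ i, (n : ℝ) ^ 2 * (Real.exp (ρ i / n) + Real.exp (-(ρ i / n)) - 2) := by
        rw [mul_pow, Real.sq_sqrt hc0, hc, Finset.mul_sum]
      _ ≤ _ := Finset.sum_le_sum fun i _ ↦ mul_sq_exp_add_exp_neg_le _ hn
  rw [← frobenius_norm_sq (hX.sub hY), h.matSq_eq]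
  refine ge_of_tendsto (x := atTop) (f := fun n : ℕ ↦ ∑ i, ρ i ^ 2 * Real.exp ((ρ i / n) ^ 2 / 2))
    ?_ (eventually_atTop.2 ⟨1, fun n hn ↦ bound n (by omega)⟩)
  refine tendsto_finsetSum _ fun i _ ↦ ?_
  have t1 : Tendsto (fun n : ℕ ↦ ρ i / (n : ℝ)) atTop (𝓝 0) :=
    tendsto_const_div_atTop_nhds_zero_nat _
  have t2 : Tendsto (fun x : ℝ ↦ ρ i ^ 2 * Real.exp (x ^ 2 / 2)) (𝓝 0)
      (𝓝 (ρ i ^ 2 * Real.exp ((0 : ℝ) ^ 2 / 2))) := Continuous.tendsto (by fun_prop) 0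
  simpa [Function.comp_def] using t2.comp t1

/-! ### The comparison inequality and the infinitesimal bound for matrices -/

theorem matSq_one_exp {X : Matrix ι ι ℂ} (hX : X.IsHermitian) :
    matSq 1 (NormedSpace.exp X) = (X * X).trace.re := by
  obtain ⟨U, f, h1, h2, rfl⟩ := hX.exists_diag
  have : IsSimDiag 1 (NormedSpace.exp (U * realDiag f * Uᴴ)) U Uᴴ f :=
    ⟨h1, h1.symm, exp_conj_realDiag h1 f⟩
  rw [this.matSq_eq]
  calc ∑ i, f i ^ 2 = (realDiag f * realDiag f).trace.re := by
        rw [realDiag_mul, trace_realDiag, Complex.ofReal_re]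
        simp only [sq]
    _ = (U * (realDiag f * ((Uᴴ * U) * realDiag f) * Uᴴ)).trace.re := by
        rw [h2, Matrix.one_mul, Matrix.trace_mul_comm U, Matrix.mul_assoc (_ * _), h2,
          Matrix.mul_one]
    _ = _ := by simp only [Matrix.mul_assoc]

/-- The CAT(0) inequality for the affine-invariant distance: after a congruence the point `γ(t)` is
`1`, where the metric increasing property compares with the flat space of Hermitian matrices. -/
theorem IsSimDiag.matSq_cat {S T : Matrix ι ι ℂ} {ρ : ι → ℝ} (h : IsSimDiag P Q S T ρ)
    (hR : R.PosDef) {t : ℝ} (ht : t ∈ Icc (0 : ℝ) 1) :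
    matSq R (diagCurve S ρ t) ≤
      (1 - t) * matSq R P + t * matSq R Q - t * (1 - t) * matSq P Q := by
  -- the congruence that moves `γ(t)` to `1`
  set C : Matrix ι ι ℂ := realDiag (fun i ↦ Real.exp (-(t * ρ i / 2))) * T
  set C' : Matrix ι ι ℂ := S * realDiag (fun i ↦ Real.exp (t * ρ i / 2))
  have hC' : C' * C = 1 := (isSimDiag_diagCurve h.mul_eq_one ρ t t).mul_eq_one
  have hC : C * C' = 1 := mul_eq_one_comm.1 hC'
  have hγ : ∀ s, C * diagCurve S ρ s * Cᴴ = NormedSpace.exp (realDiag fun i ↦ (s - t) * ρ i) := by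
    intro s
    have hd := (isSimDiag_diagCurve h.mul_eq_one ρ t s).right
    have hH : C'ᴴ * Cᴴ = 1 := by rw [← Matrix.conjTranspose_mul, hC, Matrix.conjTranspose_one]
    rw [hd, exp_realDiag]
    change C * (C' * realDiag (fun i ↦ Real.exp ((s - t) * ρ i)) * C'ᴴ) * Cᴴ = _
    calc _ = (C * C') * realDiag (fun i ↦ Real.exp ((s - t) * ρ i)) * (C'ᴴ * Cᴴ) := by
          simp only [Matrix.mul_assoc]
      _ = _ := by rw [hC, hH, Matrix.one_mul, Matrix.mul_one]
  have hD : ∀ f : ι → ℝ, (realDiag f).IsHermitian := realDiag_conjTranspose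
  obtain ⟨Z, hZ, hZR⟩ := ((posDef_congr hC).2 hR).exists_log
  have inv : ∀ s, matSq R (diagCurve S ρ s) =
      matSq (NormedSpace.exp Z) (NormedSpace.exp (realDiag fun i ↦ (s - t) * ρ i)) := fun s ↦ by
    rw [← matSq_congr hC hR, hγ, hZR]
  have lower : ∀ s, ((Z - realDiag fun i ↦ (s - t) * ρ i) *
      (Z - realDiag fun i ↦ (s - t) * ρ i)).trace.re ≤ matSq R (diagCurve S ρ s) := fun s ↦ by
    rw [inv]
    exact trace_sub_sq_le_matSq hZ (hD _)
  have e0 : matSq R (diagCurve S ρ t) = (Z * Z).trace.re := by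
    rw [inv, matSq_comm hZ.posDef_exp (hD _).posDef_exp]
    simp only [sub_self, zero_mul]
    rw [exp_realDiag]
    simp only [Real.exp_zero]
    rw [realDiag_one, matSq_one_exp hZ]
  have expand : ∀ s, ((Z - realDiag fun i ↦ (s - t) * ρ i) *
      (Z - realDiag fun i ↦ (s - t) * ρ i)).trace.re = (Z * Z).trace.re -
        2 * (s - t) * (Z * realDiag ρ).trace.re + (s - t) ^ 2 * ∑ i, ρ i ^ 2 := fun s ↦ by
    have : (realDiag fun i ↦ (s - t) * ρ i) = ((s - t : ℝ) : ℂ) • realDiag ρ := by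
      ext i j
      simp only [realDiag, Matrix.smul_apply, Matrix.diagonal_apply, smul_eq_mul]
      split_ifs <;> simp
    rw [this, Matrix.sub_mul, Matrix.mul_sub, Matrix.mul_sub]
    simp only [Matrix.trace_sub, Matrix.mul_smul, Matrix.smul_mul, Matrix.trace_smul, smul_eq_mul]
    rw [Matrix.trace_mul_comm (realDiag ρ) Z, realDiag_mul, trace_realDiag]
    simp only [Complex.sub_re, Complex.re_ofReal_mul, Complex.ofReal_re, ← sq]
    ring
  have l0 := lower 0
  have l1 := lower 1
  rw [expand, h.diagCurve_zero] at l0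
  rw [expand, h.diagCurve_one] at l1
  rw [e0, h.matSq_eq]
  have a0 := mul_le_mul_of_nonneg_left l0 (sub_nonneg.2 ht.2)
  have a1 := mul_le_mul_of_nonneg_left l1 ht.1
  nlinarith

/-- The CAT(0) inequality for `matSqDist`, for every sign of `α`: the `α` term is the square of
`log det`, which is affine along the curve and so satisfies the inequality with equality. -/
theorem IsSimDiag.matSqDist_cat {S T : Matrix ι ι ℂ} {ρ : ι → ℝ} (h : IsSimDiag P Q S T ρ)
    (α : ℝ) (hR : R.PosDef) {t : ℝ} (ht : t ∈ Icc (0 : ℝ) 1) :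
    matSqDist α R (diagCurve S ρ t) ≤
      (1 - t) * matSqDist α R P + t * matSqDist α R Q - t * (1 - t) * matSqDist α P Q := by
  have hc := posDef_diagCurve h.mul_eq_one ρ
  have h0 := hc 0
  have e1 := matLogDet_add hR h0 (hc t)
  have e2 := matLogDet_add hR h0 (hc 1)
  have e3 := (isSimDiag_diagCurve h.mul_eq_one ρ 0 t).matLogDet_eq
  have e4 := h.matLogDet_eq
  simp only [h.diagCurve_zero, h.diagCurve_one] at e1 e2 e3
  rw [← Finset.mul_sum, sub_zero, ← e4] at e3
  have := h.matSq_cat hR ht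
  simp only [matSqDist, e1, e2, e3]
  nlinarith

theorem matSqDist_comm (α : ℝ) (hP : P.PosDef) (hQ : Q.PosDef) :
    matSqDist α P Q = matSqDist α Q P := by
  rw [matSqDist, matSq_comm hP hQ, matLogDet_comm hP hQ, neg_sq, matSqDist]

/-- By the Cauchy–Schwarz inequality `(∑ ρᵢ)² ≤ r ∑ ρᵢ²`, the condition `α > -1/r` says that
`matSqDist` is positive definite. -/
theorem matSqDist_lower {α : ℝ} (hα : -(1 / (Fintype.card ι : ℝ)) < α) (hP : P.PosDef)
    (hQ : Q.PosDef) : ∃ κ > 0, κ * matSq P Q ≤ matSqDist α P Q := by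
  obtain ⟨S, T, ρ, h⟩ := exists_isSimDiag hP hQ
  have cs : (∑ i, ρ i) ^ 2 ≤ Fintype.card ι * ∑ i, ρ i ^ 2 := sq_sum_le_card_mul_sum_sq
  rw [matSqDist, h.matSq_eq, h.matLogDet_eq]
  rcases le_total 0 α with h0 | h0
  · refine ⟨1, one_pos, ?_⟩
    nlinarith [sq_nonneg (∑ i, ρ i)]
  · refine ⟨1 + α * Fintype.card ι, ?_, ?_⟩
    · rcases (Nat.cast_nonneg (α := ℝ) (Fintype.card ι)).eq_or_lt with hc | hc
      · simp [← hc]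
      · have := mul_lt_mul_of_pos_right hα hc
        rw [neg_mul, one_div, inv_mul_cancel₀ hc.ne'] at this
        linarith
    · nlinarith

theorem matSqDist_nonneg {α : ℝ} (hα : -(1 / (Fintype.card ι : ℝ)) < α) (hP : P.PosDef)
    (hQ : Q.PosDef) : 0 ≤ matSqDist α P Q := by
  obtain ⟨S, T, ρ, h⟩ := exists_isSimDiag hP hQ
  obtain ⟨κ, hκ, hle⟩ := matSqDist_lower hα hP hQ
  refine le_trans (mul_nonneg hκ.le ?_) hle
  rw [h.matSq_eq]
  positivity

theorem eq_of_matSqDist_eq_zero {α : ℝ} (hα : -(1 / (Fintype.card ι : ℝ)) < α) (hP : P.PosDef)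
    (hQ : Q.PosDef) (h0 : matSqDist α P Q = 0) : P = Q := by
  obtain ⟨S, T, ρ, h⟩ := exists_isSimDiag hP hQ
  obtain ⟨κ, hκ, hle⟩ := matSqDist_lower hα hP hQ
  rw [h0, h.matSq_eq] at hle
  have hs : ∑ i, ρ i ^ 2 ≤ 0 := by
    by_contra! hs
    nlinarith [mul_pos hκ hs]
  have hz : ∀ i, ρ i = 0 := fun i ↦ by
    have := (Finset.sum_eq_zero_iff_of_nonneg fun i _ ↦ sq_nonneg (ρ i)).1
      (le_antisymm hs (Finset.sum_nonneg fun i _ ↦ sq_nonneg (ρ i))) i (Finset.mem_univ i)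
    simpa using this
  rw [h.left, h.right]
  simp [hz, realDiag_one]

theorem matSqDist_self (α : ℝ) (hP : P.PosDef) : matSqDist α P P = 0 := by
  obtain ⟨S, T, ρ, h⟩ := exists_isSimDiag hP hP
  have h' : IsSimDiag P P S T 0 := ⟨h.mul_eq_one, h.left, by simp [realDiag_one, h.left]⟩
  simp [matSqDist, h'.matSq_eq, h'.matLogDet_eq]

/-- An upper bound for the squared distance of `P` and `Q = P + ε M`, divided by `ε²`. It reduces to
`tr(P⁻¹ M P⁻¹ M) + α (tr P⁻¹ M)²` for `Q = P`. -/
def matBound (α : ℝ) (P Q M : Matrix ι ι ℂ) : ℝ :=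
  (P⁻¹ * M * (Q⁻¹ * M)).trace.re + α * (P⁻¹ * M).trace.re ^ 2 +
    |α| * (|(Q⁻¹ * M).trace.re - (P⁻¹ * M).trace.re| *
      (2 * |(P⁻¹ * M).trace.re| + |(Q⁻¹ * M).trace.re - (P⁻¹ * M).trace.re|))

/-- With `ρ` the logarithms of the eigenvalues of `P⁻¹ Q`, the trace term is bounded by
`ρ² ≤ exp ρ + exp (-ρ) - 2`, and the `α` term by
`ε tr(Q⁻¹ M) = ∑ (1 - exp (-ρᵢ)) ≤ ∑ ρᵢ ≤ ∑ (exp ρᵢ - 1) = ε tr(P⁻¹ M)`. -/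
theorem matSqDist_le_matBound (α : ℝ) (hP : P.PosDef) (hQ : Q.PosDef) {M : Matrix ι ι ℂ} {ε : ℝ}
    (hM : Q = P + (ε : ℂ) • M) : matSqDist α P Q ≤ ε ^ 2 * matBound α P Q M := by
  obtain ⟨S, T, ρ, h⟩ := exists_isSimDiag hP hQ
  have uP : P⁻¹ * P = 1 := Matrix.nonsing_inv_mul _ ((Matrix.isUnit_iff_isUnit_det _).1 hP.isUnit)
  have uQ : Q⁻¹ * Q = 1 := Matrix.nonsing_inv_mul _ ((Matrix.isUnit_iff_isUnit_det _).1 hQ.isUnit)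
  have hM' : (ε : ℂ) • M = Q - P := by rw [hM]; simp
  have eP : (ε : ℂ) • (P⁻¹ * M) = P⁻¹ * Q - 1 := by
    rw [← Matrix.mul_smul, hM', Matrix.mul_sub, uP]
  have eQ : (ε : ℂ) • (Q⁻¹ * M) = 1 - Q⁻¹ * P := by
    rw [← Matrix.mul_smul, hM', Matrix.mul_sub, uQ]
  have uQ' : Q * Q⁻¹ = 1 := mul_eq_one_comm.1 uQ
  have t1 : ε * (P⁻¹ * M).trace.re = ∑ i, (Real.exp (ρ i) - 1) := by
    rw [← Complex.re_ofReal_mul, ← smul_eq_mul, ← Matrix.trace_smul, eP, Matrix.trace_sub,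
      h.trace_inv_mul, Complex.sub_re, Complex.ofReal_re]
    simp
  have t2 : ε * (Q⁻¹ * M).trace.re = ∑ i, (1 - Real.exp (-ρ i)) := by
    rw [← Complex.re_ofReal_mul, ← smul_eq_mul, ← Matrix.trace_smul, eQ, Matrix.trace_sub,
      h.trace_inv_mul', Complex.sub_re, Complex.ofReal_re]
    simp
  have t3 : ε ^ 2 * (P⁻¹ * M * (Q⁻¹ * M)).trace.re =
      ∑ i, (Real.exp (ρ i) + Real.exp (-ρ i) - 2) := by
    have : (ε : ℂ) • ((ε : ℂ) • (P⁻¹ * M * (Q⁻¹ * M))) = P⁻¹ * Q - 1 - (1 - Q⁻¹ * P) := by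
      rw [← Matrix.mul_smul, ← Matrix.smul_mul, eP, eQ, Matrix.mul_sub, Matrix.mul_one,
        Matrix.sub_mul, Matrix.one_mul, Matrix.mul_assoc, ← Matrix.mul_assoc Q, uQ',
        Matrix.one_mul, uP]
    rw [sq, mul_assoc, ← Complex.re_ofReal_mul, ← Complex.re_ofReal_mul, ← smul_eq_mul,
      ← smul_eq_mul, ← Matrix.trace_smul, ← Matrix.trace_smul, this]
    simp only [Matrix.trace_sub, h.trace_inv_mul, h.trace_inv_mul', Complex.sub_re,
      Complex.ofReal_re, Matrix.trace_one, Complex.natCast_re]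
    simp [Finset.sum_add_distrib, Finset.sum_sub_distrib]
    ring
  have l1 : ∑ i, ρ i ≤ ε * (P⁻¹ * M).trace.re := by
    rw [t1]
    exact Finset.sum_le_sum fun i _ ↦ by linarith [Real.add_one_le_exp (ρ i)]
  have l2 : ε * (Q⁻¹ * M).trace.re ≤ ∑ i, ρ i := by
    rw [t2]
    exact Finset.sum_le_sum fun i _ ↦ by linarith [Real.add_one_le_exp (-ρ i)]
  have l3 : ∑ i, ρ i ^ 2 ≤ ε ^ 2 * (P⁻¹ * M * (Q⁻¹ * M)).trace.re := by
    rw [t3]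
    exact Finset.sum_le_sum fun i _ ↦ sq_le_exp_add_exp_neg (ρ i)
  rw [matSqDist, h.matSq_eq, h.matLogDet_eq, matBound]
  set τ := (P⁻¹ * M).trace.re
  set σ := (Q⁻¹ * M).trace.re
  set l := ∑ i, ρ i
  have d1 : |l - ε * τ| ≤ |ε| * |σ - τ| := by
    rw [← abs_mul, abs_of_nonpos (by linarith : l - ε * τ ≤ 0)]
    calc -(l - ε * τ) ≤ -(ε * (σ - τ)) := by linarith
      _ ≤ _ := neg_le_abs _
  have d2 : |l + ε * τ| ≤ |ε| * (2 * |τ| + |σ - τ|) := by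
    calc |l + ε * τ| = |(l - ε * τ) + 2 * (ε * τ)| := by ring_nf
      _ ≤ |l - ε * τ| + |2 * (ε * τ)| := abs_add_le _ _
      _ ≤ |ε| * |σ - τ| + 2 * (|ε| * |τ|) := by
        rw [abs_mul 2, abs_mul, abs_two]
        linarith
      _ = _ := by ring
  have d3 : α * (l ^ 2 - (ε * τ) ^ 2) ≤ |α| * (ε ^ 2 * (|σ - τ| * (2 * |τ| + |σ - τ|))) := by
    refine (le_abs_self _).trans ?_
    rw [abs_mul]
    refine mul_le_mul_of_nonneg_left ?_ (abs_nonneg _)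
    calc |l ^ 2 - (ε * τ) ^ 2| = |l - ε * τ| * |l + ε * τ| := by rw [← abs_mul]; ring_nf
      _ ≤ (|ε| * |σ - τ|) * (|ε| * (2 * |τ| + |σ - τ|)) :=
        mul_le_mul d1 d2 (abs_nonneg _) (by positivity)
      _ = |ε| ^ 2 * (|σ - τ| * (2 * |τ| + |σ - τ|)) := by ring
      _ = _ := by rw [sq_abs]
  nlinarith

end Matrices

/-! ### Smoothness of the matrix logarithm and of the matrix exponential -/

section ExpSubOneDiv

variable {𝔸 : Type*} [NormedRing 𝔸] [NormedAlgebra ℝ 𝔸]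

/-- The entire function `(exp a - 1) / a = ∑ aⁿ / (n + 1)!` on a real Banach algebra. -/
def expSubOneDiv (a : 𝔸) : 𝔸 :=
  FormalMultilinearSeries.ofScalarsSum (E := 𝔸) (fun n : ℕ ↦ (((n + 1).factorial : ℝ))⁻¹) a

theorem expSubOneDiv_zero : expSubOneDiv (0 : 𝔸) = 1 := by
  simp [expSubOneDiv]

variable [CompleteSpace 𝔸]

theorem expSubOneDiv_hasFPowerSeriesOnBall :
    HasFPowerSeriesOnBall (expSubOneDiv : 𝔸 → 𝔸)
      (FormalMultilinearSeries.ofScalars 𝔸 fun n : ℕ ↦ (((n + 1).factorial : ℝ))⁻¹) 0 ⊤ := by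
  have hr : (FormalMultilinearSeries.ofScalars 𝔸
      fun n : ℕ ↦ (((n + 1).factorial : ℝ))⁻¹).radius = ⊤ := by
    refine FormalMultilinearSeries.ofScalars_radius_eq_top_of_tendsto 𝔸 _
      (.of_forall fun n ↦ by positivity) ?_
    have : (fun n : ℕ ↦ ‖(((n.succ + 1).factorial : ℝ))⁻¹‖ / ‖(((n + 1).factorial : ℝ))⁻¹‖) =
        fun n : ℕ ↦ 1 / ((n + 1 : ℕ) + 1 : ℝ) := by
      ext n
      rw [Nat.factorial_succ (n + 1), norm_inv, norm_inv, Nat.cast_mul, norm_mul]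
      simp only [Real.norm_natCast]
      have : ((n + 1).factorial : ℝ) ≠ 0 := by positivity
      field_simp
      push_cast
      ring
    rw [this]
    exact (tendsto_add_atTop_iff_nat 1).2 tendsto_one_div_add_atTop_nhds_zero_nat
  have := (FormalMultilinearSeries.ofScalars 𝔸
      fun n : ℕ ↦ (((n + 1).factorial : ℝ))⁻¹).hasFPowerSeriesOnBall (by rw [hr]; simp)
  rwa [hr] at this

theorem contDiff_expSubOneDiv : ContDiff ℝ ∞ (expSubOneDiv : 𝔸 → 𝔸) := by
  rw [contDiff_iff_contDiffAt]
  intro a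
  exact (expSubOneDiv_hasFPowerSeriesOnBall.analyticAt_of_mem (by simp)).contDiffAt

theorem mul_expSubOneDiv (a : 𝔸) : a * expSubOneDiv a = NormedSpace.exp a - 1 := by
  have h1 : HasSum (fun n : ℕ ↦ (((n + 1).factorial : ℝ))⁻¹ • a ^ n) (expSubOneDiv a) := by
    have := expSubOneDiv_hasFPowerSeriesOnBall.hasSum (y := a) (by simp)
    simpa [FormalMultilinearSeries.ofScalars_apply_eq] using this
  have h2 := h1.mul_left a
  have h3 := NormedSpace.exp_series_hasSum_exp' (𝕂 := ℝ) a
  have h4 := (hasSum_nat_add_iff' 1).2 h3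
  simp only [Finset.range_one, Finset.sum_singleton, Nat.factorial_zero, Nat.cast_one, inv_one,
    pow_zero, one_smul] at h4
  simp only [mul_smul_comm, ← pow_succ'] at h2
  exact h2.unique h4

end ExpSubOneDiv

/-- An endomorphism of a finite-dimensional space whose directional derivatives at `x` do not vanish
has a smooth local right inverse. -/
theorem ContDiff.exists_local_right_inverse {V : Type*} [NormedAddCommGroup V] [NormedSpace ℝ V]
    [FiniteDimensional ℝ V] {f : V → V} (hf : ContDiff ℝ ∞ f) {x : V}
    (hx : ∀ k, HasDerivAt (fun ε : ℝ ↦ f (x + ε • k)) 0 0 → k = 0) :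
    ∃ g : V → V, ContDiffAt ℝ ∞ g (f x) ∧ ∀ᶠ p in 𝓝 (f x), f (g p) = p := by
  have hd := (hf.differentiable (by simp)).differentiableAt (x := x) |>.hasFDerivAt
  have hinj : Function.Injective (fderiv ℝ f x) := by
    rw [injective_iff_map_eq_zero]
    intro k hk
    refine hx k ?_
    have hl : HasDerivAt (fun ε : ℝ ↦ x + ε • k) ((1 : ℝ) • k) 0 :=
      ((hasDerivAt_id (0 : ℝ)).smul_const k).const_add x
    have hd' : HasFDerivAt f (fderiv ℝ f x) (x + (0 : ℝ) • k) := by simpa using hd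
    have := hd'.comp_hasDerivAt (0 : ℝ) hl
    rwa [one_smul, hk] at this
  have : CompleteSpace V := FiniteDimensional.complete ℝ V
  let e : V ≃L[ℝ] V :=
    (LinearEquiv.ofInjectiveEndo (fderiv ℝ f x).toLinearMap hinj).toContinuousLinearEquiv
  have hd' : HasFDerivAt f (e : V →L[ℝ] V) x := by
    convert hd using 1
    ext1 k
    rfl
  have hfa : ContDiffAt ℝ ∞ f x := hf.contDiffAt
  exact ⟨hfa.localInverse hd' (by simp), hfa.to_localInverse hd' (by simp),
    (hfa.hasStrictFDerivAt' hd' (by simp)).eventually_right_inverse⟩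

theorem HasDerivAt.comp_of_eq_zero {V W : Type*} [NormedAddCommGroup V] [NormedSpace ℝ V]
    [NormedAddCommGroup W] [NormedSpace ℝ W] {F : V → W} (hF : Differentiable ℝ F) {c : ℝ → V}
    {x : ℝ} (hc : HasDerivAt c 0 x) : HasDerivAt (fun ε ↦ F (c ε)) 0 x := by
  have := (hF (c x)).hasFDerivAt.comp_hasDerivAt x hc
  rwa [map_zero] at this

section MatrixLog

open scoped ComplexOrder Matrix Matrix.Norms.Operator

variable {ι : Type*} [DecidableEq ι] [Fintype ι]

theorem contDiff_matrix_exp :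
    ContDiff ℝ ∞ (NormedSpace.exp : Matrix ι ι ℂ → Matrix ι ι ℂ) := by
  rw [contDiff_iff_contDiffAt]
  intro x
  exact (NormedSpace.exp_analytic (𝕂 := ℝ) x).contDiffAt

theorem contDiffAt_matrix_inv {A : Matrix ι ι ℂ} (h : IsUnit A) :
    ContDiffAt ℝ ∞ (fun A : Matrix ι ι ℂ ↦ A⁻¹) A := by
  simp_rw [Matrix.nonsing_inv_eq_ringInverse]
  obtain ⟨u, rfl⟩ := h
  exact contDiffAt_ringInverse ℝ u

open Classical in
/-- The Hermitian logarithm of a positive definite matrix (and `0` for other matrices). -/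
def matLog (P : Matrix ι ι ℂ) : Matrix ι ι ℂ :=
  if h : ∃ X : Matrix ι ι ℂ, X.IsHermitian ∧ NormedSpace.exp X = P then h.choose else 0

theorem matLog_spec {P : Matrix ι ι ℂ} (hP : P.PosDef) :
    (matLog P).IsHermitian ∧ NormedSpace.exp (matLog P) = P := by
  rw [matLog, dif_pos hP.exists_log]
  exact hP.exists_log.choose_spec

theorem matLog_eq {X P : Matrix ι ι ℂ} (hX : X.IsHermitian) (h : NormedSpace.exp X = P) :
    matLog P = X := by
  have hP : P.PosDef := h ▸ hX.posDef_exp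
  exact (matLog_spec hP).1.exp_injective hX ((matLog_spec hP).2.trans h.symm)

theorem trace_inv_mul_sub_mul {P Q : Matrix ι ι ℂ} (hP : P⁻¹ * P = 1) (hQ : Q⁻¹ * Q = 1) :
    (P⁻¹ * (Q - P) * (Q⁻¹ * (Q - P))).trace =
      (P⁻¹ * Q).trace + (Q⁻¹ * P).trace - 2 * Fintype.card ι := by
  have hQ' : Q * Q⁻¹ = 1 := mul_eq_one_comm.1 hQ
  have : P⁻¹ * (Q - P) * (Q⁻¹ * (Q - P)) = P⁻¹ * Q - 1 - (1 - Q⁻¹ * P) := by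
    rw [Matrix.mul_sub, hP, Matrix.mul_sub Q⁻¹, hQ, Matrix.mul_sub, Matrix.mul_one,
      Matrix.sub_mul, Matrix.one_mul, Matrix.mul_assoc, ← Matrix.mul_assoc Q, hQ', Matrix.one_mul,
      hP]
  rw [this, Matrix.trace_sub, Matrix.trace_sub, Matrix.trace_sub, Matrix.trace_one]
  ring

/-- The derivative of `exp` at a Hermitian matrix is injective on Hermitian matrices, because `exp`
does not decrease distances to first order, by `trace_sub_sq_le`. -/
theorem eq_zero_of_hasDerivAt_exp {X K : Matrix ι ι ℂ} (hX : X.IsHermitian) (hK : K.IsHermitian)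
    (h : HasDerivAt (fun ε : ℝ ↦ NormedSpace.exp (X + ε • K)) 0 0) : K = 0 := by
  set c : ℝ → Matrix ι ι ℂ := fun ε ↦ NormedSpace.exp (X + ε • K) with hc
  have hh : ∀ ε : ℝ, (X + ε • K).IsHermitian := fun ε ↦ hX.add (by
    rw [Matrix.IsHermitian, Matrix.conjTranspose_smul, hK]; simp)
  have hu : ∀ ε, IsUnit (c ε) := fun ε ↦ Matrix.isUnit_exp _
  have hinv : ∀ ε, (c ε)⁻¹ * c ε = 1 := fun ε ↦
    Matrix.nonsing_inv_mul _ ((Matrix.isUnit_iff_isUnit_det _).1 (hu ε))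
  have hc0 : c 0 = NormedSpace.exp X := by simp [hc]
  refine eq_zero_of_trace_sq_le hK ?_
  have hle : ∀ᶠ ε in 𝓝[≠] (0 : ℝ),
      (K * K).trace.re ≤ ((c 0)⁻¹ * slope c 0 ε * ((c ε)⁻¹ * slope c 0 ε)).trace.re := by
    filter_upwards [self_mem_nhdsWithin] with ε (hε : ε ≠ 0)
    have h1 := trace_sub_sq_le hX (hh ε)
    rw [← hc0] at h1
    have h2 := congrArg Complex.re (trace_inv_mul_sub_mul (hinv 0) (hinv ε))
    have h3 : X - (X + ε • K) = (-ε) • K := by rw [sub_add_cancel_left, neg_smul]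
    have h4 : c ε - c 0 = ε • slope c 0 ε := by
      have := sub_smul_slope c 0 ε
      rwa [sub_zero, vsub_eq_sub, eq_comm] at this
    rw [h3] at h1
    rw [h4] at h2
    simp only [Matrix.smul_mul, Matrix.mul_smul, Matrix.trace_smul, Complex.smul_re,
      smul_eq_mul] at h1 h2
    have h5 : (0 : ℝ) < ε ^ 2 := by positivity
    simp only [Complex.sub_re, Complex.add_re, Complex.mul_re, Complex.re_ofNat, Complex.natCast_re,
      Complex.im_ofNat, Complex.natCast_im, mul_zero, sub_zero] at h2
    refine le_of_mul_le_mul_left ?_ h5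
    calc ε ^ 2 * (K * K).trace.re = -ε * (-ε * (K * K).trace.re) := by ring
      _ ≤ _ := h1
      _ = ε * (ε * ((c 0)⁻¹ * slope c 0 ε * ((c ε)⁻¹ * slope c 0 ε)).trace.re) := h2.symm
      _ = _ := by ring
  have hs : Tendsto (slope c 0) (𝓝[≠] 0) (𝓝 0) := hasDerivAt_iff_tendsto_slope.1 h
  have hi : Tendsto (fun ε ↦ (c ε)⁻¹) (𝓝[≠] 0) (𝓝 (c 0)⁻¹) :=
    ((contDiffAt_matrix_inv (hu 0)).continuousAt.tendsto.comp
      h.continuousAt.tendsto).mono_left nhdsWithin_le_nhds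
  have ht : Tendsto (fun ε ↦ ((c 0)⁻¹ * slope c 0 ε * ((c ε)⁻¹ * slope c 0 ε)).trace.re)
      (𝓝[≠] 0) (𝓝 (((c 0)⁻¹ * 0 * ((c 0)⁻¹ * 0)).trace.re)) := by
    have hcont : Continuous fun A : Matrix ι ι ℂ ↦ A.trace.re :=
      Complex.continuous_re.comp (Continuous.matrix_trace continuous_id)
    exact hcont.continuousAt.tendsto.comp ((hs.const_mul _).mul (hi.mul hs))
  simpa using ge_of_tendsto ht hle

/-- The Hermitian logarithm is smooth on positive definite matrices: near a Hermitian `X` the map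
`Z ↦ exp (Z + Zᴴ) / 2 + (Z - Zᴴ) / 2` is a local diffeomorphism of the space of all matrices, and
it restricts to `exp` on Hermitian matrices. -/
theorem contDiffOn_matLog :
    ContDiffOn ℝ ∞ (matLog : Matrix ι ι ℂ → Matrix ι ι ℂ) {P | P.PosDef} := by
  intro P₀ hP₀
  obtain ⟨hX, hXP⟩ := matLog_spec hP₀
  set X := matLog P₀ with hXdef
  let her : Matrix ι ι ℂ → Matrix ι ι ℂ := fun Z ↦ (2⁻¹ : ℝ) • (Z + Zᴴ)
  let skw : Matrix ι ι ℂ → Matrix ι ι ℂ := fun Z ↦ (2⁻¹ : ℝ) • (Z - Zᴴ)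
  have hher : ∀ Z, (her Z)ᴴ = her Z := fun Z ↦ by
    simp only [her, Matrix.conjTranspose_smul, Matrix.conjTranspose_add,
      Matrix.conjTranspose_conjTranspose, star_trivial, add_comm]
  have hskw : ∀ Z, (skw Z)ᴴ = -skw Z := fun Z ↦ by
    simp only [skw, Matrix.conjTranspose_smul, Matrix.conjTranspose_sub,
      Matrix.conjTranspose_conjTranspose, star_trivial, ← smul_neg, neg_sub]
  have hsum : ∀ Z, her Z + skw Z = Z := fun Z ↦ by
    simp only [her, skw, ← smul_add, add_add_sub_cancel]
    rw [← two_smul ℝ Z, smul_smul]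
    norm_num
  let starL : Matrix ι ι ℂ →L[ℝ] Matrix ι ι ℂ :=
    LinearMap.toContinuousLinearMap
      { toFun := fun Z ↦ Zᴴ
        map_add' := Matrix.conjTranspose_add
        map_smul' := fun r Z ↦ by simp [Matrix.conjTranspose_smul] }
  have hstar : ContDiff ℝ ∞ (fun Z : Matrix ι ι ℂ ↦ Zᴴ) := starL.contDiff
  let f : Matrix ι ι ℂ → Matrix ι ι ℂ := fun Z ↦ NormedSpace.exp (her Z) + skw Z
  have hf : ContDiff ℝ ∞ f :=
    (contDiff_matrix_exp.comp ((contDiff_id.add hstar).const_smul _)).add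
      ((contDiff_id.sub hstar).const_smul _)
  have hherX : her X = X := by
    simp only [her, hX.eq]
    rw [← two_smul ℝ X, smul_smul]
    norm_num
  have hskwX : skw X = 0 := by simp [skw, hX.eq]
  have hfX : f X = P₀ := by simp only [f, hherX, hskwX, hXP, add_zero]
  obtain ⟨g, hg, hright⟩ := hf.exists_local_right_inverse (x := X) fun K hc ↦ by
    have her_add : ∀ ε : ℝ, her (X + ε • K) = X + ε • her K := fun ε ↦ by
      rw [← hherX]
      simp only [her, Matrix.conjTranspose_add, Matrix.conjTranspose_smul, star_trivial, hX.eq]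
      module
    have skw_add : ∀ ε : ℝ, skw (X + ε • K) = ε • skw K := fun ε ↦ by
      simp only [skw, Matrix.conjTranspose_add, Matrix.conjTranspose_smul, star_trivial, hX.eq]
      module
    have e : ∀ ε : ℝ, f (X + ε • K) - (f (X + ε • K))ᴴ = ε • ((2 : ℝ) • skw K) := fun ε ↦ by
      have hx : (NormedSpace.exp (her (X + ε • K)))ᴴ = NormedSpace.exp (her (X + ε • K)) := by
        rw [← Matrix.exp_conjTranspose, hher]
      simp only [f, Matrix.conjTranspose_add, hx, hskw, skw_add, Matrix.conjTranspose_smul,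
        star_trivial]
      module
    have hs0 : skw K = 0 := by
      have d1 := HasDerivAt.comp_of_eq_zero
        ((contDiff_id.sub hstar).differentiable (n := ∞) (by simp)) hc
      have d2 : HasDerivAt (fun ε : ℝ ↦ ε • ((2 : ℝ) • skw K)) ((1 : ℝ) • ((2 : ℝ) • skw K)) 0 :=
        (hasDerivAt_id (0 : ℝ)).smul_const _
      have d3 := d1.congr_of_eventuallyEq (f₁ := fun ε : ℝ ↦ ε • ((2 : ℝ) • skw K))
        (.of_forall fun ε ↦ (e ε).symm)
      have := d2.unique d3
      simpa using this
    have hhK : her K = K := by simpa [hs0] using hsum K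
    rw [← hhK]
    refine eq_zero_of_hasDerivAt_exp hX (hher K) ?_
    refine hc.congr_of_eventuallyEq (.of_forall fun ε ↦ ?_)
    simp only [f, her_add, skw_add, hs0, smul_zero, add_zero]
  rw [hfX] at hg hright
  refine hg.contDiffWithinAt.congr_of_eventuallyEq_of_mem ?_ hP₀
  filter_upwards [nhdsWithin_le_nhds hright, self_mem_nhdsWithin] with P hP (hPd : P.PosDef)
  have hs0 : skw (g P) = 0 := by
    have h1 : (f (g P))ᴴ = f (g P) := by rw [hP]; exact hPd.1
    simp only [f, Matrix.conjTranspose_add, ← Matrix.exp_conjTranspose, hher, hskw] at h1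
    have h2 : -skw (g P) = skw (g P) := add_left_cancel h1
    have h3 : (2 : ℝ) • skw (g P) = 0 := by
      rw [two_smul]
      nth_rewrite 1 [← h2]
      exact neg_add_cancel _
    simpa using h3
  have hh : her (g P) = g P := by simpa [hs0] using hsum (g P)
  refine matLog_eq (by rw [← hh]; exact hher _) ?_
  simpa [f, hs0, hh] using hP

end MatrixLog

/-! ### Geodesics of positive definite matrices -/

section MatrixGeodesic

open scoped ComplexOrder Matrix Matrix.Norms.Operator

variable {ι : Type*} [DecidableEq ι] [Fintype ι]

theorem Matrix.PosDef.inv_mul_self {P : Matrix ι ι ℂ} (hP : P.PosDef) : P⁻¹ * P = 1 :=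
  Matrix.nonsing_inv_mul _ ((Matrix.isUnit_iff_isUnit_det _).1 hP.isUnit)

theorem Matrix.PosDef.mul_inv_self {P : Matrix ι ι ℂ} (hP : P.PosDef) : P * P⁻¹ = 1 :=
  mul_eq_one_comm.1 hP.inv_mul_self

/-- The positive definite square root of a positive definite matrix, as `exp (log P / 2)`. -/
def matRoot (P : Matrix ι ι ℂ) : Matrix ι ι ℂ := NormedSpace.exp ((2⁻¹ : ℝ) • matLog P)

theorem posDef_matRoot {P : Matrix ι ι ℂ} (hP : P.PosDef) : (matRoot P).PosDef := by
  refine Matrix.IsHermitian.posDef_exp ?_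
  rw [Matrix.IsHermitian, Matrix.conjTranspose_smul, (matLog_spec hP).1, star_trivial]

theorem matRoot_mul_self {P : Matrix ι ι ℂ} (hP : P.PosDef) : matRoot P * matRoot P = P := by
  rw [matRoot, ← Matrix.exp_add_of_commute _ _ (Commute.refl _), ← add_smul]
  norm_num
  exact (matLog_spec hP).2

/-- The Hermitian matrix `X` with `exp (P⁻¹ X) = P⁻¹ Q`. -/
def matRelLog (P Q : Matrix ι ι ℂ) : Matrix ι ι ℂ :=
  matRoot P * matLog ((matRoot P)⁻¹ * Q * (matRoot P)⁻¹) * matRoot P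

theorem posDef_root_conj {P Q : Matrix ι ι ℂ} (hP : P.PosDef) (hQ : Q.PosDef) :
    ((matRoot P)⁻¹ * Q * (matRoot P)⁻¹).PosDef := by
  have hR := posDef_matRoot hP
  have := (posDef_congr (A := Q) hR.inv_mul_self).2 hQ
  rwa [Matrix.conjTranspose_nonsing_inv, hR.1] at this

theorem eq_matRelLog {P Q X : Matrix ι ι ℂ} (hP : P.PosDef) (hX : X.IsHermitian)
    (h : NormedSpace.exp (P⁻¹ * X) = P⁻¹ * Q) : X = matRelLog P Q := by
  have hR := posDef_matRoot hP
  set R := matRoot P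
  have hRR : R * R = P := matRoot_mul_self hP
  have hPinv : P⁻¹ = R⁻¹ * R⁻¹ := by rw [← hRR, Matrix.mul_inv_rev]
  have hH : (R⁻¹ * X * R⁻¹).IsHermitian := by
    rw [Matrix.IsHermitian, Matrix.conjTranspose_mul, Matrix.conjTranspose_mul,
      Matrix.conjTranspose_nonsing_inv, hR.1, hX, Matrix.mul_assoc]
  have e1 : R⁻¹ * X * R⁻¹ = R * (P⁻¹ * X) * R⁻¹ := by
    rw [hPinv, Matrix.mul_assoc R⁻¹ R⁻¹ X, ← Matrix.mul_assoc R, hR.mul_inv_self, Matrix.one_mul]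
  have e2 : NormedSpace.exp (R⁻¹ * X * R⁻¹) = R⁻¹ * Q * R⁻¹ := by
    rw [e1, Matrix.exp_conj _ _ hR.isUnit, h, hPinv, Matrix.mul_assoc R⁻¹ R⁻¹ Q,
      ← Matrix.mul_assoc R, hR.mul_inv_self, Matrix.one_mul]
  rw [matRelLog, matLog_eq hH e2]
  calc X = (R * R⁻¹) * X * (R⁻¹ * R) := by
        rw [hR.mul_inv_self, hR.inv_mul_self, Matrix.one_mul, Matrix.mul_one]
    _ = _ := by simp only [R, Matrix.mul_assoc]

/-- The endomorphism `P⁻¹ X`, where `X` is the relative logarithm of `Q`. -/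
def matGen (P Q : Matrix ι ι ℂ) : Matrix ι ι ℂ := P⁻¹ * matRelLog P Q

/-- The geodesic `P exp (t P⁻¹ X)` from `P` to `Q`. -/
def matGeod (P Q : Matrix ι ι ℂ) (t : ℝ) : Matrix ι ι ℂ :=
  P * NormedSpace.exp (t • matGen P Q)

/-- The difference quotient of `matGeod` between the times `t` and `s`, in a form that makes sense
(and is smooth) also at `s = t`. -/
def matGeodSlope (P Q : Matrix ι ι ℂ) (t s : ℝ) : Matrix ι ι ℂ :=
  P * (matGen P Q * NormedSpace.exp (t • matGen P Q)) * expSubOneDiv ((s - t) • matGen P Q)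

theorem matGeodSlope_self (P Q : Matrix ι ι ℂ) (t : ℝ) :
    matGeodSlope P Q t t = P * (matGen P Q * NormedSpace.exp (t • matGen P Q)) := by
  rw [matGeodSlope, sub_self, zero_smul, expSubOneDiv_zero, mul_one]

theorem matGeod_sub (P Q : Matrix ι ι ℂ) (t s : ℝ) :
    matGeod P Q s - matGeod P Q t = (s - t) • matGeodSlope P Q t s := by
  set A := matGen P Q
  have h1 : (s - t) • A * expSubOneDiv ((s - t) • A) = NormedSpace.exp ((s - t) • A) - 1 :=
    mul_expSubOneDiv _
  have h2 : NormedSpace.exp (s • A) =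
      NormedSpace.exp (t • A) * NormedSpace.exp ((s - t) • A) := by
    rw [← Matrix.exp_add_of_commute _ _ ((Commute.refl A).smul_left t |>.smul_right (s - t)),
      ← add_smul]
    congr 2
    ring
  have h3 : A * NormedSpace.exp (t • A) = NormedSpace.exp (t • A) * A :=
    (((Commute.refl A).smul_right t).exp_right).eq
  change P * _ - P * _ = (s - t) • (P * (A * _) * _)
  rw [h2, h3, ← mul_sub, ← mul_sub_one, ← h1]
  simp only [mul_assoc, smul_mul_assoc, mul_smul_comm, A]

theorem contDiffAt_matRelLog {P Q : Matrix ι ι ℂ} (hP : P.PosDef) (hQ : Q.PosDef) :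
    ContDiffWithinAt ℝ ∞ (fun p : Matrix ι ι ℂ × Matrix ι ι ℂ ↦ matRelLog p.1 p.2)
      ({P | P.PosDef} ×ˢ {Q | Q.PosDef}) (P, Q) := by
  have hroot : ContDiffWithinAt ℝ ∞ (fun p : Matrix ι ι ℂ × Matrix ι ι ℂ ↦ matRoot p.1)
      ({P | P.PosDef} ×ˢ {Q | Q.PosDef}) (P, Q) := by
    refine contDiff_matrix_exp.contDiffAt.comp_contDiffWithinAt _ ?_
    refine ContDiffWithinAt.const_smul _ ?_
    exact ContDiffWithinAt.comp (g := matLog) (t := {P : Matrix ι ι ℂ | P.PosDef}) (P, Q)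
      (contDiffOn_matLog P hP)
      contDiffWithinAt_fst fun p hp ↦ hp.1
  have hinv : ContDiffWithinAt ℝ ∞ (fun p : Matrix ι ι ℂ × Matrix ι ι ℂ ↦ (matRoot p.1)⁻¹)
      ({P | P.PosDef} ×ˢ {Q | Q.PosDef}) (P, Q) :=
    (contDiffAt_matrix_inv (posDef_matRoot hP).isUnit).comp_contDiffWithinAt (P, Q) hroot
  have hlog : ContDiffWithinAt ℝ ∞ (fun p : Matrix ι ι ℂ × Matrix ι ι ℂ ↦
      matLog ((matRoot p.1)⁻¹ * p.2 * (matRoot p.1)⁻¹))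
      ({P | P.PosDef} ×ˢ {Q | Q.PosDef}) (P, Q) :=
    ContDiffWithinAt.comp (g := matLog) (t := {P : Matrix ι ι ℂ | P.PosDef}) (P, Q)
      (contDiffOn_matLog _ (posDef_root_conj hP hQ))
      ((hinv.mul contDiffWithinAt_snd).mul hinv) fun p hp ↦ posDef_root_conj hp.1 hp.2
  exact (hroot.mul hlog).mul hroot

namespace IsSimDiag

variable {P Q S T : Matrix ι ι ℂ} {ρ : ι → ℝ}

theorem exp_conj (h : IsSimDiag P Q S T ρ) (f : ι → ℝ) :
    NormedSpace.exp (Tᴴ * realDiag f * Sᴴ) = Tᴴ * realDiag (fun i ↦ Real.exp (f i)) * Sᴴ := by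
  have hTS : Tᴴ * Sᴴ = 1 := mul_eq_one_comm.1 h.conj_mul_conj
  have hi : (Tᴴ)⁻¹ = Sᴴ := Matrix.inv_eq_right_inv hTS
  rw [← hi, Matrix.exp_conj _ _ (IsUnit.of_mul_eq_one _ hTS), exp_realDiag]

theorem inv_mul_congr (h : IsSimDiag P Q S T ρ) (f : ι → ℝ) :
    P⁻¹ * (S * realDiag f * Sᴴ) = Tᴴ * realDiag f * Sᴴ := by
  have hTS : T * S = 1 := mul_eq_one_comm.1 h.mul_eq_one
  rw [h.inv_left, Matrix.mul_assoc, ← Matrix.mul_assoc T, ← Matrix.mul_assoc T, hTS,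
    Matrix.one_mul, Matrix.mul_assoc]

theorem isHermitian_congr (f : ι → ℝ) : (S * realDiag f * Sᴴ).IsHermitian := by
  rw [Matrix.IsHermitian, Matrix.conjTranspose_mul, Matrix.conjTranspose_mul,
    realDiag_conjTranspose, Matrix.conjTranspose_conjTranspose, Matrix.mul_assoc]

theorem matRelLog_eq (h : IsSimDiag P Q S T ρ) (hP : P.PosDef) :
    matRelLog P Q = S * realDiag ρ * Sᴴ := by
  refine (eq_matRelLog hP (isHermitian_congr ρ) ?_).symm
  rw [h.inv_mul_congr, h.exp_conj, ← h.inv_mul_congr, ← h.right]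

theorem matGen_eq (h : IsSimDiag P Q S T ρ) (hP : P.PosDef) :
    matGen P Q = Tᴴ * realDiag ρ * Sᴴ := by
  rw [matGen, h.matRelLog_eq hP, h.inv_mul_congr]

theorem exp_smul_matGen (h : IsSimDiag P Q S T ρ) (hP : P.PosDef) (t : ℝ) :
    NormedSpace.exp (t • matGen P Q) = Tᴴ * realDiag (fun i ↦ Real.exp (t * ρ i)) * Sᴴ := by
  have : t • matGen P Q = Tᴴ * realDiag (fun i ↦ t * ρ i) * Sᴴ := by
    have e : realDiag (fun i ↦ t * ρ i) = t • realDiag ρ := by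
      ext i j
      simp only [realDiag, Matrix.smul_apply, Matrix.diagonal_apply]
      split_ifs <;> simp
    rw [h.matGen_eq hP, e, Matrix.mul_smul, Matrix.smul_mul]
  rw [this, h.exp_conj]

theorem mul_conj (h : IsSimDiag P Q S T ρ) (D : Matrix ι ι ℂ) :
    P * (Tᴴ * D * Sᴴ) = S * D * Sᴴ := by
  rw [h.left, Matrix.mul_assoc S, ← Matrix.mul_assoc Sᴴ, ← Matrix.mul_assoc Sᴴ, h.conj_mul_conj,
    Matrix.one_mul, ← Matrix.mul_assoc]

theorem matGeod_eq (h : IsSimDiag P Q S T ρ) (hP : P.PosDef) (t : ℝ) :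
    matGeod P Q t = diagCurve S ρ t := by
  rw [matGeod, h.exp_smul_matGen hP, h.mul_conj, diagCurve]

theorem mul_matGen_mul_exp (h : IsSimDiag P Q S T ρ) (hP : P.PosDef) (t : ℝ) :
    P * (matGen P Q * NormedSpace.exp (t • matGen P Q)) =
      S * realDiag (fun i ↦ ρ i * Real.exp (t * ρ i)) * Sᴴ := by
  rw [h.exp_smul_matGen hP, h.matGen_eq hP, ← realDiag_mul, ← h.mul_conj]
  congr 1
  simp only [Matrix.mul_assoc]
  rw [← Matrix.mul_assoc Sᴴ, h.conj_mul_conj, Matrix.one_mul]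

end IsSimDiag

section

variable {P Q : Matrix ι ι ℂ}

theorem isHermitian_matRelLog (hP : P.PosDef) (hQ : Q.PosDef) : (matRelLog P Q).IsHermitian := by
  obtain ⟨S, T, ρ, h⟩ := exists_isSimDiag hP hQ
  rw [h.matRelLog_eq hP]
  exact IsSimDiag.isHermitian_congr ρ

theorem exp_matGen (hP : P.PosDef) (hQ : Q.PosDef) :
    NormedSpace.exp (matGen P Q) = P⁻¹ * Q := by
  obtain ⟨S, T, ρ, h⟩ := exists_isSimDiag hP hQ
  rw [h.matGen_eq hP, h.exp_conj, ← h.inv_mul_congr, ← h.right]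

theorem posDef_matGeod (hP : P.PosDef) (hQ : Q.PosDef) (t : ℝ) : (matGeod P Q t).PosDef := by
  obtain ⟨S, T, ρ, h⟩ := exists_isSimDiag hP hQ
  rw [h.matGeod_eq hP]
  exact posDef_diagCurve h.mul_eq_one ρ t

theorem matGeod_zero : matGeod P Q 0 = P := by
  simp [matGeod]

theorem matGeod_one (hP : P.PosDef) (hQ : Q.PosDef) : matGeod P Q 1 = Q := by
  rw [matGeod, one_smul, exp_matGen hP hQ, ← Matrix.mul_assoc, hP.mul_inv_self, Matrix.one_mul]

theorem isHermitian_matGeodVelocity (hP : P.PosDef) (hQ : Q.PosDef) (t : ℝ) :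
    (P * (matGen P Q * NormedSpace.exp (t • matGen P Q))).IsHermitian := by
  obtain ⟨S, T, ρ, h⟩ := exists_isSimDiag hP hQ
  rw [h.mul_matGen_mul_exp hP]
  exact IsSimDiag.isHermitian_congr _

theorem inv_matGeod_mul_velocity (hP : P.PosDef) (hQ : Q.PosDef) (t : ℝ) :
    (matGeod P Q t)⁻¹ * (P * (matGen P Q * NormedSpace.exp (t • matGen P Q))) = matGen P Q := by
  have hγ := posDef_matGeod hP hQ t
  have h3 : matGen P Q * NormedSpace.exp (t • matGen P Q) =
      NormedSpace.exp (t • matGen P Q) * matGen P Q :=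
    (((Commute.refl (matGen P Q)).smul_right t).exp_right).eq
  rw [h3, ← Matrix.mul_assoc P]
  change (matGeod P Q t)⁻¹ * (matGeod P Q t * _) = _
  rw [← Matrix.mul_assoc, hγ.inv_mul_self, Matrix.one_mul]

theorem matSqDist_eq_trace (α : ℝ) (hP : P.PosDef) (hQ : Q.PosDef) :
    ((matGen P Q * matGen P Q).trace + (α : ℂ) * (matGen P Q).trace * (matGen P Q).trace).re =
      matSqDist α P Q := by
  obtain ⟨S, T, ρ, h⟩ := exists_isSimDiag hP hQ
  have tr : ∀ f : ι → ℝ, (Tᴴ * realDiag f * Sᴴ).trace = ((∑ i, f i : ℝ) : ℂ) := fun f ↦ by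
    rw [Matrix.trace_mul_comm, ← Matrix.mul_assoc, h.conj_mul_conj, Matrix.one_mul, trace_realDiag]
  have e : Tᴴ * realDiag ρ * Sᴴ * (Tᴴ * realDiag ρ * Sᴴ) =
      Tᴴ * realDiag (fun i ↦ ρ i * ρ i) * Sᴴ := by
    calc _ = Tᴴ * (realDiag ρ * ((Sᴴ * Tᴴ) * realDiag ρ)) * Sᴴ := by simp only [Matrix.mul_assoc]
      _ = _ := by rw [h.conj_mul_conj, Matrix.one_mul, realDiag_mul]
  rw [matSqDist, h.matSq_eq, h.matLogDet_eq, h.matGen_eq hP, e, tr, tr, ← Complex.ofReal_mul,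
    ← Complex.ofReal_mul, ← Complex.ofReal_add, Complex.ofReal_re]
  simp only [← sq]
  ring

theorem matSqDist_cat (α : ℝ) {R : Matrix ι ι ℂ} (hP : P.PosDef) (hQ : Q.PosDef) (hR : R.PosDef)
    {t : ℝ} (ht : t ∈ Icc (0 : ℝ) 1) :
    matSqDist α R (matGeod P Q t) ≤
      (1 - t) * matSqDist α R P + t * matSqDist α R Q - t * (1 - t) * matSqDist α P Q := by
  obtain ⟨S, T, ρ, h⟩ := exists_isSimDiag hP hQ
  rw [h.matGeod_eq hP]
  exact h.matSqDist_cat α hR ht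

end

theorem tendsto_matBound {β : Type*} {l : Filter β} {a : β → ℝ} {p q m : β → Matrix ι ι ℂ} {α : ℝ}
    {P Q M : Matrix ι ι ℂ} (hP : P.PosDef) (hQ : Q.PosDef) (ha : Tendsto a l (𝓝 α))
    (hp : Tendsto p l (𝓝 P)) (hq : Tendsto q l (𝓝 Q)) (hm : Tendsto m l (𝓝 M)) :
    Tendsto (fun x ↦ matBound (a x) (p x) (q x) (m x)) l (𝓝 (matBound α P Q M)) := by
  have htr : Continuous fun A : Matrix ι ι ℂ ↦ A.trace.re :=
    Complex.continuous_re.comp (Continuous.matrix_trace continuous_id)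
  have tr : ∀ {f : β → Matrix ι ι ℂ} {A}, Tendsto f l (𝓝 A) →
      Tendsto (fun x ↦ (f x).trace.re) l (𝓝 A.trace.re) := fun hf ↦ (htr.tendsto _).comp hf
  have h1 := (((contDiffAt_matrix_inv hP.isUnit).continuousAt.tendsto.comp hp)).mul hm
  have h2 := (((contDiffAt_matrix_inv hQ.isUnit).continuousAt.tendsto.comp hq)).mul hm
  have t1 := tr h1
  have t2 := tr h2
  have t3 := tr (h1.mul h2)
  exact (t3.add (ha.mul (t1.pow 2))).add
    (ha.abs.mul ((t2.sub t1).abs.mul ((t1.abs.const_mul 2).add (t2.sub t1).abs)))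

end MatrixGeodesic

/-! ### Hermitian forms and their matrices -/

section FiberGeometry

open scoped ComplexOrder Matrix Matrix.Norms.Operator

variable {V : Type*} [AddCommGroup V] [Module ℂ V] {ι : Type*}

/-- The matrix of a Hermitian form. The indices are ordered so that the matrix of `hInv h v` is
`(formMatrix b h)⁻¹ * formMatrix b v`. -/
def formMatrix (b : Module.Basis ι ℂ V) (v : Herm V) : Matrix ι ι ℂ :=
  Matrix.of fun i j ↦ v.1 (b j) (b i)

theorem isHermitian_formMatrix (b : Module.Basis ι ℂ V) (v : Herm V) :
    (formMatrix b v).IsHermitian := by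
  ext i j
  rw [Matrix.conjTranspose_apply]
  exact (v.2 (b i) (b j)).symm

theorem formMatrix_add (b : Module.Basis ι ℂ V) (v w : Herm V) :
    formMatrix b (v + w) = formMatrix b v + formMatrix b w := rfl

theorem formMatrix_sub (b : Module.Basis ι ℂ V) (v w : Herm V) :
    formMatrix b (v - w) = formMatrix b v - formMatrix b w := rfl

theorem formMatrix_smul (b : Module.Basis ι ℂ V) (c : ℝ) (v : Herm V) :
    formMatrix b (c • v) = c • formMatrix b v := rfl

theorem tendsto_formMatrix_iff {β : Type*} {l : Filter β} [Fintype ι] (b : Module.Basis ι ℂ V)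
    {f : β → Herm V} {v : Herm V} :
    Tendsto (fun x ↦ formMatrix b (f x)) l (𝓝 (formMatrix b v)) ↔ Tendsto f l (𝓝 v) := by
  rw [nhds_induced, tendsto_comap_iff, tendsto_pi_nhds]
  constructor
  · intro h p
    have e : ∀ w : Herm V, w.1 p.1 p.2 =
        ∑ i, ∑ j, b.repr p.1 j * (starRingEnd ℂ (b.repr p.2 i) * formMatrix b w i j) := fun w ↦ by
      conv_lhs => rw [← b.sum_repr p.1, ← b.sum_repr p.2]
      simp only [map_sum, LinearMap.sum_apply, map_smul, LinearMap.smul_apply,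
        LinearMap.map_smulₛₗ, smul_eq_mul, formMatrix, Matrix.of_apply, Finset.mul_sum]
      exact Finset.sum_congr rfl fun i _ ↦ Finset.sum_congr rfl fun j _ ↦ by ring
    have h' := fun i j ↦ (tendsto_pi_nhds.1 ((tendsto_pi_nhds.1 h) i)) j
    simp only [Function.comp_apply, e]
    exact tendsto_finsetSum _ fun i _ ↦ tendsto_finsetSum _ fun j _ ↦
      ((h' i j).const_mul _).const_mul _
  · intro h
    exact tendsto_pi_nhds.2 fun i ↦ tendsto_pi_nhds.2 fun j ↦ h (b j, b i)

variable [Fintype ι]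

theorem form_apply (b : Module.Basis ι ℂ V) (v : Herm V) (a c : V) :
    v.1 a c = star (⇑(b.repr c)) ⬝ᵥ (formMatrix b v).mulVec (b.repr a) := by
  conv_lhs => rw [← b.sum_repr a, ← b.sum_repr c]
  simp only [map_sum, LinearMap.sum_apply, map_smul, LinearMap.smul_apply,
    LinearMap.map_smulₛₗ, smul_eq_mul, dotProduct, Matrix.mulVec, formMatrix, Matrix.of_apply,
    Finset.mul_sum, Pi.star_apply]
  refine Finset.sum_congr rfl fun i _ ↦ Finset.sum_congr rfl fun j _ ↦ ?_
  rw [RCLike.star_def]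
  ring

theorem formMatrix_injective (b : Module.Basis ι ℂ V) :
    Function.Injective (formMatrix b) := by
  intro v w h
  refine Subtype.ext (LinearMap.ext fun a ↦ LinearMap.ext fun c ↦ ?_)
  rw [form_apply b, form_apply b, h]

theorem posDef_formMatrix_iff (b : Module.Basis ι ℂ V) {h : Herm V} :
    (formMatrix b h).PosDef ↔ h ∈ HermPos V := by
  constructor
  · intro hp a ha
    have hne : (⇑(b.repr a) : ι → ℂ) ≠ 0 := fun h0 ↦ ha <| by
      rw [← b.repr.map_eq_zero_iff]
      exact DFunLike.coe_injective h0
    have := hp.dotProduct_mulVec_pos hne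
    rw [← form_apply b] at this
    exact (Complex.lt_def.1 this).1
  · intro hh
    refine Matrix.PosDef.of_dotProduct_mulVec_pos (isHermitian_formMatrix b h) fun x hx ↦ ?_
    set a := b.equivFun.symm x
    have hr : (⇑(b.repr a) : ι → ℂ) = x := by
      rw [← b.equivFun_apply]
      exact b.equivFun.apply_symm_apply x
    have ha : a ≠ 0 := fun h0 ↦ hx (by rw [← hr, h0]; simp)
    rw [← hr, ← form_apply b, Complex.lt_def]
    refine ⟨hh a ha, ?_⟩
    have := congrArg Complex.im (h.2 a a)
    rw [Complex.conj_im] at this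
    simp only [Complex.zero_im]
    linarith

/-- The Hermitian form with a given Hermitian matrix. -/
def formOfMatrix (b : Module.Basis ι ℂ V) (A : Matrix ι ι ℂ)
    (hA : A.IsHermitian) : Herm V :=
  ⟨LinearMap.mk₂'ₛₗ (RingHom.id ℂ) (starRingEnd ℂ)
    (fun a c ↦ star (⇑(b.repr c)) ⬝ᵥ A.mulVec (b.repr a))
    (by intro a a' c; simp [Matrix.mulVec_add, dotProduct_add])
    (by intro t a c; simp [Matrix.mulVec_smul, dotProduct_smul])
    (by intro a c c'; simp [add_dotProduct])
    (by intro t a c; simp [star_smul, smul_dotProduct]), by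
    intro a c
    change star (⇑(b.repr a)) ⬝ᵥ A.mulVec (b.repr c) =
      star (star (⇑(b.repr c)) ⬝ᵥ A.mulVec (b.repr a))
    rw [Matrix.star_dotProduct, Matrix.star_mulVec, hA.eq, Matrix.dotProduct_mulVec]⟩

theorem formMatrix_formOfMatrix [DecidableEq ι] (b : Module.Basis ι ℂ V) (A : Matrix ι ι ℂ)
    (hA : A.IsHermitian) : formMatrix b (formOfMatrix b A hA) = A := by
  ext i j
  change star (⇑(b.repr (b i))) ⬝ᵥ A.mulVec (b.repr (b j)) = A i j
  have e : ∀ k, (⇑(b.repr (b k)) : ι → ℂ) = Pi.single k 1 := fun k ↦ by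
    rw [b.repr_self, Finsupp.single_eq_pi_single]
  have e2 : star (Pi.single i (1 : ℂ) : ι → ℂ) = Pi.single i 1 := by
    rw [← Pi.single_star, star_one]
  rw [e, e, e2, Matrix.mulVec_single_one, single_one_dotProduct]
  rfl

variable [DecidableEq ι] [FiniteDimensional ℂ V]

theorem toMatrix_hInv (b : Module.Basis ι ℂ V) {h : Herm V} (hh : h ∈ HermPos V) (v : Herm V) :
    LinearMap.toMatrix b b (hInv h v) = (formMatrix b h)⁻¹ * formMatrix b v := by
  have hp := (posDef_formMatrix_iff b).2 hh
  set B := Matrix.toLin b b ((formMatrix b h)⁻¹ * formMatrix b v)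
  have hB : ∀ a c, v.1 a c = h.1 a (B c) := fun a c ↦ by
    have hr : (⇑(b.repr (B c)) : ι → ℂ) =
        ((formMatrix b h)⁻¹ * formMatrix b v).mulVec (b.repr c) :=
      Matrix.repr_toLin b b _ _
    rw [form_apply b, form_apply b, hr, Matrix.star_mulVec, Matrix.conjTranspose_mul,
      Matrix.conjTranspose_nonsing_inv, (isHermitian_formMatrix b v).eq,
      (isHermitian_formMatrix b h).eq, ← Matrix.dotProduct_mulVec, Matrix.mulVec_mulVec,
      Matrix.mul_assoc, hp.inv_mul_self, Matrix.mul_one]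
  have : hInv h v = B := (HermPos.existsUnique_endo hh v.1).unique (hInv_spec hh v) hB
  rw [this, LinearMap.toMatrix_toLin]

theorem toMatrix_endExp (b : Module.Basis ι ℂ V) (A : Module.End ℂ V) :
    LinearMap.toMatrix b b (endExp A) = NormedSpace.exp (LinearMap.toMatrix b b A) := by
  -- the two bases may be indexed by different types
  set f := Module.finBasis ℂ V
  let e : ι ≃ Fin (Module.finrank ℂ V) := b.indexEquiv f
  let b' := b.reindex e
  have hre : ∀ C : Module.End ℂ V,
      LinearMap.toMatrix b b C = Matrix.reindexAlgEquiv ℂ ℂ e.symm (LinearMap.toMatrix b' b' C) :=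
    fun C ↦ by
    ext i j
    simp [LinearMap.toMatrix_apply, b']
  have hexp : ∀ C : Matrix (Fin (Module.finrank ℂ V)) (Fin (Module.finrank ℂ V)) ℂ,
      Matrix.reindexAlgEquiv ℂ ℂ e.symm (NormedSpace.exp C) =
        NormedSpace.exp (Matrix.reindexAlgEquiv ℂ ℂ e.symm C) := fun C ↦
    NormedSpace.map_exp (𝔸 := Matrix (Fin (Module.finrank ℂ V)) (Fin (Module.finrank ℂ V)) ℂ)
      (𝔹 := Matrix ι ι ℂ) (Matrix.reindexAlgEquiv ℂ ℂ e.symm) (by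
        change Continuous fun C : Matrix _ _ ℂ ↦ Matrix.reindex e.symm e.symm C
        fun_prop) C
  rw [hre, hre A, ← hexp]
  congr 1
  have hfb := basis_toMatrix_mul_linearMap_toMatrix_mul_basis_toMatrix b' f b' f
  rw [← hfb (endExp A), ← hfb A]
  have h1 : f.toMatrix b' * b'.toMatrix f = 1 := Module.Basis.toMatrix_mul_toMatrix_flip f b'
  have h2 : b'.toMatrix f * f.toMatrix b' = 1 := Module.Basis.toMatrix_mul_toMatrix_flip b' f
  have hi : (b'.toMatrix f)⁻¹ = f.toMatrix b' := Matrix.inv_eq_right_inv h2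
  rw [endExp, LinearMap.toMatrix_toLin, ← hi, Matrix.exp_conj _ _ (IsUnit.of_mul_eq_one _ h2)]

end FiberGeometry

/-! ### The geometry of the positive definite Hermitian forms on a vector space -/

section FiberDistance

open scoped ComplexOrder Matrix Matrix.Norms.Operator

variable {V : Type*} [AddCommGroup V] [Module ℂ V] [FiniteDimensional ℂ V]

/-- The Hermitian form `v` with `exp (h⁻¹ v) = h⁻¹ k`, for positive definite `h` and `k`. -/
def fiberLog (h k : Herm V) : Herm V :=
  Classical.epsilon fun v ↦ endExp (hInv h v) = hInv h k

/-- The geodesic `h exp (t h⁻¹ v)` from `h` to `k`, where `v = fiberLog h k`. -/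
def fiberGeod (h k : Herm V) (t : ℝ) : Herm V :=
  Classical.epsilon fun u ↦ hInv h u = endExp ((t : ℂ) • hInv h (fiberLog h k))

/-- The velocity `v exp (t h⁻¹ v)` of the geodesic from `h` to `k`, where `v = fiberLog h k`. -/
def fiberGeodVelocity (h k : Herm V) (t : ℝ) : Herm V :=
  Classical.epsilon fun u ↦
    hInv h u = hInv h (fiberLog h k) * endExp ((t : ℂ) • hInv h (fiberLog h k))

/-- The squared Riemannian distance on the positive definite Hermitian forms: the sum of the squared
logarithms of the eigenvalues of `h⁻¹ k`, plus `α` times the squared logarithm of `det (h⁻¹ k)`. -/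
def fiberSqDist (α : ℝ) (h k : Herm V) : ℝ :=
  sqLogRoots (hInv h k).charpoly + α * Real.log ‖LinearMap.det (hInv h k)‖ ^ 2

/-- The bound `matBound` for the squared distance of `h` and `k = h + ε m`, divided by `ε²`. -/
def fiberBound (α : ℝ) (h k m : Herm V) : ℝ :=
  matBound α (formMatrix (Module.finBasis ℂ V) h) (formMatrix (Module.finBasis ℂ V) k)
    (formMatrix (Module.finBasis ℂ V) m)

variable {ι : Type*} [Fintype ι] [DecidableEq ι] (b : Module.Basis ι ℂ V) {h k : Herm V}

theorem fiberSqDist_eq (α : ℝ) (hh : h ∈ HermPos V) (k : Herm V) :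
    fiberSqDist α h k = matSqDist α (formMatrix b h) (formMatrix b k) := by
  rw [fiberSqDist, matSqDist, matSq, matLogDet, ← toMatrix_hInv b hh, LinearMap.charpoly_toMatrix,
    LinearMap.det_toMatrix]

theorem trace_hInv (hh : h ∈ HermPos V) (v : Herm V) :
    LinearMap.trace ℂ V (hInv h v) = ((formMatrix b h)⁻¹ * formMatrix b v).trace := by
  rw [← toMatrix_hInv b hh, LinearMap.trace_eq_matrix_trace ℂ b]

theorem trace_hInv_mul (hh : h ∈ HermPos V) (hk : k ∈ HermPos V) (v w : Herm V) :
    LinearMap.trace ℂ V (hInv h v * hInv k w) =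
      ((formMatrix b h)⁻¹ * formMatrix b v * ((formMatrix b k)⁻¹ * formMatrix b w)).trace := by
  rw [← toMatrix_hInv b hh, ← toMatrix_hInv b hk, LinearMap.trace_eq_matrix_trace ℂ b,
    LinearMap.toMatrix_mul]

theorem fiberBound_eq (α : ℝ) (hh : h ∈ HermPos V) (hk : k ∈ HermPos V) (m : Herm V) :
    fiberBound α h k m = matBound α (formMatrix b h) (formMatrix b k) (formMatrix b m) := by
  simp only [fiberBound, matBound, ← trace_hInv _ hh, ← trace_hInv _ hk, ← trace_hInv_mul _ hh hk]

theorem fiberInner_self_eq (α : ℝ) (hh : h ∈ HermPos V) (v : Herm V) :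
    fiberInner α h v v = fiberBound α h h v := by
  set b := Module.finBasis ℂ V
  have him : (starRingEnd ℂ) ((formMatrix b h)⁻¹ * formMatrix b v).trace =
      ((formMatrix b h)⁻¹ * formMatrix b v).trace := by
    rw [← Complex.star_def, ← Matrix.trace_conjTranspose, Matrix.conjTranspose_mul,
      Matrix.conjTranspose_nonsing_inv, isHermitian_formMatrix b h, isHermitian_formMatrix b v,
      Matrix.trace_mul_comm]
  have hre := Complex.conj_eq_iff_re.1 him
  rw [fiberBound, matBound, fiberInner, trace_hInv b hh, trace_hInv_mul b hh hh]
  set z := ((formMatrix b h)⁻¹ * formMatrix b v).trace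
  rw [Complex.add_re, ← hre]
  simp only [Complex.ofReal_re, sub_self, abs_zero, zero_mul, mul_zero, add_zero,
    ← Complex.ofReal_mul]
  ring

theorem endExp_fiberLog (hh : h ∈ HermPos V) (hk : k ∈ HermPos V) :
    endExp (hInv h (fiberLog h k)) = hInv h k := by
  set b := Module.finBasis ℂ V
  have hp := (posDef_formMatrix_iff b).2 hh
  have hq := (posDef_formMatrix_iff b).2 hk
  refine Classical.epsilon_spec (p := fun v ↦ endExp (hInv h v) = hInv h k)
    ⟨formOfMatrix b _ (isHermitian_matRelLog hp hq), (LinearMap.toMatrix b b).injective ?_⟩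
  rw [toMatrix_endExp, toMatrix_hInv b hh, toMatrix_hInv b hh, formMatrix_formOfMatrix]
  exact exp_matGen hp hq

theorem formMatrix_of_endExp_eq (hh : h ∈ HermPos V) {v : Herm V}
    (e : endExp (hInv h v) = hInv h k) :
    formMatrix b v = matRelLog (formMatrix b h) (formMatrix b k) := by
  refine eq_matRelLog ((posDef_formMatrix_iff b).2 hh) (isHermitian_formMatrix b v) ?_
  rw [← toMatrix_hInv b hh, ← toMatrix_hInv b hh, ← toMatrix_endExp, e]

theorem formMatrix_fiberLog (hh : h ∈ HermPos V) (hk : k ∈ HermPos V) :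
    formMatrix b (fiberLog h k) = matRelLog (formMatrix b h) (formMatrix b k) :=
  formMatrix_of_endExp_eq b hh (endExp_fiberLog hh hk)

theorem endExp_hInv_eq_iff (hh : h ∈ HermPos V) (hk : k ∈ HermPos V) (u : Herm V) :
    endExp (hInv h u) = hInv h k ↔ u = fiberLog h k := by
  set b := Module.finBasis ℂ V
  refine ⟨fun e ↦ formMatrix_injective b ?_, fun e ↦ e ▸ endExp_fiberLog hh hk⟩
  rw [formMatrix_of_endExp_eq b hh e, formMatrix_fiberLog b hh hk]

theorem toMatrix_hInv_fiberLog (hh : h ∈ HermPos V) (hk : k ∈ HermPos V) :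
    LinearMap.toMatrix b b (hInv h (fiberLog h k)) =
      matGen (formMatrix b h) (formMatrix b k) := by
  rw [toMatrix_hInv b hh, formMatrix_fiberLog b hh hk, matGen]

theorem toMatrix_endExp_smul (hh : h ∈ HermPos V) (hk : k ∈ HermPos V) (t : ℝ) :
    LinearMap.toMatrix b b (endExp ((t : ℂ) • hInv h (fiberLog h k))) =
      NormedSpace.exp (t • matGen (formMatrix b h) (formMatrix b k)) := by
  rw [toMatrix_endExp, map_smul, toMatrix_hInv_fiberLog b hh hk]
  congr 1

theorem hInv_fiberGeod (hh : h ∈ HermPos V) (hk : k ∈ HermPos V) (t : ℝ) :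
    hInv h (fiberGeod h k t) = endExp ((t : ℂ) • hInv h (fiberLog h k)) := by
  set b := Module.finBasis ℂ V
  have hp := (posDef_formMatrix_iff b).2 hh
  have hq := (posDef_formMatrix_iff b).2 hk
  refine Classical.epsilon_spec
    (p := fun u ↦ hInv h u = endExp ((t : ℂ) • hInv h (fiberLog h k)))
    ⟨formOfMatrix b _ (posDef_matGeod hp hq t).1, (LinearMap.toMatrix b b).injective ?_⟩
  rw [toMatrix_hInv b hh, formMatrix_formOfMatrix, toMatrix_endExp_smul b hh hk, matGeod,
    ← Matrix.mul_assoc, hp.inv_mul_self, Matrix.one_mul]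

theorem hInv_fiberGeodVelocity (hh : h ∈ HermPos V) (hk : k ∈ HermPos V) (t : ℝ) :
    hInv h (fiberGeodVelocity h k t) =
      hInv h (fiberLog h k) * endExp ((t : ℂ) • hInv h (fiberLog h k)) := by
  set b := Module.finBasis ℂ V
  have hp := (posDef_formMatrix_iff b).2 hh
  have hq := (posDef_formMatrix_iff b).2 hk
  refine Classical.epsilon_spec
    (p := fun u ↦
      hInv h u = hInv h (fiberLog h k) * endExp ((t : ℂ) • hInv h (fiberLog h k)))
    ⟨formOfMatrix b _ (isHermitian_matGeodVelocity hp hq t),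
      (LinearMap.toMatrix b b).injective ?_⟩
  rw [toMatrix_hInv b hh, formMatrix_formOfMatrix, LinearMap.toMatrix_mul,
    toMatrix_endExp_smul b hh hk, toMatrix_hInv_fiberLog b hh hk, ← Matrix.mul_assoc,
    hp.inv_mul_self, Matrix.one_mul]

theorem formMatrix_fiberGeod (hh : h ∈ HermPos V) (hk : k ∈ HermPos V) (t : ℝ) :
    formMatrix b (fiberGeod h k t) = matGeod (formMatrix b h) (formMatrix b k) t := by
  have hp := (posDef_formMatrix_iff b).2 hh
  rw [matGeod, ← toMatrix_endExp_smul b hh hk, ← hInv_fiberGeod hh hk, toMatrix_hInv b hh,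
    ← Matrix.mul_assoc, hp.mul_inv_self, Matrix.one_mul]

theorem formMatrix_fiberGeodVelocity (hh : h ∈ HermPos V) (hk : k ∈ HermPos V) (t : ℝ) :
    formMatrix b (fiberGeodVelocity h k t) =
      matGeodSlope (formMatrix b h) (formMatrix b k) t t := by
  have hp := (posDef_formMatrix_iff b).2 hh
  rw [matGeodSlope_self, ← toMatrix_endExp_smul b hh hk, ← toMatrix_hInv_fiberLog b hh hk,
    ← LinearMap.toMatrix_mul, ← hInv_fiberGeodVelocity hh hk, toMatrix_hInv b hh,
    ← Matrix.mul_assoc, hp.mul_inv_self, Matrix.one_mul]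

theorem formMatrix_slope_fiberGeod (hh : h ∈ HermPos V) (hk : k ∈ HermPos V)
    {s t : ℝ} (hst : s ≠ t) :
    formMatrix b (slope (fiberGeod h k) t s) =
      matGeodSlope (formMatrix b h) (formMatrix b k) t s := by
  rw [slope_def_module, formMatrix_smul, formMatrix_sub, formMatrix_fiberGeod b hh hk,
    formMatrix_fiberGeod b hh hk, matGeod_sub, smul_smul, inv_mul_cancel₀ (sub_ne_zero.2 hst),
    one_smul]

theorem fiberGeod_mem (hh : h ∈ HermPos V) (hk : k ∈ HermPos V)
    (t : ℝ) : fiberGeod h k t ∈ HermPos V := by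
  set b := Module.finBasis ℂ V
  rw [← posDef_formMatrix_iff b, formMatrix_fiberGeod b hh hk]
  exact posDef_matGeod ((posDef_formMatrix_iff b).2 hh) ((posDef_formMatrix_iff b).2 hk) t

theorem fiberGeod_zero (hh : h ∈ HermPos V) (hk : k ∈ HermPos V) : fiberGeod h k 0 = h := by
  refine formMatrix_injective (Module.finBasis ℂ V) ?_
  rw [formMatrix_fiberGeod _ hh hk, matGeod_zero]

theorem fiberGeod_one (hh : h ∈ HermPos V) (hk : k ∈ HermPos V) : fiberGeod h k 1 = k := by
  refine formMatrix_injective (Module.finBasis ℂ V) ?_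
  rw [formMatrix_fiberGeod _ hh hk, matGeod_one ((posDef_formMatrix_iff _).2 hh)
    ((posDef_formMatrix_iff _).2 hk)]

theorem hInv_fiberGeod_velocity (hh : h ∈ HermPos V) (hk : k ∈ HermPos V) (t : ℝ) :
    hInv (fiberGeod h k t) (fiberGeodVelocity h k t) = hInv h (fiberLog h k) := by
  set b := Module.finBasis ℂ V
  refine (LinearMap.toMatrix b b).injective ?_
  rw [toMatrix_hInv b (fiberGeod_mem hh hk t), toMatrix_hInv_fiberLog b hh hk,
    formMatrix_fiberGeod b hh hk, formMatrix_fiberGeodVelocity b hh hk, matGeodSlope_self,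
    inv_matGeod_mul_velocity ((posDef_formMatrix_iff _).2 hh) ((posDef_formMatrix_iff _).2 hk)]

theorem fiberInner_fiberGeodVelocity (hh : h ∈ HermPos V) (hk : k ∈ HermPos V) (α t : ℝ) :
    fiberInner α (fiberGeod h k t) (fiberGeodVelocity h k t) (fiberGeodVelocity h k t) =
      fiberSqDist α h k := by
  set b := Module.finBasis ℂ V
  rw [fiberInner, hInv_fiberGeod_velocity hh hk, LinearMap.trace_eq_matrix_trace ℂ b,
    LinearMap.trace_eq_matrix_trace ℂ b, LinearMap.toMatrix_mul, toMatrix_hInv_fiberLog b hh hk,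
    fiberSqDist_eq b α hh]
  exact matSqDist_eq_trace α ((posDef_formMatrix_iff _).2 hh) ((posDef_formMatrix_iff _).2 hk)

theorem fiberSqDist_comm (hh : h ∈ HermPos V) (hk : k ∈ HermPos V)
    (α : ℝ) : fiberSqDist α h k = fiberSqDist α k h := by
  set b := Module.finBasis ℂ V
  rw [fiberSqDist_eq b α hh, fiberSqDist_eq b α hk]
  exact matSqDist_comm α ((posDef_formMatrix_iff _).2 hh) ((posDef_formMatrix_iff _).2 hk)

theorem fiberSqDist_cat (hh : h ∈ HermPos V) (hk : k ∈ HermPos V)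
    (α : ℝ) {r : Herm V} (hr : r ∈ HermPos V) {t : ℝ}
    (ht : t ∈ Icc (0 : ℝ) 1) :
    fiberSqDist α r (fiberGeod h k t) ≤
      (1 - t) * fiberSqDist α r h + t * fiberSqDist α r k - t * (1 - t) * fiberSqDist α h k := by
  set b := Module.finBasis ℂ V
  simp only [fiberSqDist_eq b α hr, fiberSqDist_eq b α hh, formMatrix_fiberGeod b hh hk]
  exact matSqDist_cat α ((posDef_formMatrix_iff _).2 hh) ((posDef_formMatrix_iff _).2 hk)
    ((posDef_formMatrix_iff _).2 hr) ht

theorem fiberSqDist_nonneg (hh : h ∈ HermPos V) (hk : k ∈ HermPos V)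
    {α : ℝ} (hα : -(1 / (Module.finrank ℂ V : ℝ)) < α) :
    0 ≤ fiberSqDist α h k := by
  rw [fiberSqDist_eq (Module.finBasis ℂ V) α hh]
  exact matSqDist_nonneg (by simpa using hα) ((posDef_formMatrix_iff _).2 hh)
    ((posDef_formMatrix_iff _).2 hk)

theorem eq_of_fiberSqDist_eq_zero (hh : h ∈ HermPos V) (hk : k ∈ HermPos V)
    {α : ℝ} (hα : -(1 / (Module.finrank ℂ V : ℝ)) < α)
    (h0 : fiberSqDist α h k = 0) : h = k := by
  rw [fiberSqDist_eq (Module.finBasis ℂ V) α hh] at h0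
  exact formMatrix_injective _ (eq_of_matSqDist_eq_zero (by simpa using hα)
    ((posDef_formMatrix_iff _).2 hh) ((posDef_formMatrix_iff _).2 hk) h0)

theorem fiberSqDist_le_fiberBound (hh : h ∈ HermPos V) (hk : k ∈ HermPos V)
    (α : ℝ) {m : Herm V} {ε : ℝ} (hm : k = h + ε • m) :
    fiberSqDist α h k ≤ ε ^ 2 * fiberBound α h k m := by
  set b := Module.finBasis ℂ V
  rw [fiberSqDist_eq b α hh]
  refine matSqDist_le_matBound α ((posDef_formMatrix_iff _).2 hh)
    ((posDef_formMatrix_iff _).2 hk) ?_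
  conv_lhs => rw [hm]
  rw [formMatrix_add, formMatrix_smul]
  congr 1

theorem fiberSqDist_self (α : ℝ) (hh : h ∈ HermPos V) : fiberSqDist α h h = 0 := by
  rw [fiberSqDist_eq (Module.finBasis ℂ V) α hh]
  exact matSqDist_self α ((posDef_formMatrix_iff _).2 hh)

/-- The order of magnitude of `q` along a curve: from convergence of the bounds to an estimate
of the difference quotients. -/
theorem eventually_sqrt_le_of_tendsto {f B : ℝ → ℝ} {l : Filter ℝ} {t r B₀ : ℝ}
    (hB : Tendsto B l (𝓝 B₀)) (hf : ∀ᶠ s in l, f s ≤ (s - t) ^ 2 * B s) (hr : √B₀ < r) :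
    ∀ᶠ s in l, √(f s) ≤ r * |s - t| := by
  have hr0 : 0 < r := (Real.sqrt_nonneg _).trans_lt hr
  filter_upwards [hf, hB.eventually_lt_const ((Real.sqrt_lt' hr0).1 hr)] with s h1 h2
  rw [Real.sqrt_le_left (by positivity), mul_pow, sq_abs]
  nlinarith [sq_nonneg (s - t)]

theorem IsC1CurveOn.eq_add_smul_slope {X : Type*} [AddCommGroup X] [Module ℝ X] (c : ℝ → X)
    (t s : ℝ) : c s = c t + (s - t) • slope c t s := by
  have := sub_smul_slope c t s
  rw [this, vsub_eq_sub, add_sub_cancel]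

/-- A differentiable curve in a space of forms is continuous. -/
theorem tendsto_of_tendsto_slope {c : ℝ → Herm V} {w : Herm V} {t : ℝ} {s : Set ℝ}
    (h : Tendsto (slope c t) (𝓝[s \ {t}] t) (𝓝 w)) : Tendsto c (𝓝[s \ {t}] t) (𝓝 (c t)) := by
  set b := Module.finBasis ℂ V
  rw [← tendsto_formMatrix_iff b] at h ⊢
  have h0 : Tendsto (fun s ↦ s - t) (𝓝[s \ {t}] t) (𝓝 0) := by
    have : Tendsto (fun s ↦ s - t) (𝓝 t) (𝓝 (t - t)) :=
      (continuous_id.sub continuous_const).tendsto t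
    rw [sub_self] at this
    exact this.mono_left nhdsWithin_le_nhds
  have := (tendsto_const_nhds (x := formMatrix b (c t))).add (h0.smul h)
  simp only [zero_smul, add_zero] at this
  refine this.congr fun s ↦ ?_
  rw [← formMatrix_smul, ← formMatrix_add, ← IsC1CurveOn.eq_add_smul_slope]

theorem tendsto_fiberBound {β : Type*} {l : Filter β} {α : ℝ} {p q m : β → Herm V} {P Q M : Herm V}
    (hP : P ∈ HermPos V) (hQ : Q ∈ HermPos V) (hp : Tendsto p l (𝓝 P)) (hq : Tendsto q l (𝓝 Q))
    (hm : Tendsto m l (𝓝 M)) :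
    Tendsto (fun x ↦ fiberBound α (p x) (q x) (m x)) l (𝓝 (fiberBound α P Q M)) :=
  tendsto_matBound ((posDef_formMatrix_iff _).2 hP) ((posDef_formMatrix_iff _).2 hQ)
    tendsto_const_nhds ((tendsto_formMatrix_iff _).2 hp) ((tendsto_formMatrix_iff _).2 hq)
    ((tendsto_formMatrix_iff _).2 hm)

theorem contDiff_matGeodSlope (P Q : Matrix ι ι ℂ) (t : ℝ) :
    ContDiff ℝ ∞ (matGeodSlope P Q t) := by
  unfold matGeodSlope
  refine contDiff_const.mul (contDiff_expSubOneDiv.comp ?_)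
  exact (contDiff_id.sub contDiff_const).smul contDiff_const

theorem continuous_matGeodSlope_diag (P Q : Matrix ι ι ℂ) :
    Continuous fun t ↦ matGeodSlope P Q t t := by
  simp only [matGeodSlope_self]
  refine continuous_const.mul (continuous_const.mul ?_)
  exact contDiff_matrix_exp.continuous.comp (continuous_id.smul continuous_const)

/-- On each fiber, `fiberSqDist` is the square of the path-length distance. -/
theorem fiber_isCATZeroSqDist {α : ℝ} (hα : -(1 / (Module.finrank ℂ V : ℝ)) < α) :
    IsCATZeroSqDist (HermPos V) (fiberNorm α) (fiberSqDist α) fiberGeod fiberGeodVelocity where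
  nonneg p hp p' hp' := fiberSqDist_nonneg hp hp' hα
  symm p hp p' hp' := fiberSqDist_comm hp hp' α
  self p hp := fiberSqDist_self α hp
  eq_of_eq_zero p hp p' hp' := eq_of_fiberSqDist_eq_zero hp hp' hα
  source p hp p' hp' := fiberGeod_zero hp hp'
  target p hp p' hp' := fiberGeod_one hp hp'
  mem p hp p' hp' t _ := fiberGeod_mem hp hp' t
  isC1 p hp p' hp' := by
    set b := Module.finBasis ℂ V
    refine ⟨Continuous.continuousOn ?_, fun t _ ↦ ?_⟩
    · refine continuous_iff_continuousAt.2 fun t ↦ (tendsto_formMatrix_iff b).1 ?_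
      simp only [formMatrix_fiberGeodVelocity b hp hp']
      exact (continuous_matGeodSlope_diag _ _).tendsto t
    · rw [← tendsto_formMatrix_iff b, formMatrix_fiberGeodVelocity b hp hp']
      refine Tendsto.congr' ?_ (((contDiff_matGeodSlope _ _ t).continuous.tendsto t).mono_left
        nhdsWithin_le_nhds)
      filter_upwards [self_mem_nhdsWithin] with s hs
      exact (formMatrix_slope_fiberGeod b hp hp' hs.2).symm
  speed p hp p' hp' t _ := by rw [fiberNorm, fiberInner_fiberGeodVelocity hp hp']
  cat p hp p' hp' r hr t ht := fiberSqDist_cat hp hp' α hr ht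
  nrm_nonneg p v := Real.sqrt_nonneg _
  nrm_continuousOn c w a b hc hS := by
    intro t ht
    have hct : ContinuousWithinAt c (Icc a b) t := by
      rw [← continuousWithinAt_sdiff_self]
      exact tendsto_of_tendsto_slope (hc.2 t ht)
    have : ContinuousWithinAt (fun s ↦ √(fiberBound α (c s) (c s) (w s))) (Icc a b) t :=
      (tendsto_fiberBound (hS t ht) (hS t ht) hct hct (hc.1 t ht)).sqrt
    refine this.congr (fun s hs ↦ ?_) ?_
    · rw [fiberNorm, fiberInner_self_eq α (hS s hs)]
    · rw [fiberNorm, fiberInner_self_eq α (hS t ht)]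
  sqrt_le c w a b hc hS t ht r hr := by
    rw [fiberNorm, fiberInner_self_eq α (hS t ht)] at hr
    refine eventually_sqrt_le_of_tendsto (tendsto_fiberBound (hS t ht) (hS t ht)
      tendsto_const_nhds (tendsto_of_tendsto_slope (hc.2 t ht)) (hc.2 t ht)) ?_ hr
    filter_upwards [self_mem_nhdsWithin] with s hs
    exact fiberSqDist_le_fiberBound (hS t ht) (hS s hs.1) α (IsC1CurveOn.eq_add_smul_slope c t s)

theorem fiberDist_eq {α : ℝ} (hα : -(1 / (Module.finrank ℂ V : ℝ)) < α) (hh : h ∈ HermPos V)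
    (hk : k ∈ HermPos V) : fiberDist α h k = √(fiberSqDist α h k) :=
  (fiber_isCATZeroSqDist hα).pathDist_eq hh hk

theorem fiberDist_sq {α : ℝ} (hα : -(1 / (Module.finrank ℂ V : ℝ)) < α) (hh : h ∈ HermPos V)
    (hk : k ∈ HermPos V) : fiberDist α h k ^ 2 = fiberSqDist α h k := by
  rw [fiberDist_eq hα hh hk, Real.sq_sqrt (fiberSqDist_nonneg hh hk hα)]

theorem fiberDist_fiberGeod {α : ℝ} (hα : -(1 / (Module.finrank ℂ V : ℝ)) < α)
    (hh : h ∈ HermPos V) (hk : k ∈ HermPos V) {s t : ℝ} (hs : s ∈ Icc (0 : ℝ) 1)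
    (ht : t ∈ Icc (0 : ℝ) 1) :
    fiberDist α (fiberGeod h k s) (fiberGeod h k t) = |s - t| * fiberDist α h k := by
  rw [fiberDist_eq hα (fiberGeod_mem hh hk s) (fiberGeod_mem hh hk t), fiberDist_eq hα hh hk]
  exact (fiber_isCATZeroSqDist hα).sqrt_geodesic hh hk hs ht

end FiberDistance

/-! ### The Riemannian volume of a closed manifold -/

section RiemannianVolume

variable {n : ℕ} {M : Type*} [TopologicalSpace M] [ChartedSpace (EuclideanSpace ℝ (Fin n)) M]
  [IsManifold (𝓡 n) ∞ M]
  (g : ContMDiffRiemannianMetric (𝓡 n) ∞ (EuclideanSpace ℝ (Fin n))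
    (fun x : M ↦ TangentSpace (𝓡 n) x))

theorem dotProduct_gram_mulVec {W T : Type*} [AddCommGroup W] [Module ℝ W] [TopologicalSpace W]
    [AddCommGroup T] [Module ℝ T] [TopologicalSpace T] (G : T →L[ℝ] T →L[ℝ] ℝ) (A : W →L[ℝ] T)
    {ι : Type*} [Fintype ι] (e : ι → W) (c d : ι → ℝ) :
    c ⬝ᵥ (Matrix.of fun i j ↦ G (A (e i)) (A (e j))).mulVec d =
      G (A (∑ i, c i • e i)) (A (∑ i, d i • e i)) := by
  simp only [map_sum, map_smul, sum_apply, smul_apply,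
    dotProduct, Matrix.mulVec, Matrix.of_apply, smul_eq_mul]
  simp only [Finset.mul_sum]
  rw [Finset.sum_comm]
  exact Finset.sum_congr rfl fun i _ ↦ Finset.sum_congr rfl fun j _ ↦ by ring

theorem continuousOn_mfderiv_extChartAt_symm (x₀ : M) (v : EuclideanSpace ℝ (Fin n)) :
    ContinuousOn (fun y ↦ TotalSpace.mk' (EuclideanSpace ℝ (Fin n))
      (E := fun x : M ↦ TangentSpace (𝓡 n) x) ((extChartAt (𝓡 n) x₀).symm y)
      (mfderiv 𝓘(ℝ, EuclideanSpace ℝ (Fin n)) (𝓡 n) (extChartAt (𝓡 n) x₀).symm y v))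
      (extChartAt (𝓡 n) x₀).target := by
  have h1 := (contMDiffOn_extChartAt_symm (I := 𝓡 n) (n := ∞) x₀).continuousOn_tangentMapWithin
    (by simp) (isOpen_extChartAt_target x₀).uniqueMDiffOn
  have h2 : Continuous fun y : EuclideanSpace ℝ (Fin n) ↦
      (TotalSpace.mk' (EuclideanSpace ℝ (Fin n))
        (E := fun x : EuclideanSpace ℝ (Fin n) ↦
          TangentSpace 𝓘(ℝ, EuclideanSpace ℝ (Fin n)) x) y v) := by
    refine (tangentBundleModelSpaceHomeomorph 𝓘(ℝ, EuclideanSpace ℝ (Fin n))).symm.continuous.comp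
      (f := fun y ↦ ((y, v) : ModelProd _ _)) ?_
    exact continuous_id.prodMk continuous_const
  refine (h1.comp h2.continuousOn (fun y hy ↦ hy)).congr fun y hy ↦ ?_
  simp only [Function.comp, tangentMapWithin]
  rw [mfderivWithin_of_isOpen (isOpen_extChartAt_target x₀) hy]

theorem continuousOn_chartGram_apply (x₀ : M) (i j : Fin n) :
    ContinuousOn (fun y ↦ chartGram g x₀ y i j) (extChartAt (𝓡 n) x₀).target := by
  intro y hy
  have hv := continuousOn_mfderiv_extChartAt_symm x₀ (EuclideanSpace.single i (1 : ℝ)) y hy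
  have hw := continuousOn_mfderiv_extChartAt_symm x₀ (EuclideanSpace.single j (1 : ℝ)) y hy
  have hf := continuousOn_extChartAt_symm (I := 𝓡 n) x₀ y hy
  have := (g.contMDiff.continuous.continuousAt.comp_continuousWithinAt
    hf).clm_bundle_apply₂ (F₁ := EuclideanSpace ℝ (Fin n)) (F₂ := EuclideanSpace ℝ (Fin n))
    (F₃ := ℝ) (E₃ := Bundle.Trivial M ℝ) hv hw
  simp only [FiberBundle.continuousWithinAt_totalSpace] at this
  exact this.2

theorem continuousOn_det_chartGram (x₀ : M) :
    ContinuousOn (fun y ↦ (chartGram g x₀ y).det) (extChartAt (𝓡 n) x₀).target := by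
  have : ContinuousOn (fun y ↦ chartGram g x₀ y) (extChartAt (𝓡 n) x₀).target :=
    continuousOn_pi.2 fun i ↦ continuousOn_pi.2 fun j ↦ continuousOn_chartGram_apply g x₀ i j
  exact (continuous_id.matrix_det).comp_continuousOn this

theorem injective_mfderiv_extChartAt_symm (x₀ : M) {y : EuclideanSpace ℝ (Fin n)}
    (hy : y ∈ (extChartAt (𝓡 n) x₀).target) :
    Function.Injective
      (mfderiv 𝓘(ℝ, EuclideanSpace ℝ (Fin n)) (𝓡 n) (extChartAt (𝓡 n) x₀).symm y) := by
  have := isInvertible_mfderivWithin_extChartAt_symm (I := 𝓡 n) hy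
  rw [ModelWithCorners.range_eq_univ, mfderivWithin_univ] at this
  exact this.injective

theorem posDef_chartGram (x₀ : M) {y : EuclideanSpace ℝ (Fin n)}
    (hy : y ∈ (extChartAt (𝓡 n) x₀).target) : (chartGram g x₀ y).PosDef := by
  have key := fun c d : Fin n → ℝ ↦ dotProduct_gram_mulVec
    (g.inner ((extChartAt (𝓡 n) x₀).symm y))
    (mfderiv 𝓘(ℝ, EuclideanSpace ℝ (Fin n)) (𝓡 n) (extChartAt (𝓡 n) x₀).symm y)
    (fun i ↦ (EuclideanSpace.single i (1 : ℝ) : EuclideanSpace ℝ (Fin n))) c d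
  refine Matrix.PosDef.of_dotProduct_mulVec_pos ?_ fun c hc ↦ ?_
  · ext i j
    exact g.symm _ _ _
  · rw [star_trivial]
    refine lt_of_lt_of_eq (g.pos _ _ fun h0 ↦ hc ?_) (key c c).symm
    have h1 := injective_mfderiv_extChartAt_symm x₀ hy (h0.trans (map_zero _).symm)
    have h2 : ∑ i, c i • (EuclideanSpace.single i (1 : ℝ) : EuclideanSpace ℝ (Fin n)) = 0 := h1
    ext i
    have := congrArg (fun v : EuclideanSpace ℝ (Fin n) ↦ v i) h2
    simpa [Finset.sum_apply, Pi.single_apply] using this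

theorem aemeasurable_sqrt_det_chartGram (x₀ : M) :
    AEMeasurable (fun y ↦ ENNReal.ofReal √(chartGram g x₀ y).det)
      (volume.restrict (extChartAt (𝓡 n) x₀).target) :=
  ((continuousOn_det_chartGram g x₀).sqrt.aemeasurable
    (isOpen_extChartAt_target x₀).measurableSet).ennreal_ofReal

variable [MeasurableSpace M] [BorelSpace M]

theorem aemeasurable_extChartAt_symm (x₀ : M) :
    AEMeasurable (extChartAt (𝓡 n) x₀).symm
      ((volume.restrict (extChartAt (𝓡 n) x₀).target).withDensity
        fun y ↦ ENNReal.ofReal √(chartGram g x₀ y).det) :=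
  ((continuousOn_extChartAt_symm x₀).aemeasurable
    (isOpen_extChartAt_target x₀).measurableSet).mono_ac (withDensity_absolutelyContinuous _ _)

theorem chartVolume_lt_top (x₀ : M) {S : Set M} (hS : IsCompact S) (hSm : MeasurableSet S)
    (hS' : S ⊆ (extChartAt (𝓡 n) x₀).source) : chartVolume g x₀ S < ⊤ := by
  rw [chartVolume, Measure.map_apply_of_aemeasurable (aemeasurable_extChartAt_symm g x₀) hSm,
    withDensity_apply', Measure.restrict_restrict' (isOpen_extChartAt_target x₀).measurableSet]
  have hK : (extChartAt (𝓡 n) x₀).symm ⁻¹' S ∩ (extChartAt (𝓡 n) x₀).target =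
      extChartAt (𝓡 n) x₀ '' S := by
    rw [inter_comm]
    exact ((extChartAt (𝓡 n) x₀).image_eq_target_inter_inv_preimage hS').symm
  rw [hK]
  have hKt : extChartAt (𝓡 n) x₀ '' S ⊆ (extChartAt (𝓡 n) x₀).target :=
    hK ▸ inter_subset_right
  have hc : IsCompact (extChartAt (𝓡 n) x₀ '' S) :=
    hS.image_of_continuousOn ((continuousOn_extChartAt x₀).mono hS')
  obtain ⟨B, hB⟩ := hc.bddAbove_image ((continuousOn_det_chartGram g x₀).sqrt.mono hKt)
  calc ∫⁻ y in extChartAt (𝓡 n) x₀ '' S, ENNReal.ofReal √(chartGram g x₀ y).det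
      ≤ ∫⁻ _ in extChartAt (𝓡 n) x₀ '' S, ENNReal.ofReal B :=
        setLIntegral_mono' hc.measurableSet fun y hy ↦
          ENNReal.ofReal_le_ofReal (hB (mem_image_of_mem _ hy))
    _ < ⊤ := by
        rw [setLIntegral_const]
        exact ENNReal.mul_lt_top ENNReal.ofReal_lt_top hc.measure_lt_top

theorem chartVolume_pos (x₀ : M) {U : Set M} (hU : IsOpen U) {x : M} (hx : x ∈ U)
    (hx' : x ∈ (extChartAt (𝓡 n) x₀).source) : chartVolume g x₀ U ≠ 0 := by
  rw [chartVolume, Measure.map_apply_of_aemeasurable (aemeasurable_extChartAt_symm g x₀)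
    hU.measurableSet, Ne, withDensity_apply_eq_zero' (aemeasurable_sqrt_det_chartGram g x₀),
    Measure.restrict_apply' (isOpen_extChartAt_target x₀).measurableSet]
  have hV := (continuousOn_extChartAt_symm x₀).isOpen_inter_preimage
    (isOpen_extChartAt_target (I := 𝓡 n) x₀) hU
  refine ne_of_gt ((hV.measure_pos volume ⟨extChartAt (𝓡 n) x₀ x, ?_, ?_⟩).trans_le
    (measure_mono fun y hy ↦ ⟨⟨?_, hy.2⟩, hy.1⟩))
  · exact (extChartAt (𝓡 n) x₀).map_source hx'
  · rwa [mem_preimage, (extChartAt (𝓡 n) x₀).left_inv hx']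
  · exact (ENNReal.ofReal_pos.2 (Real.sqrt_pos.2 (posDef_chartGram g x₀ hy.1).det_pos)).ne'

variable [T2Space M] [CompactSpace M]

theorem isFiniteMeasure_riemannianVolume : IsFiniteMeasure (riemannianVolume g) := by
  refine ⟨?_⟩
  rw [riemannianVolume, Measure.sum_apply _ MeasurableSet.univ]
  set ρ := (SmoothPartitionOfUnity.exists_isSubordinate_chartAt_source (𝓡 n) M).choose with hρ
  have hsub : ρ.IsSubordinate fun x ↦ (chartAt (EuclideanSpace ℝ (Fin n)) x).source :=
    (SmoothPartitionOfUnity.exists_isSubordinate_chartAt_source (𝓡 n) M).choose_spec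
  -- all but finitely many functions of the partition of unity vanish identically
  have hfin : {x₀ : M | (Function.support (ρ x₀)).Nonempty}.Finite :=
    ρ.locallyFinite.finite_nonempty_of_compact
  rw [tsum_eq_sum (s := hfin.toFinset)]
  · refine ENNReal.sum_lt_top.2 fun x₀ _ ↦ ?_
    rw [withDensity_apply _ MeasurableSet.univ, Measure.restrict_univ]
    have hcl : MeasurableSet (tsupport (ρ x₀)) := (isClosed_tsupport _).measurableSet
    calc ∫⁻ x, ENNReal.ofReal (ρ x₀ x) ∂(chartVolume g x₀)
        ≤ ∫⁻ x, (tsupport (ρ x₀)).indicator 1 x ∂(chartVolume g x₀) := by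
          refine lintegral_mono fun x ↦ ?_
          by_cases hx : x ∈ tsupport (ρ x₀)
          · rw [indicator_of_mem hx]
            exact ENNReal.ofReal_le_one.2 (ρ.le_one x₀ x)
          · rw [image_eq_zero_of_notMem_tsupport hx, ENNReal.ofReal_zero]
            exact zero_le
      _ = chartVolume g x₀ (tsupport (ρ x₀)) := lintegral_indicator_one hcl
      _ < ⊤ := by
          refine chartVolume_lt_top g x₀ (isClosed_tsupport _).isCompact hcl ?_
          rw [extChartAt_source]
          exact hsub x₀
  · intro x₀ hx₀
    have h0 : ∀ x, ρ x₀ x = 0 := by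
      intro x
      by_contra hx
      exact hx₀ (hfin.mem_toFinset.2 ⟨x, hx⟩)
    simp [h0]

theorem isOpenPosMeasure_riemannianVolume : (riemannianVolume g).IsOpenPosMeasure := by
  refine ⟨fun U hU ⟨x, hx⟩ h0 ↦ ?_⟩
  rw [riemannianVolume, Measure.sum_apply _ hU.measurableSet, ENNReal.tsum_eq_zero] at h0
  set ρ := (SmoothPartitionOfUnity.exists_isSubordinate_chartAt_source (𝓡 n) M).choose with hρ
  have hsub : ρ.IsSubordinate fun x ↦ (chartAt (EuclideanSpace ℝ (Fin n)) x).source :=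
    (SmoothPartitionOfUnity.exists_isSubordinate_chartAt_source (𝓡 n) M).choose_spec
  obtain ⟨x₀, hx₀⟩ := ρ.exists_pos_of_mem (mem_univ x)
  have hc : Continuous (ρ x₀) := (ρ x₀).contMDiff.continuous
  have h1 := h0 x₀
  rw [withDensity_apply_eq_zero hc.measurable.ennreal_ofReal] at h1
  have hxs : x ∈ (extChartAt (𝓡 n) x₀).source := by
    rw [extChartAt_source]
    exact hsub x₀ (subset_tsupport _ hx₀.ne')
  refine chartVolume_pos g x₀ ((isOpen_lt continuous_const hc).inter hU) ⟨hx₀, hx⟩ hxs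
    (measure_mono_null (inter_subset_inter_left U fun y hy ↦ ?_) h1)
  exact (ENNReal.ofReal_pos.2 hy).ne'

end RiemannianVolume

/-! ### Smooth dependence of matrix geodesics on their endpoints -/

section MatrixSmooth

open scoped ComplexOrder Matrix Matrix.Norms.Operator

variable {ι : Type*} [DecidableEq ι] [Fintype ι]

variable (ι) in
/-- Pairs of positive definite matrices. -/
def posDefPairs : Set (Matrix ι ι ℂ × Matrix ι ι ℂ) := {P | P.PosDef} ×ˢ {Q | Q.PosDef}

theorem contDiffOn_matRelLog :
    ContDiffOn ℝ ∞ (fun p : Matrix ι ι ℂ × Matrix ι ι ℂ ↦ matRelLog p.1 p.2) (posDefPairs ι) :=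
  fun _ hp ↦ contDiffAt_matRelLog hp.1 hp.2

theorem contDiffOn_matGen :
    ContDiffOn ℝ ∞ (fun p : Matrix ι ι ℂ × Matrix ι ι ℂ ↦ matGen p.1 p.2) (posDefPairs ι) :=
  fun p hp ↦ ((contDiffAt_matrix_inv hp.1.isUnit).comp_contDiffWithinAt p
    contDiffWithinAt_fst).mul (contDiffOn_matRelLog p hp)

theorem contDiffOn_matGeod :
    ContDiffOn ℝ ∞ (fun p : ℝ × (Matrix ι ι ℂ × Matrix ι ι ℂ) ↦ matGeod p.2.1 p.2.2 p.1)
      (univ ×ˢ posDefPairs ι) := by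
  have hA : ContDiffOn ℝ ∞ (fun p : ℝ × (Matrix ι ι ℂ × Matrix ι ι ℂ) ↦ matGen p.2.1 p.2.2)
      (univ ×ˢ posDefPairs ι) := contDiffOn_matGen.comp contDiffOn_snd fun p hp ↦ hp.2
  exact (contDiff_fst.comp contDiff_snd).contDiffOn.mul
    (contDiff_matrix_exp.comp_contDiffOn (contDiffOn_fst.smul hA))

theorem contDiffOn_matGeodSlope :
    ContDiffOn ℝ ∞ (fun p : (ℝ × ℝ) × (Matrix ι ι ℂ × Matrix ι ι ℂ) ↦
      matGeodSlope p.2.1 p.2.2 p.1.1 p.1.2) (univ ×ˢ posDefPairs ι) := by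
  have hA : ContDiffOn ℝ ∞ (fun p : (ℝ × ℝ) × (Matrix ι ι ℂ × Matrix ι ι ℂ) ↦
      matGen p.2.1 p.2.2) (univ ×ˢ posDefPairs ι) :=
    contDiffOn_matGen.comp contDiffOn_snd fun p hp ↦ hp.2
  have ht : ContDiffOn ℝ ∞ (fun p : (ℝ × ℝ) × (Matrix ι ι ℂ × Matrix ι ι ℂ) ↦ p.1.1)
      (univ ×ˢ posDefPairs ι) := (contDiff_fst.comp contDiff_fst).contDiffOn
  have hs : ContDiffOn ℝ ∞ (fun p : (ℝ × ℝ) × (Matrix ι ι ℂ × Matrix ι ι ℂ) ↦ p.1.2)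
      (univ ×ˢ posDefPairs ι) := (contDiff_snd.comp contDiff_fst).contDiffOn
  exact ((contDiff_fst.comp contDiff_snd).contDiffOn.mul
    (hA.mul (contDiff_matrix_exp.comp_contDiffOn (ht.smul hA)))).mul
    (contDiff_expSubOneDiv.comp_contDiffOn ((hs.sub ht).smul hA))

theorem contDiffOn_matGeod_fixed (t : ℝ) :
    ContDiffOn ℝ ∞ (fun p : Matrix ι ι ℂ × Matrix ι ι ℂ ↦ matGeod p.1 p.2 t) (posDefPairs ι) :=
  contDiffOn_matGeod.comp (f := fun p ↦ (t, p)) (contDiff_const.prodMk contDiff_id).contDiffOn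
    fun _ hp ↦ ⟨mem_univ t, hp⟩

theorem contDiffOn_matGeodSlope_fixed (t s : ℝ) :
    ContDiffOn ℝ ∞ (fun p : Matrix ι ι ℂ × Matrix ι ι ℂ ↦ matGeodSlope p.1 p.2 t s)
      (posDefPairs ι) :=
  contDiffOn_matGeodSlope.comp (f := fun p ↦ ((t, s), p))
    (contDiff_const.prodMk contDiff_id).contDiffOn fun _ hp ↦ ⟨mem_univ (t, s), hp⟩

theorem ContDiffOn.matrix_apply {ι : Type*} [Fintype ι] [DecidableEq ι] {W : Type*}
    [NormedAddCommGroup W] [NormedSpace ℝ W] {f : W → Matrix ι ι ℂ} {s : Set W}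
    (hf : ContDiffOn ℝ ∞ f s) (i j : ι) :
    ContDiffOn ℝ ∞ (fun x ↦ f x i j) s :=
  ((Matrix.entryLinearMap ℝ ℂ i j : Matrix ι ι ℂ →ₗ[ℝ] ℂ).toContinuousLinearMap).contDiff
    |>.comp_contDiffOn hf

theorem ContMDiffOn.comp_sum_linearMap {n : ℕ} {M : Type*} [TopologicalSpace M]
    [ChartedSpace (EuclideanSpace ℝ (Fin n)) M] {V : Type*} [NormedAddCommGroup V]
    [NormedSpace ℝ V] {κ : Type*} [Fintype κ] (T : κ → ℂ →ₗ[ℝ] V) {f : κ → M → ℂ} {s : Set M}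
    (hf : ∀ k, ContMDiffOn (𝓡 n) 𝓘(ℝ, ℂ) ∞ (f k) s) {Φ : V → ℂ} {S : Set V}
    (hΦ : ContDiffOn ℝ ∞ Φ S) (hS : ∀ x ∈ s, ∑ k, T k (f k x) ∈ S) :
    ContMDiffOn (𝓡 n) 𝓘(ℝ, ℂ) ∞ (fun x ↦ Φ (∑ k, T k (f k x))) s := by
  have : ContMDiffOn (𝓡 n) 𝓘(ℝ, V) ∞ (fun x ↦ ∑ k, T k (f k x)) s :=
    contMDiffOn_finsetSum fun k _ ↦
      ((T k).toContinuousLinearMap.contDiff (n := ∞)).contMDiff.comp_contMDiffOn (hf k)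
  exact hΦ.contMDiffOn.comp this hS

/-- The linear map that places a number in one entry of a pair of matrices. -/
def pairSingle : (ι × ι) ⊕ (ι × ι) → ℂ →ₗ[ℝ] Matrix ι ι ℂ × Matrix ι ι ℂ
  | .inl k => LinearMap.inl ℝ _ _ ∘ₗ Matrix.singleLinearMap ℝ k.1 k.2
  | .inr k => LinearMap.inr ℝ _ _ ∘ₗ Matrix.singleLinearMap ℝ k.1 k.2

theorem sum_pairSingle (A B : Matrix ι ι ℂ) :
    ∑ k, pairSingle k (Sum.elim (fun k ↦ A k.1 k.2) (fun k ↦ B k.1 k.2) k) = (A, B) := by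
  rw [Fintype.sum_sum_type, Fintype.sum_prod_type, Fintype.sum_prod_type]
  simp only [pairSingle, Sum.elim_inl, Sum.elim_inr, LinearMap.comp_apply, ← map_sum]
  have key : ∀ A : Matrix ι ι ℂ, ∑ i, ∑ j, Matrix.singleLinearMap ℝ i j (A i j) = A :=
    fun A ↦ (Matrix.matrix_eq_sum_single A).symm
  rw [key, key]
  simp

/-- A smooth function of two positive definite matrices, evaluated at matrices with smooth
entries, is smooth. -/
theorem ContMDiffOn.comp_matrix_pair {n : ℕ} {M : Type*} [TopologicalSpace M]
    [ChartedSpace (EuclideanSpace ℝ (Fin n)) M] {A B : M → Matrix ι ι ℂ} {s : Set M}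
    (hA : ∀ i j, ContMDiffOn (𝓡 n) 𝓘(ℝ, ℂ) ∞ (fun x ↦ A x i j) s)
    (hB : ∀ i j, ContMDiffOn (𝓡 n) 𝓘(ℝ, ℂ) ∞ (fun x ↦ B x i j) s)
    {Φ : Matrix ι ι ℂ × Matrix ι ι ℂ → ℂ} (hΦ : ContDiffOn ℝ ∞ Φ (posDefPairs ι))
    (hAp : ∀ x ∈ s, (A x).PosDef) (hBp : ∀ x ∈ s, (B x).PosDef) :
    ContMDiffOn (𝓡 n) 𝓘(ℝ, ℂ) ∞ (fun x ↦ Φ (A x, B x)) s := by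
  have := ContMDiffOn.comp_sum_linearMap (V := Matrix ι ι ℂ × Matrix ι ι ℂ) pairSingle
    (f := fun k x ↦ Sum.elim (fun k ↦ A x k.1 k.2) (fun k ↦ B x k.1 k.2) k) (s := s)
    (by rintro (k | k); exacts [hA _ _, hB _ _]) hΦ
    (fun x hx ↦ by rw [sum_pairSingle]; exact ⟨hAp x hx, hBp x hx⟩)
  simpa only [sum_pairSingle] using this

theorem ContDiffOn.of_matrix_pair_apply {W : Type*} [NormedAddCommGroup W] [NormedSpace ℝ W]
    {A B : W → Matrix ι ι ℂ} {s : Set W}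
    (hA : ∀ i j, ContDiffOn ℝ ∞ (fun x ↦ A x i j) s)
    (hB : ∀ i j, ContDiffOn ℝ ∞ (fun x ↦ B x i j) s) :
    ContDiffOn ℝ ∞ (fun x ↦ (A x, B x)) s := by
  have : ContDiffOn ℝ ∞ (fun x ↦ ∑ k, pairSingle k
      (Sum.elim (fun k ↦ A x k.1 k.2) (fun k ↦ B x k.1 k.2) k)) s := by
    refine ContDiffOn.sum fun k _ ↦ ?_
    refine ((pairSingle k).toContinuousLinearMap.contDiff (n := ∞)).comp_contDiffOn ?_
    rcases k with k | k
    exacts [hA _ _, hB _ _]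
  simpa only [sum_pairSingle] using this

end MatrixSmooth

/-! ### Smooth families of functions converge with all their derivatives -/

section SmoothFamilies

variable {W : Type*} [NormedAddCommGroup W] [NormedSpace ℝ W]
  {G : Type*} [NormedAddCommGroup G] [NormedSpace ℝ G]

/-- The partial derivatives, in the second variable, of a smooth function of two variables depend
smoothly on both variables. -/
theorem contDiffOn_iteratedFDeriv_snd {f : ℝ × W → G} {D : Set W} (hD : IsOpen D)
    (hf : ContDiffOn ℝ ∞ f (univ ×ˢ D)) (k : ℕ) :
    ContDiffOn ℝ ∞ (fun p : ℝ × W ↦ iteratedFDeriv ℝ k (fun y ↦ f (p.1, y)) p.2)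
      (univ ×ˢ D) := by
  induction k with
  | zero =>
    have : (fun p : ℝ × W ↦ iteratedFDeriv ℝ 0 (fun y ↦ f (p.1, y)) p.2) =
        (continuousMultilinearCurryFin0 ℝ W G).symm ∘ f := by
      ext p; simp
    rw [this]
    exact (LinearIsometryEquiv.contDiff _).comp_contDiffOn hf
  | succ k ih =>
    intro p hp
    have hpn : (univ ×ˢ D : Set (ℝ × W)) ∈ 𝓝 p := (isOpen_univ.prod hD).mem_nhds hp
    have h1 := (ih p hp).contDiffAt hpn
    have h2 : ContDiffAt ℝ ∞ (fun p : ℝ × W ↦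
        fderiv ℝ (iteratedFDeriv ℝ k fun y ↦ f (p.1, y)) p.2) p := by
      refine ContDiffAt.fderiv
        (f := fun (p : ℝ × W) (y : W) ↦ iteratedFDeriv ℝ k (fun y ↦ f (p.1, y)) y)
        (g := Prod.snd) (n := ∞) ?_ contDiffAt_snd (by simp)
      exact ContDiffAt.comp (p, p.2) (g := fun p : ℝ × W ↦
        iteratedFDeriv ℝ k (fun y ↦ f (p.1, y)) p.2) (f := fun q : (ℝ × W) × W ↦ (q.1.1, q.2)) h1
        ((contDiff_fst.comp contDiff_fst).prodMk contDiff_snd).contDiffAt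
    exact (h2.continuousLinearMap_comp
      ((continuousMultilinearCurryLeftEquiv ℝ (fun _ : Fin (k + 1) ↦ W) G).symm :
        _ →L[ℝ] W [×(k + 1)]→L[ℝ] G)).contDiffWithinAt

theorem tendstoUniformlyOn_iteratedFDeriv_snd {f : ℝ × W → G} {D : Set W} (hD : IsOpen D)
    (hf : ContDiffOn ℝ ∞ f (univ ×ˢ D)) (k : ℕ) {K : Set W} (hK : IsCompact K) (hKD : K ⊆ D)
    (t : ℝ) :
    TendstoUniformlyOn (fun s ↦ iteratedFDeriv ℝ k fun y ↦ f (s, y))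
      (iteratedFDeriv ℝ k fun y ↦ f (t, y)) (𝓝 t) K := by
  intro u hu
  have hc := ((contDiffOn_iteratedFDeriv_snd hD hf k).continuousOn).mono
    (prod_mono_right (s := (univ : Set ℝ)) hKD)
  obtain ⟨v, hv, h⟩ := hK.mem_uniformity_of_prod
    (f := fun s y ↦ iteratedFDeriv ℝ k (fun y ↦ f (s, y)) y) hc (mem_univ t) (symm_le_uniformity hu)
  rw [nhdsWithin_univ] at hv
  filter_upwards [hv] with s hs y hy
  exact h s hs y hy

end SmoothFamilies

/-! ### Sections of the bundle of Hermitian forms in local frames -/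

section LocalFrames

open scoped ComplexOrder Matrix Matrix.Norms.Operator

variable {n : ℕ} {M : Type*} [TopologicalSpace M] [ChartedSpace (EuclideanSpace ℝ (Fin n)) M]
  {F : Type*} [NormedAddCommGroup F]
  {E : M → Type*} [TopologicalSpace (TotalSpace F E)] [∀ x, TopologicalSpace (E x)]

theorem norm_iteratedFDeriv_zero_sub {V W : Type*} [NormedAddCommGroup V] [NormedSpace ℝ V]
    [NormedAddCommGroup W] [NormedSpace ℝ W] (f g : V → W) (z : V) :
    ‖iteratedFDeriv ℝ 0 f z - iteratedFDeriv ℝ 0 g z‖ = ‖f z - g z‖ := by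
  rw [iteratedFDeriv_zero_eq_comp, iteratedFDeriv_zero_eq_comp, Function.comp_apply,
    Function.comp_apply, ← map_sub, LinearIsometryEquiv.norm_map]

theorem isOpen_chartDomain [FiberBundle F E] (x₀ : M) : IsOpen (chartDomain n F E x₀) :=
  (continuousOn_extChartAt_symm x₀).isOpen_inter_preimage (isOpen_extChartAt_target x₀)
    (trivializationAt F E x₀).open_baseSet

variable [∀ x, AddCommGroup (E x)] [∀ x, Module ℂ (E x)] [FiberBundle F E]

theorem HermSection.ext_val {v w : HermSection n F E} (h : ∀ x, v.val x = w.val x) : v = w :=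
  Subtype.ext (funext fun x ↦ congrArg Subtype.val (h x))

theorem HermSection.val_slope (c : ℝ → HermSection n F E) (t s : ℝ) (x : M) :
    (slope c t s).val x = slope (fun s ↦ (c s).val x) t s := rfl

variable [NormedSpace ℂ F] [FiniteDimensional ℂ F]

/-- The matrix of a family of sesquilinear forms in the local frame of `E` given by the preferred
trivialization around `x₀` and a basis of the model fiber. -/
def localMatrix (v : ∀ x, E x →ₗ[ℂ] E x →ₗ⋆[ℂ] ℂ) (x₀ x : M) :
    Matrix (Fin (Module.finrank ℂ F)) (Fin (Module.finrank ℂ F)) ℂ :=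
  Matrix.of fun i j ↦ localCoeff F v x₀ (Module.finBasis ℂ F j) (Module.finBasis ℂ F i) x

theorem HermSection.contMDiffOn_localMatrix (v : HermSection n F E) (x₀ : M)
    (i j : Fin (Module.finrank ℂ F)) :
    ContMDiffOn (𝓡 n) 𝓘(ℝ, ℂ) ∞ (fun x ↦ localMatrix (F := F) v.1 x₀ x i j)
      (trivializationAt F E x₀).baseSet :=
  v.2.2 x₀ _ _

theorem HermSection.continuousAt_localMatrix (v : HermSection n F E) (x : M) :
    ContinuousAt (fun y ↦ localMatrix (F := F) v.1 x y) x := by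
  refine continuousAt_pi.2 fun i ↦ continuousAt_pi.2 fun j ↦ ?_
  exact (v.contMDiffOn_localMatrix x i j).continuousOn.continuousAt
    ((trivializationAt F E x).open_baseSet.mem_nhds
      (FiberBundle.mem_baseSet_trivializationAt' x))

theorem HermSection.contDiffOn_localMatrix [IsManifold (𝓡 n) ∞ M] (v : HermSection n F E) (x₀ : M)
    (i j : Fin (Module.finrank ℂ F)) :
    ContDiffOn ℝ ∞ (fun y ↦ localMatrix (F := F) v.1 x₀ ((extChartAt (𝓡 n) x₀).symm y) i j)
      (chartDomain n F E x₀) := by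
  rw [← contMDiffOn_iff_contDiffOn]
  exact (v.contMDiffOn_localMatrix x₀ i j).comp
    ((contMDiffOn_extChartAt_symm x₀).mono inter_subset_left) inter_subset_right

/-- Uniform convergence near each point of the matrices in local frames; this is weaker than
convergence in the smooth topology. -/
def LocallyTendsto {β : Type*} (u : β → HermSection n F E) (l : Filter β)
    (v : HermSection n F E) : Prop :=
  ∀ x : M, Tendsto (fun p : β × M ↦ localMatrix (F := F) (u p.1).1 x p.2) (l ×ˢ 𝓝 x)
    (𝓝 (localMatrix (F := F) v.1 x x))

theorem locallyTendsto_const {β : Type*} (l : Filter β) (v : HermSection n F E) :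
    LocallyTendsto (fun _ ↦ v) l v :=
  fun x ↦ (v.continuousAt_localMatrix x).tendsto.comp tendsto_snd

theorem Filter.Tendsto.locallyTendsto {β : Type*} {u : β → HermSection n F E} {l : Filter β}
    {v : HermSection n F E} (h : Tendsto u l (𝓝 v)) : LocallyTendsto u l v := by
  intro x
  refine tendsto_pi_nhds.2 fun i ↦ tendsto_pi_nhds.2 fun j ↦ ?_
  set a := Module.finBasis ℂ F j
  set c := Module.finBasis ℂ F i
  have hx : extChartAt (𝓡 n) x x ∈ chartDomain n F E x :=
    ⟨mem_extChartAt_target x, by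
      rw [mem_preimage, extChartAt_to_inv]
      exact FiberBundle.mem_baseSet_trivializationAt' x⟩
  obtain ⟨K, hK, hKD, hKc⟩ := local_compact_nhds ((isOpen_chartDomain (F := F) x).mem_nhds hx)
  rw [nhds_induced, tendsto_comap_iff, tendsto_pi_nhds] at h
  have h1 := UniformOnFun.tendsto_iff_tendstoUniformlyOn.1 (h (x, a, c, 0)) K ⟨hKc, hKD⟩
  have hdiff : Tendsto (fun p : β × M ↦
      localCoeff F (u p.1).1 x a c p.2 - localCoeff F v.1 x a c p.2) (l ×ˢ 𝓝 x) (𝓝 0) := by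
    rw [Metric.tendsto_nhds]
    intro ε hε
    have h2 := Metric.tendstoUniformlyOn_iff.1 h1 ε hε
    have h3 : ∀ᶠ y in 𝓝 x, extChartAt (𝓡 n) x y ∈ K :=
      (continuousAt_extChartAt x).eventually hK
    have h4 : ∀ᶠ y in 𝓝 x, y ∈ (extChartAt (𝓡 n) x).source :=
      (isOpen_extChartAt_source x).mem_nhds (mem_extChartAt_source x)
    filter_upwards [h2.prod_mk (h3.and h4)] with p hp
    have h5 := hp.1 _ hp.2.1
    rw [dist_comm, dist_eq_norm] at h5
    rw [dist_zero_right]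
    have h6 : ‖iteratedFDeriv ℝ 0 (localCoeff F (u p.1).1 x a c ∘ (extChartAt (𝓡 n) x).symm)
        (extChartAt (𝓡 n) x p.2) - iteratedFDeriv ℝ 0
        (localCoeff F v.1 x a c ∘ (extChartAt (𝓡 n) x).symm) (extChartAt (𝓡 n) x p.2)‖ < ε := h5
    rw [norm_iteratedFDeriv_zero_sub, Function.comp_apply, Function.comp_apply,
      (extChartAt (𝓡 n) x).left_inv hp.2.2] at h6
    exact h6
  have := hdiff.add (((locallyTendsto_const l v x).apply_nhds i).apply_nhds j)
  rw [zero_add] at this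
  refine this.congr fun p ↦ ?_
  exact sub_add_cancel _ _

variable [VectorBundle ℂ F E]

/-- The basis of the fiber over `x` given by the preferred trivialization around `x₀`. -/
def localFrame {x₀ x : M} (hx : x ∈ (trivializationAt F E x₀).baseSet) :
    Module.Basis (Fin (Module.finrank ℂ F)) ℂ (E x) :=
  (Module.finBasis ℂ F).map ((trivializationAt F E x₀).linearEquivAt ℂ x hx).symm

theorem formMatrix_localFrame {x₀ x : M} (hx : x ∈ (trivializationAt F E x₀).baseSet)
    {v : ∀ x, E x →ₗ[ℂ] E x →ₗ⋆[ℂ] ℂ} {u : Herm (E x)} (hu : u.1 = v x) :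
    formMatrix (localFrame hx) u = localMatrix (F := F) v x₀ x := by
  ext i j
  rw [localMatrix, formMatrix, Matrix.of_apply, Matrix.of_apply, hu]
  rfl

theorem finrank_fiber (F : Type*) [NormedAddCommGroup F] [NormedSpace ℂ F]
    [TopologicalSpace (TotalSpace F E)] [FiberBundle F E] [VectorBundle ℂ F E] (x : M) :
    Module.finrank ℂ (E x) = Module.finrank ℂ F :=
  ((trivializationAt F E x).linearEquivAt ℂ x
    (FiberBundle.mem_baseSet_trivializationAt' x)).finrank_eq

theorem localCoeff_eq_sum (v : ∀ x, E x →ₗ[ℂ] E x →ₗ⋆[ℂ] ℂ) (x₀ : M) (u w : F) {x : M}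
    (hx : x ∈ (trivializationAt F E x₀).baseSet) :
    localCoeff F v x₀ u w x = ∑ j, ∑ i, (Module.finBasis ℂ F).repr u j *
      (starRingEnd ℂ ((Module.finBasis ℂ F).repr w i) * localMatrix (F := F) v x₀ x i j) := by
  set b := Module.finBasis ℂ F
  have e : ∀ u : F, (trivializationAt F E x₀).symm x u =
      ∑ j, b.repr u j • (trivializationAt F E x₀).symm x (b j) := fun u ↦ by
    have := congrArg ((trivializationAt F E x₀).linearEquivAt ℂ x hx).symm (b.sum_repr u)
    rw [map_sum] at this
    simpa only [map_smul, Trivialization.linearEquivAt_symm_apply] using this.symm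
  rw [localCoeff, e u, e w]
  simp only [map_sum, LinearMap.sum_apply, map_smul, LinearMap.smul_apply, LinearMap.map_smulₛₗ,
    smul_eq_mul, localMatrix, Matrix.of_apply, localCoeff, b]
  simp only [Finset.mul_sum]
  rw [Finset.sum_comm]
  exact Finset.sum_congr rfl fun j _ ↦ Finset.sum_congr rfl fun i _ ↦ mul_left_comm _ _ _

theorem contMDiffOn_localCoeff {v : ∀ x, E x →ₗ[ℂ] E x →ₗ⋆[ℂ] ℂ} {x₀ : M}
    (h : ∀ i j, ContMDiffOn (𝓡 n) 𝓘(ℝ, ℂ) ∞ (fun x ↦ localMatrix (F := F) v x₀ x i j)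
      (trivializationAt F E x₀).baseSet) (u w : F) :
    ContMDiffOn (𝓡 n) 𝓘(ℝ, ℂ) ∞ (localCoeff F v x₀ u w) (trivializationAt F E x₀).baseSet := by
  have : ContMDiffOn (𝓡 n) 𝓘(ℝ, ℂ) ∞ (fun x ↦ ∑ j, ∑ i, (Module.finBasis ℂ F).repr u j *
      (starRingEnd ℂ ((Module.finBasis ℂ F).repr w i) * localMatrix (F := F) v x₀ x i j))
      (trivializationAt F E x₀).baseSet :=
    contMDiffOn_finsetSum fun j _ ↦ contMDiffOn_finsetSum fun i _ ↦
      ((contDiff_const.mul (contDiff_const.mul contDiff_id)).contMDiff).comp_contMDiffOn (h i j)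
  exact this.congr fun x hx ↦ localCoeff_eq_sum v x₀ u w hx

/-- A family of Hermitian forms whose matrices in local frames are smooth is a smooth section. -/
def HermSection.ofSmooth (v : ∀ x, Herm (E x))
    (h : ∀ x₀ i j, ContMDiffOn (𝓡 n) 𝓘(ℝ, ℂ) ∞
      (fun x ↦ localMatrix (F := F) (fun x ↦ (v x).1) x₀ x i j)
      (trivializationAt F E x₀).baseSet) : HermSection n F E :=
  ⟨fun x ↦ (v x).1, fun x ↦ (v x).2, fun x₀ u w ↦ contMDiffOn_localCoeff (h x₀) u w⟩

theorem HermSection.formMatrix_val (v : HermSection n F E) {x₀ x : M}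
    (hx : x ∈ (trivializationAt F E x₀).baseSet) :
    formMatrix (localFrame hx) (v.val x) = localMatrix (F := F) v.1 x₀ x :=
  formMatrix_localFrame hx rfl

theorem posDef_localMatrix {h : HermSection n F E} (hh : h ∈ HermMetric n F E) {x₀ x : M}
    (hx : x ∈ (trivializationAt F E x₀).baseSet) :
    (localMatrix (F := F) h.1 x₀ x).PosDef := by
  rw [← HermSection.formMatrix_val h hx]
  exact (posDef_formMatrix_iff _).2 (hh x)

/-- A family of sections whose matrices in local frames are smooth functions of the parameter and
the point is continuous for the smooth topology. -/
theorem HermSection.continuous_of_contDiffOn {u : ℝ → HermSection n F E}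
    (h : ∀ x₀ i j, ContDiffOn ℝ ∞ (fun p : ℝ × EuclideanSpace ℝ (Fin n) ↦
      localMatrix (F := F) (u p.1).1 x₀ ((extChartAt (𝓡 n) x₀).symm p.2) i j)
      (univ ×ˢ chartDomain n F E x₀)) : Continuous u := by
  refine continuous_induced_rng.2 (continuous_pi fun ⟨x₀, a, c, k⟩ ↦
    continuous_iff_continuousAt.2 fun t ↦ ?_)
  rw [ContinuousAt, UniformOnFun.tendsto_iff_tendstoUniformlyOn]
  rintro K ⟨hK, hKD⟩
  have hs : ContDiffOn ℝ ∞ (fun p : ℝ × EuclideanSpace ℝ (Fin n) ↦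
      localCoeff F (u p.1).1 x₀ a c ((extChartAt (𝓡 n) x₀).symm p.2))
      (univ ×ˢ chartDomain n F E x₀) := by
    have : ContDiffOn ℝ ∞ (fun p : ℝ × EuclideanSpace ℝ (Fin n) ↦
        ∑ j, ∑ i, (Module.finBasis ℂ F).repr a j * (starRingEnd ℂ ((Module.finBasis ℂ F).repr c i) *
          localMatrix (F := F) (u p.1).1 x₀ ((extChartAt (𝓡 n) x₀).symm p.2) i j))
        (univ ×ˢ chartDomain n F E x₀) :=
      ContDiffOn.sum fun j _ ↦ ContDiffOn.sum fun i _ ↦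
        contDiffOn_const.mul (contDiffOn_const.mul (h x₀ i j))
    exact this.congr fun p hp ↦ localCoeff_eq_sum _ _ _ _ hp.2.2
  exact tendstoUniformlyOn_iteratedFDeriv_snd (isOpen_chartDomain x₀) hs k hK hKD t

end LocalFrames

/-! ### Geodesics in the space of Hermitian metrics -/

section SectionGeodesics

open scoped ComplexOrder Matrix Matrix.Norms.Operator

variable {n : ℕ} {M : Type*} [TopologicalSpace M] [ChartedSpace (EuclideanSpace ℝ (Fin n)) M]
  {F : Type*} [NormedAddCommGroup F] [NormedSpace ℂ F] [FiniteDimensional ℂ F]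
  {E : M → Type*} [∀ x, AddCommGroup (E x)] [∀ x, Module ℂ (E x)]
  [TopologicalSpace (TotalSpace F E)] [∀ x, TopologicalSpace (E x)] [FiberBundle F E]
  [VectorBundle ℂ F E]

open Classical in
/-- The section with the given values, when they depend smoothly on the point, and zero
otherwise. -/
def HermSection.ofFiber (v : ∀ x, Herm (E x)) : HermSection n F E :=
  if h : ∀ x₀ i j, ContMDiffOn (𝓡 n) 𝓘(ℝ, ℂ) ∞
      (fun x ↦ localMatrix (F := F) (fun x ↦ (v x).1) x₀ x i j)
      (trivializationAt F E x₀).baseSet then HermSection.ofSmooth v h else 0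

/-- Values whose matrices are a smooth function of the matrices of two Hermitian metrics form a
smooth section. -/
theorem HermSection.val_ofFiber {h k : HermSection n F E} (hh : h ∈ HermMetric n F E)
    (hk : k ∈ HermMetric n F E) {v : ∀ x, Herm (E x)}
    {Φ : Matrix (Fin (Module.finrank ℂ F)) (Fin (Module.finrank ℂ F)) ℂ ×
      Matrix (Fin (Module.finrank ℂ F)) (Fin (Module.finrank ℂ F)) ℂ →
      Matrix (Fin (Module.finrank ℂ F)) (Fin (Module.finrank ℂ F)) ℂ}
    (hΦ : ContDiffOn ℝ ∞ Φ (posDefPairs _))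
    (hv : ∀ (x : M) (b : Module.Basis (Fin (Module.finrank ℂ F)) ℂ (E x)),
      formMatrix b (v x) = Φ (formMatrix b (h.val x), formMatrix b (k.val x))) (x : M) :
    (HermSection.ofFiber v : HermSection n F E).val x = v x := by
  rw [HermSection.ofFiber, dif_pos]
  · rfl
  · intro x₀ i j
    refine (ContMDiffOn.comp_matrix_pair (h.contMDiffOn_localMatrix x₀)
      (k.contMDiffOn_localMatrix x₀) (hΦ.matrix_apply i j)
      (fun x hx ↦ posDef_localMatrix hh hx) (fun x hx ↦ posDef_localMatrix hk hx)).congr ?_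
    intro x hx
    rw [← formMatrix_localFrame hx (u := v x) rfl, hv, h.formMatrix_val hx, k.formMatrix_val hx]

variable {h k : HermSection n F E}

/-- A family of sections is continuous if its matrices are difference quotients of the geodesics
between the matrices of two Hermitian metrics, at times depending smoothly on the parameter. -/
theorem continuous_of_localMatrix_eq [IsManifold (𝓡 n) ∞ M] (hh : h ∈ HermMetric n F E)
    (hk : k ∈ HermMetric n F E) {u : ℝ → HermSection n F E} {τ : ℝ → ℝ × ℝ}
    (hτ : ContDiff ℝ ∞ τ)
    (hu : ∀ (s : ℝ) (x : M) (b : Module.Basis (Fin (Module.finrank ℂ F)) ℂ (E x)),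
      formMatrix b ((u s).val x) =
        matGeodSlope (formMatrix b (h.val x)) (formMatrix b (k.val x)) (τ s).1 (τ s).2) :
    Continuous u := by
  refine HermSection.continuous_of_contDiffOn fun x₀ i j ↦ ?_
  have hpair := (ContDiffOn.of_matrix_pair_apply (h.contDiffOn_localMatrix x₀)
    (k.contDiffOn_localMatrix x₀)).comp (contDiffOn_snd (E := ℝ)) fun p hp ↦
      (hp : p ∈ univ ×ˢ chartDomain n F E x₀).2
  have := (contDiffOn_matGeodSlope.comp ((hτ.comp contDiff_fst).contDiffOn.prodMk hpair)
    fun p hp ↦ ⟨mem_univ _, posDef_localMatrix hh hp.2.2, posDef_localMatrix hk hp.2.2⟩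
    ).matrix_apply i j
  refine this.congr fun p hp ↦ ?_
  rw [← HermSection.formMatrix_val _ hp.2.2, hu, h.formMatrix_val hp.2.2, k.formMatrix_val hp.2.2]
  rfl

variable [∀ x, FiniteDimensional ℂ (E x)]

/-- The section `v` with `exp (h⁻¹ v) = h⁻¹ k`. -/
def sectionLog (h k : HermSection n F E) : HermSection n F E :=
  HermSection.ofFiber fun x ↦ fiberLog (h.val x) (k.val x)

/-- The path `t ↦ h exp (t h⁻¹ v)` of Hermitian metrics, where `exp (h⁻¹ v) = h⁻¹ k`. -/
def sectionGeod (h k : HermSection n F E) (t : ℝ) : HermSection n F E :=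
  HermSection.ofFiber fun x ↦ fiberGeod (h.val x) (k.val x) t

/-- The velocity of `sectionGeod`. -/
def sectionGeodVelocity (h k : HermSection n F E) (t : ℝ) : HermSection n F E :=
  HermSection.ofFiber fun x ↦ fiberGeodVelocity (h.val x) (k.val x) t

theorem val_sectionLog (hh : h ∈ HermMetric n F E) (hk : k ∈ HermMetric n F E) (x : M) :
    (sectionLog h k).val x = fiberLog (h.val x) (k.val x) :=
  HermSection.val_ofFiber hh hk contDiffOn_matRelLog
    (fun x b ↦ formMatrix_fiberLog b (hh x) (hk x)) x

theorem val_sectionGeod (hh : h ∈ HermMetric n F E) (hk : k ∈ HermMetric n F E) (t : ℝ) (x : M) :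
    (sectionGeod h k t).val x = fiberGeod (h.val x) (k.val x) t :=
  HermSection.val_ofFiber hh hk (Φ := fun p ↦ matGeod p.1 p.2 t)
    (contDiffOn_matGeod_fixed t)
    (fun x b ↦ formMatrix_fiberGeod b (hh x) (hk x) t) x

theorem val_sectionGeodVelocity (hh : h ∈ HermMetric n F E) (hk : k ∈ HermMetric n F E) (t : ℝ)
    (x : M) : (sectionGeodVelocity h k t).val x = fiberGeodVelocity (h.val x) (k.val x) t :=
  HermSection.val_ofFiber hh hk (Φ := fun p ↦ matGeodSlope p.1 p.2 t t)
    (contDiffOn_matGeodSlope_fixed t t)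
    (fun x b ↦ formMatrix_fiberGeodVelocity b (hh x) (hk x) t) x

theorem sectionGeod_mem (hh : h ∈ HermMetric n F E) (hk : k ∈ HermMetric n F E) (t : ℝ) :
    sectionGeod h k t ∈ HermMetric n F E := fun x ↦ by
  rw [val_sectionGeod hh hk]
  exact fiberGeod_mem (hh x) (hk x) t

theorem sectionGeod_zero (hh : h ∈ HermMetric n F E) (hk : k ∈ HermMetric n F E) :
    sectionGeod h k 0 = h :=
  HermSection.ext_val fun x ↦ by rw [val_sectionGeod hh hk, fiberGeod_zero (hh x) (hk x)]

theorem sectionGeod_one (hh : h ∈ HermMetric n F E) (hk : k ∈ HermMetric n F E) :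
    sectionGeod h k 1 = k :=
  HermSection.ext_val fun x ↦ by rw [val_sectionGeod hh hk, fiberGeod_one (hh x) (hk x)]

theorem isC1CurveOn_sectionGeod [IsManifold (𝓡 n) ∞ M] (hh : h ∈ HermMetric n F E)
    (hk : k ∈ HermMetric n F E) (a b : ℝ) :
    IsC1CurveOn (sectionGeod h k) (sectionGeodVelocity h k) a b := by
  refine ⟨Continuous.continuousOn ?_, fun t _ ↦ ?_⟩
  · refine continuous_of_localMatrix_eq hh hk (τ := fun s ↦ (s, s))
      (contDiff_id.prodMk contDiff_id) fun s x b ↦ ?_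
    rw [val_sectionGeodVelocity hh hk, formMatrix_fiberGeodVelocity b (hh x) (hk x)]
  · classical
    have hc : Continuous fun s ↦
        if s = t then sectionGeodVelocity h k t else slope (sectionGeod h k) t s := by
      refine continuous_of_localMatrix_eq hh hk (τ := fun s ↦ (t, s))
        (contDiff_const.prodMk contDiff_id) fun s x b ↦ ?_
      split_ifs with hs
      · rw [val_sectionGeodVelocity hh hk, formMatrix_fiberGeodVelocity b (hh x) (hk x), hs]
      · rw [HermSection.val_slope, ← formMatrix_slope_fiberGeod b (hh x) (hk x) hs]
        simp only [slope_def_module, val_sectionGeod hh hk]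
    have ht := (hc.tendsto t).mono_left
      (nhdsWithin_le_nhds (s := Icc a b \ {t}))
    rw [if_pos rfl] at ht
    refine ht.congr' ?_
    filter_upwards [self_mem_nhdsWithin] with s hs
    exact if_neg hs.2

end SectionGeodesics

/-! ### The `L²` geometry of the space of Hermitian metrics -/

section SectionDistance

open scoped ComplexOrder Matrix Matrix.Norms.Operator

variable {n : ℕ} {M : Type*} [TopologicalSpace M] [ChartedSpace (EuclideanSpace ℝ (Fin n)) M]
  {F : Type*} [NormedAddCommGroup F]
  {E : M → Type*} [∀ x, AddCommGroup (E x)] [∀ x, Module ℂ (E x)]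
  [TopologicalSpace (TotalSpace F E)] [∀ x, TopologicalSpace (E x)] [FiberBundle F E]

/-- The integral of the squared fibrewise distance of two Hermitian metrics. -/
def sectionSqDist [MeasurableSpace M] [∀ x, FiniteDimensional ℂ (E x)] (μ : Measure M)
    (α : M → ℝ) (h k : HermSection n F E) : ℝ :=
  ∫ x, fiberSqDist (α x) (h.val x) (k.val x) ∂μ

theorem sectionNorm_eq [∀ x, FiniteDimensional ℂ (E x)] [MeasurableSpace M] {μ : Measure M}
    {α : M → ℝ} {P : HermSection n F E} (hP : P ∈ HermMetric n F E) (m : HermSection n F E) :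
    sectionNorm μ α P m = √(∫ x, fiberBound (α x) (P.val x) (P.val x) (m.val x) ∂μ) := by
  rw [sectionNorm, sectionInner]
  simp only [fun x ↦ fiberInner_self_eq (α x) (hP x) (m.val x)]

variable [NormedSpace ℂ F] [FiniteDimensional ℂ F]

/-- A differentiable curve of sections is continuous, in the sense of local uniform convergence. -/
theorem LocallyTendsto.of_tendsto_slope {c : ℝ → HermSection n F E} {w : HermSection n F E} {t : ℝ}
    {s : Set ℝ} (h : Tendsto (slope c t) (𝓝[s \ {t}] t) (𝓝 w)) :
    LocallyTendsto c (𝓝[s \ {t}] t) (c t) := by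
  intro x
  have h0 : Tendsto (fun s ↦ s - t) (𝓝[s \ {t}] t) (𝓝 0) := by
    have : Tendsto (fun s ↦ s - t) (𝓝 t) (𝓝 (t - t)) :=
      (continuous_id.sub continuous_const).tendsto t
    rw [sub_self] at this
    exact this.mono_left nhdsWithin_le_nhds
  have := (locallyTendsto_const (𝓝[s \ {t}] t) (c t) x).add
    ((h0.comp tendsto_fst).smul (h.locallyTendsto x))
  rw [zero_smul, add_zero] at this
  refine this.congr fun p ↦ ?_
  conv_rhs => rw [IsC1CurveOn.eq_add_smul_slope c t p.1]
  rfl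

variable [VectorBundle ℂ F E] [∀ x, FiniteDimensional ℂ (E x)] {α : M → ℝ}
  {P Q m : HermSection n F E}

theorem tendsto_fiberBound_of_localMatrix {β : Type*} {l : Filter β} {x : M} {y : β → M}
    {p q u : β → HermSection n F E} (hα : Continuous α) (hP : P ∈ HermMetric n F E)
    (hQ : Q ∈ HermMetric n F E) (hp' : ∀ᶠ s in l, p s ∈ HermMetric n F E)
    (hq' : ∀ᶠ s in l, q s ∈ HermMetric n F E) (hy : Tendsto y l (𝓝 x))
    (hp : Tendsto (fun s ↦ localMatrix (F := F) (p s).1 x (y s)) l (𝓝 (localMatrix P.1 x x)))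
    (hq : Tendsto (fun s ↦ localMatrix (F := F) (q s).1 x (y s)) l (𝓝 (localMatrix Q.1 x x)))
    (hu : Tendsto (fun s ↦ localMatrix (F := F) (u s).1 x (y s)) l (𝓝 (localMatrix m.1 x x))) :
    Tendsto (fun s ↦ fiberBound (α (y s)) ((p s).val (y s)) ((q s).val (y s)) ((u s).val (y s))) l
      (𝓝 (fiberBound (α x) (P.val x) (Q.val x) (m.val x))) := by
  have hx := FiberBundle.mem_baseSet_trivializationAt' (F := F) (E := E) x
  have h1 := tendsto_matBound (posDef_localMatrix hP hx) (posDef_localMatrix hQ hx)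
    ((hα.tendsto x).comp hy) hp hq hu
  rw [fiberBound_eq (localFrame hx) (α x) (hP x) (hQ x), P.formMatrix_val hx, Q.formMatrix_val hx,
    m.formMatrix_val hx]
  refine h1.congr' ?_
  filter_upwards [hp', hq', hy ((trivializationAt F E x).open_baseSet.mem_nhds hx)]
    with s h1 h2 hz
  rw [fiberBound_eq (localFrame hz) (α (y s)) (h1 _) (h2 _),
    (p s).formMatrix_val hz, (q s).formMatrix_val hz, (u s).formMatrix_val hz]
  rfl

theorem continuous_fiberBound (hα : Continuous α) (hP : P ∈ HermMetric n F E)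
    (hQ : Q ∈ HermMetric n F E) (m : HermSection n F E) :
    Continuous fun x ↦ fiberBound (α x) (P.val x) (Q.val x) (m.val x) :=
  continuous_iff_continuousAt.2 fun x ↦
    tendsto_fiberBound_of_localMatrix (y := fun y ↦ y) (p := fun _ ↦ P) (q := fun _ ↦ Q)
      (u := fun _ ↦ m) hα hP hQ (Eventually.of_forall fun _ ↦ hP)
      (Eventually.of_forall fun _ ↦ hQ) tendsto_id (P.continuousAt_localMatrix x)
      (Q.continuousAt_localMatrix x) (m.continuousAt_localMatrix x)

theorem fiberSqDist_eq_fiberBound (hP : P ∈ HermMetric n F E)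
    (hQ : Q ∈ HermMetric n F E) (t : ℝ) (x : M) :
    fiberSqDist (α x) (P.val x) (Q.val x) = fiberBound (α x) ((sectionGeod P Q t).val x)
      ((sectionGeod P Q t).val x) ((sectionGeodVelocity P Q t).val x) := by
  rw [← fiberInner_self_eq _ (sectionGeod_mem hP hQ t x), val_sectionGeod hP hQ,
    val_sectionGeodVelocity hP hQ, fiberInner_fiberGeodVelocity (hP x) (hQ x)]

theorem continuous_fiberSqDist (hα : Continuous α) (hP : P ∈ HermMetric n F E)
    (hQ : Q ∈ HermMetric n F E) :
    Continuous fun x ↦ fiberSqDist (α x) (P.val x) (Q.val x) := by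
  simp only [fiberSqDist_eq_fiberBound hP hQ 0]
  exact continuous_fiberBound hα (sectionGeod_mem hP hQ 0) (sectionGeod_mem hP hQ 0) _

variable [CompactSpace M] [MeasurableSpace M] [BorelSpace M] {μ : Measure M} [IsFiniteMeasure μ]

theorem Continuous.integrable_of_compactSpace {f : M → ℝ} (hf : Continuous f) :
    Integrable f μ := by
  obtain ⟨B, hB⟩ := isCompact_univ.exists_bound_of_continuousOn hf.continuousOn
  exact Integrable.of_bound hf.aestronglyMeasurable B (Eventually.of_forall fun x ↦ hB x trivial)

theorem tendsto_integral_fiberBound {β : Type*} {l : Filter β} [l.IsCountablyGenerated]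
    {p q u : β → HermSection n F E} (hα : Continuous α) (hP : P ∈ HermMetric n F E)
    (hQ : Q ∈ HermMetric n F E) (hp' : ∀ᶠ s in l, p s ∈ HermMetric n F E)
    (hq' : ∀ᶠ s in l, q s ∈ HermMetric n F E) (hp : LocallyTendsto p l P)
    (hq : LocallyTendsto q l Q) (hu : LocallyTendsto u l m) :
    Tendsto (fun s ↦ ∫ x, fiberBound (α x) ((p s).val x) ((q s).val x) ((u s).val x) ∂μ) l
      (𝓝 (∫ x, fiberBound (α x) (P.val x) (Q.val x) (m.val x) ∂μ)) := by
  have hc := continuous_fiberBound hα hP hQ m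
  have hunif : TendstoUniformly
      (fun s x ↦ fiberBound (α x) ((p s).val x) ((q s).val x) ((u s).val x))
      (fun x ↦ fiberBound (α x) (P.val x) (Q.val x) (m.val x)) l := by
    rw [← tendstoLocallyUniformly_iff_tendstoUniformly_of_compactSpace,
      tendstoLocallyUniformly_iff_forall_tendsto]
    intro x
    have h1 := tendsto_fiberBound_of_localMatrix (y := Prod.snd) hα hP hQ
      (hp'.prod_inl _) (hq'.prod_inl _) (tendsto_snd (f := l)) (hp x) (hq x) (hu x)
    have h2 := (hc.tendsto x).comp (tendsto_snd (f := l))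
    exact (h2.prodMk_nhds h1).mono_right (nhds_le_uniformity _)
  obtain ⟨B, hB⟩ := isCompact_univ.exists_bound_of_continuousOn hc.continuousOn
  refine tendsto_integral_filter_of_norm_le_const ?_ ⟨B + 1, ?_⟩ ?_
  · filter_upwards [hp', hq'] with s h1 h2
    exact (continuous_fiberBound hα h1 h2 (u s)).aestronglyMeasurable
  · filter_upwards [Metric.tendstoUniformly_iff.1 hunif 1 one_pos] with s hs
    refine Eventually.of_forall fun x ↦ ?_
    have h1 := hs x
    rw [dist_comm, dist_eq_norm] at h1
    have h2 := norm_le_insert' (fiberBound (α x) ((p s).val x) ((q s).val x) ((u s).val x))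
      (fiberBound (α x) (P.val x) (Q.val x) (m.val x))
    linarith [hB x trivial]
  · exact Eventually.of_forall fun x ↦ hunif.tendsto_at x

theorem integrable_fiberSqDist (hα : Continuous α) (hP : P ∈ HermMetric n F E)
    (hQ : Q ∈ HermMetric n F E) :
    Integrable (fun x ↦ fiberSqDist (α x) (P.val x) (Q.val x)) μ :=
  (continuous_fiberSqDist hα hP hQ).integrable_of_compactSpace

/-- The squared `L²` distance of Hermitian metrics satisfies the CAT(0) inequality, because the
squared distance in each fiber does. -/
theorem section_isCATZeroSqDist [IsManifold (𝓡 n) ∞ M] [μ.IsOpenPosMeasure] (hα : Continuous α)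
    (hα' : ∀ x, -(1 / (Module.finrank ℂ F : ℝ)) < α x) :
    IsCATZeroSqDist (HermMetric n F E) (sectionNorm μ α) (sectionSqDist μ α) sectionGeod
      sectionGeodVelocity := by
  have hα'' : ∀ x, -(1 / (Module.finrank ℂ (E x) : ℝ)) < α x := fun x ↦ by
    rw [finrank_fiber F x]
    exact hα' x
  have hnn : ∀ h ∈ HermMetric n F E, ∀ k ∈ HermMetric n F E, ∀ x,
      0 ≤ fiberSqDist (α x) (h.val x) (k.val x) := fun h hh k hk x ↦
    fiberSqDist_nonneg (hh x) (hk x) (hα'' x)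
  exact
  { nonneg := fun h hh k hk ↦ integral_nonneg fun x ↦ hnn h hh k hk x
    symm := fun h hh k hk ↦ by
      simp only [sectionSqDist, fun x ↦ fiberSqDist_comm (hh x) (hk x) (α x)]
    self := fun h hh ↦ by
      simp only [sectionSqDist, fun x ↦ fiberSqDist_self (α x) (hh x), integral_zero]
    eq_of_eq_zero := fun h hh k hk h0 ↦ by
      have h1 := (integral_eq_zero_iff_of_nonneg (hnn h hh k hk)
        (integrable_fiberSqDist hα hh hk)).1 h0
      have h2 := (continuous_fiberSqDist hα hh hk).ae_eq_iff_eq μ continuous_zero |>.1 h1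
      exact HermSection.ext_val fun x ↦
        eq_of_fiberSqDist_eq_zero (hh x) (hk x) (hα'' x) (congrFun h2 x)
    source := fun h hh k hk ↦ sectionGeod_zero hh hk
    target := fun h hh k hk ↦ sectionGeod_one hh hk
    mem := fun h hh k hk t _ ↦ sectionGeod_mem hh hk t
    isC1 := fun h hh k hk ↦ isC1CurveOn_sectionGeod hh hk 0 1
    speed := fun h hh k hk t _ ↦ by
      rw [sectionNorm_eq (sectionGeod_mem hh hk t), sectionSqDist]
      simp only [← fiberSqDist_eq_fiberBound hh hk]
    cat := fun h hh k hk r hr t ht ↦ by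
      have i1 := (integrable_fiberSqDist (μ := μ) hα hr hh).const_mul (1 - t)
      have i2 := (integrable_fiberSqDist (μ := μ) hα hr hk).const_mul t
      have i3 := (integrable_fiberSqDist (μ := μ) hα hh hk).const_mul (t * (1 - t))
      have i12 : Integrable (fun x ↦ (1 - t) * fiberSqDist (α x) (r.val x) (h.val x) +
          t * fiberSqDist (α x) (r.val x) (k.val x)) μ := i1.add i2
      have e : ∫ x, ((1 - t) * fiberSqDist (α x) (r.val x) (h.val x) +
          t * fiberSqDist (α x) (r.val x) (k.val x) -
          t * (1 - t) * fiberSqDist (α x) (h.val x) (k.val x)) ∂μ =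
          (1 - t) * sectionSqDist μ α r h + t * sectionSqDist μ α r k -
            t * (1 - t) * sectionSqDist μ α h k := by
        rw [integral_sub i12 i3, integral_add i1 i2, integral_const_mul,
          integral_const_mul, integral_const_mul]
        rfl
      rw [← e]
      refine integral_mono (integrable_fiberSqDist hα hr (sectionGeod_mem hh hk t))
        (i12.sub i3) fun x ↦ ?_
      simp only [val_sectionGeod hh hk]
      exact fiberSqDist_cat (hh x) (hk x) (α x) (hr x) ht
    nrm_nonneg := fun h v ↦ Real.sqrt_nonneg _
    nrm_continuousOn := fun c w a b hc hS t ht ↦ by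
      have hev : ∀ᶠ s in 𝓝[Icc a b \ {t}] t, c s ∈ HermMetric n F E := by
        filter_upwards [self_mem_nhdsWithin] with s hs using hS s hs.1
      have hct := LocallyTendsto.of_tendsto_slope (hc.2 t ht)
      rw [← continuousWithinAt_sdiff_self]
      have := (tendsto_integral_fiberBound (μ := μ) hα (hS t ht) (hS t ht) hev hev hct hct
        ((hc.1 t ht).mono sdiff_subset).tendsto.locallyTendsto).sqrt
      rw [ContinuousWithinAt, sectionNorm_eq (hS t ht)]
      refine this.congr' ?_
      filter_upwards [hev] with s hs
      rw [sectionNorm_eq hs]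
    sqrt_le := fun c w a b hc hS t ht r hr ↦ by
      have hev : ∀ᶠ s in 𝓝[Icc a b \ {t}] t, c s ∈ HermMetric n F E := by
        filter_upwards [self_mem_nhdsWithin] with s hs using hS s hs.1
      rw [sectionNorm_eq (hS t ht)] at hr
      refine eventually_sqrt_le_of_tendsto (tendsto_integral_fiberBound (μ := μ) hα (hS t ht)
        (hS t ht) (Eventually.of_forall fun _ ↦ hS t ht) hev (locallyTendsto_const _ (c t))
        (LocallyTendsto.of_tendsto_slope (hc.2 t ht)) (hc.2 t ht).locallyTendsto) ?_ hr
      filter_upwards [hev] with s hs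
      rw [sectionSqDist, ← integral_const_mul]
      refine integral_mono (integrable_fiberSqDist hα (hS t ht) hs)
        ((continuous_fiberBound hα (hS t ht) hs _).integrable_of_compactSpace.const_mul _)
        fun x ↦ fiberSqDist_le_fiberBound (hS t ht x) (hs x) (α x) ?_
      conv_lhs => rw [IsC1CurveOn.eq_add_smul_slope c t s]
      rfl }

end SectionDistance

end

theorem theorem4p1
    -- a closed smooth manifold with a smooth Riemannian metric
    {n : ℕ} {M : Type*} [TopologicalSpace M] [ChartedSpace (EuclideanSpace ℝ (Fin n)) M]
    [IsManifold (𝓡 n) ∞ M] [T2Space M] [CompactSpace M] [MeasurableSpace M] [BorelSpace M]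
    (g : ContMDiffRiemannianMetric (𝓡 n) ∞ (EuclideanSpace ℝ (Fin n))
      (fun x : M ↦ TangentSpace (𝓡 n) x))
    -- a smooth complex vector bundle of finite rank
    {F : Type*} [NormedAddCommGroup F] [NormedSpace ℂ F] [FiniteDimensional ℂ F]
    {E : M → Type*} [∀ x, AddCommGroup (E x)] [∀ x, Module ℂ (E x)]
    [∀ x, FiniteDimensional ℂ (E x)]
    [TopologicalSpace (TotalSpace F E)] [∀ x, TopologicalSpace (E x)] [FiberBundle F E]
    [VectorBundle ℂ F E] [VectorBundle ℝ F E] [ContMDiffVectorBundle ∞ F E (𝓡 n)]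
    -- the parameter function
    (α : M → ℝ) (hα : ContMDiff (𝓡 n) 𝓘(ℝ, ℝ) ∞ α)
    (hα' : ∀ x, -(1 / (Module.finrank ℂ F : ℝ)) < α x)
    -- two smooth Hermitian metrics
    (h₁ h₂ : HermSection n F E) (hh₁ : h₁ ∈ HermMetric n F E) (hh₂ : h₂ ∈ HermMetric n F E) :
    -- the distance formula
    (Integrable (fun x ↦ fiberDist (α x) (h₁.val x) (h₂.val x) ^ 2) (riemannianVolume g) ∧
      sectionDist (riemannianVolume g) α h₁ h₂ =
        √(∫ x, fiberDist (α x) (h₁.val x) (h₂.val x) ^ 2 ∂(riemannianVolume g))) ∧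
    -- the pointwise logarithm `v`, which is unique in each fiber, is a smooth section
    ∃ v : HermSection n F E,
      (∀ (x : M) (u : Herm (E x)),
        endExp (hInv (h₁.val x) u) = hInv (h₁.val x) (h₂.val x) ↔ u = v.val x) ∧
      -- the path `γ(t) = h₁ exp(t h₁⁻¹ v)` of Hermitian metrics
      ∃ γ : PiecewiseC1Path (HermMetric n F E) h₁ h₂,
        (∀ t ∈ Icc (0 : ℝ) 1, ∀ x : M,
          hInv (h₁.val x) ((γ.toFun t).val x) = endExp ((t : ℂ) • hInv (h₁.val x) (v.val x))) ∧
        -- it is `C¹` and solves the geodesic equation: `γ⁻¹ γ'` is constant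
        IsC1CurveOn γ.toFun γ.velocity 0 1 ∧
        (∀ t ∈ Icc (0 : ℝ) 1, ∀ x : M,
          hInv ((γ.toFun t).val x) (γ.velocity t |>.val x) = hInv (h₁.val x) (v.val x)) ∧
        -- it is a minimizing geodesic in each fiber
        (∀ x : M, ∀ s ∈ Icc (0 : ℝ) 1, ∀ t ∈ Icc (0 : ℝ) 1,
          fiberDist (α x) ((γ.toFun s).val x) ((γ.toFun t).val x) =
            |s - t| * fiberDist (α x) (h₁.val x) (h₂.val x)) ∧
        -- it is a shortest path, and a minimizing geodesic of the metric space
        γ.length (sectionNorm (riemannianVolume g) α) =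
          sectionDist (riemannianVolume g) α h₁ h₂ ∧
        (∀ s ∈ Icc (0 : ℝ) 1, ∀ t ∈ Icc (0 : ℝ) 1,
          sectionDist (riemannianVolume g) α (γ.toFun s) (γ.toFun t) =
            |s - t| * sectionDist (riemannianVolume g) α h₁ h₂) ∧
        -- every shortest path is a monotone reparametrization of it
        (∀ c : PiecewiseC1Path (HermMetric n F E) h₁ h₂,
          c.length (sectionNorm (riemannianVolume g) α) =
            sectionDist (riemannianVolume g) α h₁ h₂ →
          ∃ φ : ℝ → ℝ, ContinuousOn φ (Icc 0 1) ∧ MonotoneOn φ (Icc 0 1) ∧ φ 0 = 0 ∧ φ 1 = 1 ∧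
            ∀ t ∈ Icc (0 : ℝ) 1, c.toFun t = γ.toFun (φ t)) ∧
        -- it is the only minimizing geodesic of the metric space from `h₁` to `h₂`
        (∀ c : ℝ → HermSection n F E, (∀ t ∈ Icc (0 : ℝ) 1, c t ∈ HermMetric n F E) →
          c 0 = h₁ → c 1 = h₂ →
          (∀ s ∈ Icc (0 : ℝ) 1, ∀ t ∈ Icc (0 : ℝ) 1,
            sectionDist (riemannianVolume g) α (c s) (c t) =
              |s - t| * sectionDist (riemannianVolume g) α h₁ h₂) →
          ∀ t ∈ Icc (0 : ℝ) 1, c t = γ.toFun t) := by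
  have := isFiniteMeasure_riemannianVolume g
  have := isOpenPosMeasure_riemannianVolume g
  have hαc : Continuous α := hα.continuous
  have hα'' : ∀ x, -(1 / (Module.finrank ℂ (E x) : ℝ)) < α x := fun x ↦ by
    rw [finrank_fiber F x]
    exact hα' x
  have H := section_isCATZeroSqDist (n := n) (F := F) (E := E) (μ := riemannianVolume g) hαc hα'
  have hdist : ∀ h ∈ HermMetric n F E, ∀ k ∈ HermMetric n F E,
      sectionDist (riemannianVolume g) α h k = √(sectionSqDist (riemannianVolume g) α h k) :=
    fun h hh k hk ↦ H.pathDist_eq hh hk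
  have hsq : ∀ x, fiberDist (α x) (h₁.val x) (h₂.val x) ^ 2 =
      fiberSqDist (α x) (h₁.val x) (h₂.val x) := fun x ↦ fiberDist_sq (hα'' x) (hh₁ x) (hh₂ x)
  refine ⟨⟨?_, ?_⟩, sectionLog h₁ h₂, fun x u ↦ ?_, H.path hh₁ hh₂, fun t _ x ↦ ?_,
    H.isC1 _ hh₁ _ hh₂, fun t _ x ↦ ?_, fun x s hs t ht ↦ ?_, ?_, fun s hs t ht ↦ ?_,
    fun c hc ↦ ?_, fun c hc h0 h1 h ↦ ?_⟩
  · simp only [hsq]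
    exact integrable_fiberSqDist hαc hh₁ hh₂
  · simp only [hsq]
    exact hdist _ hh₁ _ hh₂
  · rw [val_sectionLog hh₁ hh₂]
    exact endExp_hInv_eq_iff (hh₁ x) (hh₂ x) u
  · change hInv (h₁.val x) ((sectionGeod h₁ h₂ t).val x) = _
    rw [val_sectionLog hh₁ hh₂, val_sectionGeod hh₁ hh₂, hInv_fiberGeod (hh₁ x) (hh₂ x)]
  · change hInv ((sectionGeod h₁ h₂ t).val x) ((sectionGeodVelocity h₁ h₂ t).val x) = _
    rw [val_sectionLog hh₁ hh₂, val_sectionGeod hh₁ hh₂, val_sectionGeodVelocity hh₁ hh₂,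
      hInv_fiberGeod_velocity (hh₁ x) (hh₂ x)]
  · change fiberDist (α x) ((sectionGeod h₁ h₂ s).val x) ((sectionGeod h₁ h₂ t).val x) = _
    rw [val_sectionGeod hh₁ hh₂, val_sectionGeod hh₁ hh₂,
      fiberDist_fiberGeod (hα'' x) (hh₁ x) (hh₂ x) hs ht]
  · rw [hdist _ hh₁ _ hh₂]
    exact H.length_path hh₁ hh₂
  · rw [hdist _ hh₁ _ hh₂, hdist _ ((H.path hh₁ hh₂).mem s hs) _ ((H.path hh₁ hh₂).mem t ht)]
    exact H.sqrt_geodesic hh₁ hh₂ hs ht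
  · exact H.exists_reparam_of_length_eq hh₁ hh₂ c hc
  · exact H.eq_geodesic_of_isometric hh₁ hh₂ hc h0 h1 h
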